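/- \textbf{Definitions.} Write $[m]=\{1,\dots,m\}$. Graphs are finite and simple, with labelled vertices and edges. A planar embedding of a connected graph is an embedding into the sphere, considered up to orientation-preserving homeomorphism; equivalently, it is a rotation system (a cyclic order of the edges at each vertex) satisfying Euler's formula $|V|-|E|+|F|=2$. \emph{Hybrid deletion sequences.} Let $A$ be a set of edge labels, called strict. A graph $H$ is a hybrid subgraph of $G$ if some subgraph $G'$ of $G$ is isomorphic to $H$ by an isomorphism that fixes the labels of the edges in $A\cap E(H)$. A hybrid deletion sequence is a sequence $(G_1,\dots,G_n)$ together with a set $A$ of strict labels such that, for each $i<n$, one of $G_i,G_{i+1}$ is a hybrid subgraph of the other. A simultaneous embedding of it is a sequence $(\sigma_1,\dots,\sigma_n)$ of planar embeddings of $G_1,\dots,G_n$ such that for each $i<n$: if $G_i$ is a hybrid subgraph of $G_{i+1}$, then $\sigma_i$ is, up to an isomorphism fixing the labels in $A\cap E(G_i)$, the embedding induced by $\sigma_{i+1}$ on some subgraph of $G_{i+1}$; otherwise $\sigma_{i+1}$ is, up to an isomorphism fixing the labels in $A\cap E(G_{i+1})$, the embedding induced by $\sigma_i$ on some subgraph of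 $G_i$. The length of the sequence is $n$, and its size is $\sum_{i=1}^n(|V(G_i)|+|E(G_i)|)$. \emph{Villages.} For $s\ge 1$ and $I\subseteq[s]$, the village $V(s,I)$ is obtained from a wheel with rim $s_1s_2\dots s_{4s}$ (the planet) by adding, for each $i\in I$, a house $H_i$: a path $v_1v_2\dots v_7$ with $v_1=s_{4i-3}$ and $v_7=s_{4i-1}$, whose other vertices are new, and a new vertex $w$ (with its three edges: the inhabitant of $H_i$) adjacent to $v_2,v_4,v_6$. In an embedding $\sigma$, the inhabitant is inside $H_i$ if it is not on the same side as the centre of the wheel of the cycle formed by $v_1\dots v_7$ and $s_{4i-3}s_{4i-2}s_{4i-1}$. Put $T_\sigma(H_i)=1$ if it is inside and $T_\sigma(H_i)=0$ otherwise. \emph{Housing sequences.} An $(I,s)$-housing sequence is a hybrid deletion sequence $(G_1,\dots,G_n)$ of 2-connected graphs with fixed isomorphisms from $V(s,I)$ to $G_1$ and to $G_n$ that agree on the planet, such that the planet (with these labels) is a subgraph of every $G_i$; in every $G_i$ the centre of the planet has strictly larger degree than every other vertex; and in every simultaneous embedding the embeddings of $G_1$ and $G_n$ correspond to the same embedding of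 $V(s,I)$. Its allocation set is the set of all functions $f\colon I\to\{0,1\}$ for which there is a simultaneous embedding $(\sigma_1,\dots,\sigma_n)$ with $f(i)=T_{\sigma_1}(H_i)$ for all $i\in I$. For a set $P$ of unordered pairs of elements of $I$, let $EQ(P)$ be the set of functions $f\colon I\to\{0,1\}$ with $f(i)=f(j)$ for all $\{i,j\}\in P$. \textbf{Lemma.} Let $m\ge 0$ and $s$ be integers with $s\ge m^3$ and $s>m$, and let $P\subseteq\binom{[m]}{2}$. Then there is an $([m],s)$-housing sequence of length at most $27$ and size at most $400\,s^{4/3}$ whose allocation set is $EQ(P)$. -/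

import Mathlib

namespace HousingSeq

universe u v u' v'

/-! ### Labelled graphs: isomorphisms and 2-connectedness -/

/-- An isomorphism from `G` to `H`, given by a vertex map and an edge map. Only the values on the
vertices and the edges of `G` matter. (As every edge has exactly one pair of ends and `onE` is a
bijection of edge sets, preserving links in one direction also gives the other direction.) -/
structure GraphIso {α : Type u} {β : Type v} {α' : Type u'} {β' : Type v'}
    (G : Graph α β) (H : Graph α' β') where
  onV : α → α'
  onE : β → β'
  bijV : Set.BijOn onV G.vertexSet H.vertexSet
  bijE : Set.BijOn onE G.edgeSet H.edgeSet
  map_isLink : ∀ ⦃e x y⦄, G.IsLink e x y → H.IsLink (onE e) (onV x) (onV y)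

/-- `G` is 2-connected: it has more than two vertices, is connected, and stays connected when any
single vertex is deleted. -/
def TwoConnected {α : Type u} {β : Type v} (G : Graph α β) : Prop :=
  2 < G.vertexSet.ncard ∧ G.toSimpleGraph.Connected ∧
    ∀ x : G.vertexSet, (G.toSimpleGraph.induce {x}ᶜ).Connected

/-- The degree of a vertex (of a loopless graph). -/
noncomputable def degree {α : Type u} {β : Type v} (G : Graph α β) (x : α) : ℕ :=
  (G.incidenceSet x).ncard

/-! ### Planar embeddings as rotation systems of genus zero -/

/-- A dart of `G`: an edge of `G` together with one of its ends, i.e. the edge directed away from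
that end. -/
def Dart {α : Type u} {β : Type v} (G : Graph α β) : Type (max u v) :=
  {d : α × β // G.Inc d.2 d.1}

/-- The vertex at which a dart starts. -/
def Dart.vertex {α : Type u} {β : Type v} {G : Graph α β} (d : Dart G) : α := d.1.1

/-- The edge of a dart. -/
def Dart.edge {α : Type u} {β : Type v} {G : Graph α β} (d : Dart G) : β := d.1.2

/-- The same edge, directed away from its other end. -/
noncomputable def Dart.rev {α : Type u} {β : Type v} {G : Graph α β} (d : Dart G) : Dart G :=
  ⟨(Graph.Inc.other d.2, d.1.2), Graph.Inc.inc_other d.2⟩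

theorem Dart.rev_rev {α : Type u} {β : Type v} {G : Graph α β} (d : Dart G) :
    d.rev.rev = d := by
  have h1 := Graph.Inc.isLink_other d.2
  have h2 := Graph.Inc.isLink_other d.rev.2
  exact Subtype.ext (Prod.ext (h2.right_unique h1.symm) rfl)

/-- Reversal of darts as a permutation. -/
noncomputable def revPerm {α : Type u} {β : Type v} (G : Graph α β) : Equiv.Perm (Dart G) :=
  ⟨Dart.rev, Dart.rev, Dart.rev_rev, Dart.rev_rev⟩

/-- The face permutation of a rotation `next`: go along the dart to its other end, and leave this
end by the next dart in the rotation there. Its cycles are the boundary walks of the faces. -/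
noncomputable def facePerm {α : Type u} {β : Type v} {G : Graph α β}
    (next : Equiv.Perm (Dart G)) : Equiv.Perm (Dart G) :=
  (revPerm G).trans next

/-- A planar embedding of a (finite, loopless, connected) graph, up to orientation preserving
homeomorphism of the sphere: a rotation system (a cyclic order of the darts at each vertex) which
satisfies Euler's formula `|V| + |F| = |E| + 2`. -/
structure PlanarEmbedding {α : Type u} {β : Type v} (G : Graph α β) where
  next : Equiv.Perm (Dart G)
  isCycleOn : ∀ x ∈ G.vertexSet, next.IsCycleOn {d : Dart G | d.vertex = x}
  euler : G.vertexSet.ncard + Nat.card (Quotient (Equiv.Perm.SameCycle.setoid (facePerm next))) =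
    G.edgeSet.ncard + 2

/-- Two vertices `x`, `y` off the cycle with edge set `C` lie in the same of the two disks into
which this cycle divides the sphere: a face at `x` can be reached from a face at `y` by passing from
face to face through edges which are not in `C`. (Two darts belong to the same face if and only if
they are in the same cycle of the face permutation; `d` and `d.rev` belong to the two faces at the
edge of `d`.) -/
def PlanarEmbedding.SameSide {α : Type u} {β : Type v} {G : Graph α β} (σ : PlanarEmbedding G)
    (C : Set β) (x y : α) : Prop :=
  ∃ d d' : Dart G, d.vertex = x ∧ d'.vertex = y ∧
    Relation.EqvGen (fun a b => b = facePerm σ.next a ∨ (a.edge ∉ C ∧ b = a.rev)) d d'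

/-- The darts of a subgraph are darts of the whole graph. -/
def Dart.incl {α : Type u} {β : Type v} {H G : Graph α β} (h : H ≤ G) (d : Dart H) : Dart G :=
  ⟨d.1, d.2.mono h⟩

/-- `ψ` is the embedding which the embedding `φ` of `G` induces on its subgraph `H`: the successor
of a dart of `H` is the first dart of `H` that follows it in the rotation of `φ`. -/
def InducedOn {α : Type u} {β : Type v} {H G : Graph α β} (h : H ≤ G) (φ : PlanarEmbedding G)
    (ψ : PlanarEmbedding H) : Prop :=
  ∀ d : Dart H, ∃ k : ℕ, 0 < k ∧ (φ.next ^ k) (d.incl h) = (ψ.next d).incl h ∧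
    ∀ j : ℕ, 0 < j → j < k → (φ.next ^ j) (d.incl h) ∉ Set.range (Dart.incl h)

/-- The action of an isomorphism on darts. -/
def GraphIso.dart {α : Type u} {β : Type v} {α' : Type u'} {β' : Type v'}
    {G : Graph α β} {H : Graph α' β'} (θ : GraphIso G H) (d : Dart G) : Dart H :=
  ⟨(θ.onV d.1.1, θ.onE d.1.2), by
    obtain ⟨y, hy⟩ := d.2
    exact ⟨_, θ.map_isLink hy⟩⟩

/-- The isomorphism `θ` carries the embedding `σ` of `G` to the embedding `τ` of `H`. -/
def GraphIso.Carries {α : Type u} {β : Type v} {α' : Type u'} {β' : Type v'}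
    {G : Graph α β} {H : Graph α' β'} (θ : GraphIso G H) (σ : PlanarEmbedding G)
    (τ : PlanarEmbedding H) : Prop :=
  ∀ d : Dart G, θ.dart (σ.next d) = τ.next (θ.dart d)

/-! ### Hybrid deletion sequences and their simultaneous embeddings -/

/-- An isomorphism that fixes all labels of edges of its domain which lie in `A`. -/
def GraphIso.Fixes {α : Type u} {β : Type v} {H G : Graph α β} (θ : GraphIso H G) (A : Set β) :
    Prop :=
  ∀ e ∈ A ∩ H.edgeSet, θ.onE e = e

/-- `H` is a hybrid subgraph of `G` w.r.t. `A ∩ E(H)`: it is obtained from a subgraph of `G` by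
relabelling vertices and relabelling some edges outside of `A ∩ E(H)`. -/
def IsHybridSubgraph {α : Type u} {β : Type v} (A : Set β) (H G : Graph α β) : Prop :=
  ∃ G' : Graph α β, G' ≤ G ∧ ∃ θ : GraphIso H G', θ.Fixes A

/-- The embedding `σ` of `H` is, up to an isomorphism fixing `A ∩ E(H)`, the embedding induced by
the embedding `φ` of `G` on some subgraph of `G`. -/
def HybridInduces {α : Type u} {β : Type v} (A : Set β) {H G : Graph α β}
    (φ : PlanarEmbedding G) (σ : PlanarEmbedding H) : Prop :=
  ∃ (G' : Graph α β) (h : G' ≤ G) (θ : GraphIso H G') (ψ : PlanarEmbedding G'),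
    θ.Fixes A ∧ InducedOn h φ ψ ∧ θ.Carries σ ψ

/-- A hybrid deletion sequence of finite simple graphs with vertex labels in `α` and edge labels in
`β`. An edge label is either strict in all hybrid subgraph relations of the sequence or in none of
them; `strict` is the set of strict labels. The graphs are `graph 0, …, graph steps`. -/
structure HybridDeletionSequence (α : Type u) (β : Type v) where
  steps : ℕ
  graph : Fin (steps + 1) → Graph α β
  strict : Set β
  finite_vertexSet : ∀ i, (graph i).vertexSet.Finite
  finite_edgeSet : ∀ i, (graph i).edgeSet.Finite
  simple : ∀ i, (graph i).Simple
  step : ∀ i : Fin steps, IsHybridSubgraph strict (graph i.castSucc) (graph i.succ) ∨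
    IsHybridSubgraph strict (graph i.succ) (graph i.castSucc)

/-- The number of graphs in the sequence. -/
def HybridDeletionSequence.length {α : Type u} {β : Type v} (S : HybridDeletionSequence α β) : ℕ :=
  S.steps + 1

/-- The total number of vertices and edges of all graphs in the sequence. -/
noncomputable def HybridDeletionSequence.size {α : Type u} {β : Type v}
    (S : HybridDeletionSequence α β) : ℕ :=
  ∑ i, ((S.graph i).vertexSet.ncard + (S.graph i).edgeSet.ncard)

/-- A (hybrid) simultaneous embedding of a hybrid deletion sequence. -/
structure SimultaneousEmbedding {α : Type u} {β : Type v} (S : HybridDeletionSequence α β) where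
  emb : ∀ i, PlanarEmbedding (S.graph i)
  forward : ∀ i : Fin S.steps,
    IsHybridSubgraph S.strict (S.graph i.castSucc) (S.graph i.succ) →
      HybridInduces S.strict (emb i.succ) (emb i.castSucc)
  backward : ∀ i : Fin S.steps,
    ¬ IsHybridSubgraph S.strict (S.graph i.castSucc) (S.graph i.succ) →
      HybridInduces S.strict (emb i.castSucc) (emb i.succ)

/-! ### Villages -/

/-- Labels for the vertices of a village: the centre of the planet, the rim vertices `s_k`, the
vertices `v_k` (`2 ≤ k ≤ 6`) of the `i`-th house, and the central vertex `w` of its claw. -/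
inductive VillageVertex : Type
  | centre : VillageVertex
  | rim (k : ℕ) : VillageVertex
  | house (i k : ℕ) : VillageVertex
  | inhabitant (i : ℕ) : VillageVertex

/-- Labels for the edges of a village: the spokes, the surface edges `s_k s_{k+1}`, the edges
`v_k v_{k+1}` of the `i`-th house, and the edges `w v_{2k}` of its claw. -/
inductive VillageEdge : Type
  | spoke (k : ℕ) : VillageEdge
  | surface (k : ℕ) : VillageEdge
  | wall (i k : ℕ) : VillageEdge
  | claw (i k : ℕ) : VillageEdge

/-- The vertex `v_k` of the `i`-th house, where `v_1 = s_{4i-3}` and `v_7 = s_{4i-1}`. -/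
def houseVertex (i k : ℕ) : VillageVertex :=
  if k = 1 then .rim (4 * i - 3) else if k = 7 then .rim (4 * i - 1) else .house i k

/-- The two ends of an edge of a village on a planet of equator `m` (with rim vertices
`s_1, …, s_{4m}` in cyclic order). -/
def villageEnds (m : ℕ) : VillageEdge → VillageVertex × VillageVertex
  | .spoke k => (.centre, .rim k)
  | .surface k => (.rim k, .rim (if k = 4 * m then 1 else k + 1))
  | .wall i k => (houseVertex i k, houseVertex i (k + 1))
  | .claw i k => (.inhabitant i, houseVertex i (2 * k))

/-- The vertices of the village `V(m, I)`. -/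
def IsVillageVertex (m : ℕ) (I : Set ℕ) : VillageVertex → Prop
  | .centre => True
  | .rim k => k ∈ Set.Icc 1 (4 * m)
  | .house i k => i ∈ I ∩ Set.Icc 1 m ∧ k ∈ Set.Icc 2 6
  | .inhabitant i => i ∈ I ∩ Set.Icc 1 m

/-- The edges of the village `V(m, I)`. -/
def IsVillageEdge (m : ℕ) (I : Set ℕ) : VillageEdge → Prop
  | .spoke k => k ∈ Set.Icc 1 (4 * m)
  | .surface k => k ∈ Set.Icc 1 (4 * m)
  | .wall i k => i ∈ I ∩ Set.Icc 1 m ∧ k ∈ Set.Icc 1 6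
  | .claw i k => i ∈ I ∩ Set.Icc 1 m ∧ k ∈ Set.Icc 1 3

theorem isVillageVertex_houseVertex {m : ℕ} {I : Set ℕ} {i k : ℕ} (hi : i ∈ I ∩ Set.Icc 1 m)
    (hk : k ∈ Set.Icc 1 7) : IsVillageVertex m I (houseVertex i k) := by
  have h1 := hi.2.1
  have h2 := hi.2.2
  have h3 := hk.1
  have h4 := hk.2
  unfold houseVertex
  split_ifs with h h'
  · exact ⟨by omega, by omega⟩
  · exact ⟨by omega, by omega⟩
  · exact ⟨hi, by omega, by omega⟩

theorem isVillageVertex_ends {m : ℕ} {I : Set ℕ} {e : VillageEdge} (he : IsVillageEdge m I e) :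
    IsVillageVertex m I (villageEnds m e).1 ∧ IsVillageVertex m I (villageEnds m e).2 := by
  cases e with
  | spoke k => exact ⟨trivial, he⟩
  | surface k =>
    refine ⟨he, ?_⟩
    have h1 : 1 ≤ k := he.1
    have h2 : k ≤ 4 * m := he.2
    simp only [villageEnds]
    split_ifs with h
    · exact ⟨le_refl 1, by omega⟩
    · exact ⟨by omega, by omega⟩
  | wall i k =>
    have h1 : 1 ≤ k := he.2.1
    have h2 : k ≤ 6 := he.2.2
    exact ⟨isVillageVertex_houseVertex he.1 ⟨h1, by omega⟩,
      isVillageVertex_houseVertex he.1 ⟨by omega, by omega⟩⟩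
  | claw i k =>
    have h1 : 1 ≤ k := he.2.1
    have h2 : k ≤ 3 := he.2.2
    exact ⟨he.1, isVillageVertex_houseVertex he.1 ⟨by omega, by omega⟩⟩

/-- The village `V(m, I)` with index set `I ⊆ {1, …, m}` on a planet of equator `m`. -/
def village (m : ℕ) (I : Set ℕ) : Graph VillageVertex VillageEdge where
  vertexSet := {x | IsVillageVertex m I x}
  edgeSet := {e | IsVillageEdge m I e}
  IsLink e x y := IsVillageEdge m I e ∧ s(x, y) = s((villageEnds m e).1, (villageEnds m e).2)
  isLink_symm := fun _ _ => ⟨fun _ _ h => ⟨h.1, Sym2.eq_swap.trans h.2⟩⟩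
  eq_or_eq_of_isLink_of_isLink := by
    intro e x y v w h h'
    have := h.2.trans h'.2.symm
    rw [Sym2.eq_iff] at this
    tauto
  edge_mem_iff_exists_isLink := fun _ => ⟨fun h => ⟨_, _, h, rfl⟩, fun ⟨_, _, h⟩ => h.1⟩
  left_mem_of_isLink := by
    intro e x y h
    have h1 := isVillageVertex_ends h.1
    have h2 := h.2
    rw [Sym2.eq_iff] at h2
    rcases h2 with h2 | h2
    · exact h2.1 ▸ h1.1
    · exact h2.1 ▸ h1.2

/-- The planet of equator `m`: a wheel of rim length `4m`. -/
def planet (m : ℕ) : Graph VillageVertex VillageEdge := village m ∅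

/-- The bounding cycle of the `i`-th house: the path `v_1 … v_7` together with the path
`s_{4i-3} s_{4i-2} s_{4i-1}`. -/
def boundingCycle (i : ℕ) : Set VillageEdge :=
  {e | (∃ k ∈ Set.Icc 1 6, e = .wall i k) ∨ e = .surface (4 * i - 3) ∨ e = .surface (4 * i - 2)}

open Classical in
/-- The truth value `T_σ(H_i)` of the `i`-th house in an embedding `σ` of a graph that is
identified with a village by `θ`: it is `true` if the inhabitant is inside, i.e. not on the same
side of the bounding cycle as the centre of the planet. -/
noncomputable def truthValue {α : Type u} {β : Type v} {m : ℕ} {I : Set ℕ} {G : Graph α β}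
    (θ : GraphIso (village m I) G) (σ : PlanarEmbedding G) (i : ℕ) : Bool :=
  decide (¬ σ.SameSide (θ.onE '' boundingCycle i) (θ.onV (.inhabitant i)) (θ.onV .centre))

/-! ### Housing sequences -/

/-- An `(I, m)`-housing sequence. The isomorphisms `first` and `last` identify the first and the
last graph with `V(m, I)`; they agree on the planet, which (with its labels in the first graph) is
a subgraph of all graphs of the sequence. -/
structure HousingSequence (α : Type u) (β : Type v) (I : Set ℕ) (m : ℕ) extends
    HybridDeletionSequence α β where
  index_subset : I ⊆ Set.Icc 1 m
  twoConnected : ∀ i, TwoConnected (graph i)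
  first : GraphIso (village m I) (graph 0)
  last : GraphIso (village m I) (graph (Fin.last steps))
  last_onV : ∀ x ∈ (planet m).vertexSet, last.onV x = first.onV x
  last_onE : ∀ e ∈ (planet m).edgeSet, last.onE e = first.onE e
  planet_mem : ∀ i, ∀ x ∈ (planet m).vertexSet, first.onV x ∈ (graph i).vertexSet
  planet_isLink : ∀ i e x y, (planet m).IsLink e x y →
    (graph i).IsLink (first.onE e) (first.onV x) (first.onV y)
  degree_lt : ∀ i, ∀ x ∈ (graph i).vertexSet, x ≠ first.onV .centre →
    degree (graph i) x < degree (graph i) (first.onV .centre)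
  same_embedding : ∀ Φ : SimultaneousEmbedding toHybridDeletionSequence,
    ∃ τ : PlanarEmbedding (village m I),
      first.Carries τ (Φ.emb 0) ∧ last.Carries τ (Φ.emb (Fin.last steps))

/-- The allocation function of a simultaneous embedding of a housing sequence. -/
noncomputable def HousingSequence.allocation {α : Type u} {β : Type v} {I : Set ℕ} {m : ℕ}
    (S : HousingSequence α β I m) (Φ : SimultaneousEmbedding S.toHybridDeletionSequence) :
    I → Bool :=
  fun i => truthValue S.first (Φ.emb 0) i

/-- The allocation set of a housing sequence. -/
def HousingSequence.allocationSet {α : Type u} {β : Type v} {I : Set ℕ} {m : ℕ}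
    (S : HousingSequence α β I m) : Set (I → Bool) :=
  Set.range S.allocation

/-- `EQ(P)` for a set `P` of unordered pairs of elements of `I`. -/
def EQ {I : Set ℕ} (P : Set (Sym2 I)) : Set (I → Bool) :=
  {f | ∀ i j : I, s(i, j) ∈ P → f i = f j}

end HousingSeq

namespace HousingSeq

set_option linter.unusedSectionVars false

/-! ### Combinatorial maps and the Euler characteristic modulo 2 -/

/-! The village is enlarged to `m ^ 3` houses, and houses are coupled in pairs along a non-crossing
matching (a `Page`). For a pair `i < π i`, the houses are first linked by an edge. The two walls
next to the link that lead down to the planet are then removed, so that both houses form one long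
arch. Finally the two inhabitants are joined by an edge. This edge forces both inhabitants to the
same side of the arch (`nx_linked`), and the steps are then undone. Conversely, any allocation that
is constant on the pairs can be drawn at every stage, because the matching does not cross.

Three pages express every set of equalities (`exists_pages`). The houses form `m * m` blocks of `m`,
read alternately forwards and backwards, so that each house has a column. Two pages couple every
block with its neighbours by nested pairs that preserve the column, hence all blocks carry copies of
the first one. The third page couples columns `a` and `a'` inside block `m * a + a'` if this pair is
in `P`; different pairs use different blocks, so nothing crosses. With three pages the sequence has
21 graphs of size linear in `s`.

All labels are strict. As all vertices have degree at least two, hybrid subgraphs are then honest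
subgraphs (`eq_of_fixes`), and the rotation at a vertex persists as long as its edges do. This
applies to the centre, to the rim vertex 2, and to the vertex `v_4` of each house. These rotations
determine the whole embedding of a village (`village_rigid`), and the last two determine the truth
values (`sameSide_iff`). So the first and last embeddings agree, and the truth values can be
followed through the sequence.

The topology is linear algebra modulo 2. Boundaries of sets of faces lie in the cycle space;
comparing dimensions gives `|V| + |F| ≤ |E| + 2`, with equality exactly if every even edge set is a
boundary (`card_face_le`, `exists_bd_eq`, `euler_of_exists_bd_eq`). Hence each closed walk in an
embedding of genus zero has a two-colouring of its sides (`SideFun`), which plays the role of the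
Jordan curve theorem, and genus zero passes to connected subgraphs (`euler_of_induced`). Planarity
of the largest nets is shown by naming their faces and counting (`euler_netList`). -/

theorem eq_of_sameCycle {D X : Type*} {f : Equiv.Perm D} {c : D → X} (h : ∀ d, c (f d) = c d)
    {d d' : D} (hd : f.SameCycle d d') : c d = c d' := by
  obtain ⟨k, rfl⟩ := hd
  induction k with
  | zero => rfl
  | succ k ih =>
    rw [add_comm, zpow_add, zpow_one, Equiv.Perm.mul_apply, h, ih]
  | pred k ih =>
    rw [ih, sub_eq_add_neg, add_comm, zpow_add, Equiv.Perm.mul_apply, zpow_neg_one]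
    have h1 := h (f⁻¹ ((f ^ (-(k : ℤ))) d))
    rwa [show f (f⁻¹ ((f ^ (-(k : ℤ))) d)) = _ from f.apply_symm_apply _] at h1

/-- A connected combinatorial map: vertices, edges and darts, with the reversal of darts and a
rotation at every vertex. -/
structure CombMap (V E D : Type*) where
  vert : D → V
  edge : D → E
  rev : Equiv.Perm D
  next : Equiv.Perm D
  rev_rev : ∀ d, rev (rev d) = d
  vert_rev_ne : ∀ d, vert (rev d) ≠ vert d
  edge_rev : ∀ d, edge (rev d) = edge d
  edge_eq : ∀ d d', edge d' = edge d → d' = d ∨ d' = rev d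
  edge_surj : Function.Surjective edge
  vert_next : ∀ d, vert (next d) = vert d
  const_vert : ∀ c : D → ZMod 2, (∀ d, c (next d) = c d) → ∃ h : V → ZMod 2, ∀ d, c d = h (vert d)
  conn : ∀ h : V → ZMod 2, (∀ d, h (vert (rev d)) = h (vert d)) → ∀ v w, h v = h w
  nonempty : Nonempty D

namespace CombMap

variable {V E D : Type*} (M : CombMap V E D)

/-- The faces of a combinatorial map. -/
abbrev Face : Type _ := Quotient (Equiv.Perm.SameCycle.setoid (M.rev.trans M.next))

theorem face_next (d : D) :
    (Quotient.mk _ (M.next d) : M.Face) = Quotient.mk _ (M.rev d) := by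
  refine Quotient.sound (Equiv.Perm.SameCycle.symm ⟨1, ?_⟩)
  simp [M.rev_rev]

section

variable [Fintype D]

open Classical in
theorem sum_edge (φ : D → ZMod 2) (d : D) :
    ∑ d' with M.edge d' = M.edge d, φ d' = φ d + φ (M.rev d) := by
  have h : (Finset.univ.filter fun d' => M.edge d' = M.edge d) = {d, M.rev d} := by
    ext d'
    simp only [Finset.mem_filter, Finset.mem_univ, true_and, Finset.mem_insert,
      Finset.mem_singleton]
    refine ⟨M.edge_eq d d', ?_⟩
    rintro (rfl | rfl)
    · rfl
    · exact M.edge_rev d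
  rw [h, Finset.sum_pair]
  intro hd
  exact M.vert_rev_ne d (congrArg M.vert hd.symm)

open Classical in
/-- The incidence matrix. -/
noncomputable def inc : Matrix V E (ZMod 2) :=
  fun v e => ∑ d with M.vert d = v ∧ M.edge d = e, 1

open Classical in
theorem inc_mulVec [Fintype E] [DecidableEq V] (z : E → ZMod 2) (v : V) :
    M.inc.mulVec z v = ∑ d with M.vert d = v, z (M.edge d) := by
  simp only [Matrix.mulVec, dotProduct, inc, Finset.sum_mul, Finset.sum_filter]
  rw [Finset.sum_comm]
  refine Finset.sum_congr rfl fun d _ => ?_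
  rw [Finset.sum_eq_single (M.edge d)] <;> aesop

open Classical in
theorem inc_transpose_mulVec [Fintype V] (h : V → ZMod 2) (e : E) :
    M.inc.transpose.mulVec h e = ∑ d with M.edge d = e, h (M.vert d) := by
  simp only [Matrix.mulVec, dotProduct, inc, Finset.sum_mul, Finset.sum_filter,
    Matrix.transpose_apply]
  rw [Finset.sum_comm]
  refine Finset.sum_congr rfl fun d _ => ?_
  rw [Finset.sum_eq_single (M.vert d)] <;> aesop

open Classical in
/-- The boundary of a set of faces. -/
noncomputable def bd : (M.Face → ZMod 2) →ₗ[ZMod 2] (E → ZMod 2) where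
  toFun c e := ∑ d with M.edge d = e, c (Quotient.mk _ d)
  map_add' c c' := by
    ext e
    simp [Finset.sum_add_distrib]
  map_smul' a c := by
    ext e
    simp [Finset.mul_sum]

theorem bd_apply (c : M.Face → ZMod 2) (d : D) :
    M.bd c (M.edge d) = c (Quotient.mk _ d) + c (Quotient.mk _ (M.rev d)) :=
  M.sum_edge (fun d => c (Quotient.mk _ d)) d

end

variable [Fintype V] [Fintype E] [Fintype D]

/-- The even edge sets. -/
noncomputable def cyc : Submodule (ZMod 2) (E → ZMod 2) := LinearMap.ker M.inc.mulVecLin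

open Classical in
theorem mem_cyc [DecidableEq V] (z : E → ZMod 2) :
    z ∈ M.cyc ↔ ∀ v, ∑ d with M.vert d = v, z (M.edge d) = 0 := by
  simp only [cyc, LinearMap.mem_ker, Matrix.mulVecLin_apply, funext_iff, inc_mulVec,
    Pi.zero_apply]

theorem add_self_zmod (a : ZMod 2) : a + a = 0 := by
  rw [← two_mul]
  have : (2 : ZMod 2) = 0 := rfl
  rw [this, zero_mul]

theorem eq_of_add_eq_zero_zmod {a b : ZMod 2} (h : a + b = 0) : a = b := by
  revert a b; decide

/-- At a vertex every edge contributes the faces on its two sides. Since `M.next d` and `M.rev d`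
lie on the same face, the rotation matches the second kind of contributions with the first, and the
two sums cancel modulo 2. -/
theorem range_bd_le : LinearMap.range M.bd ≤ M.cyc := by
  classical
  rintro _ ⟨c, rfl⟩
  rw [mem_cyc]
  intro v
  have h1 : ∑ d with M.vert d = v, c (Quotient.mk _ (M.rev d)) =
      ∑ d with M.vert d = v, c (Quotient.mk _ d) := by
    refine Finset.sum_bij (fun d _ => M.next d) ?_ ?_ ?_ ?_
    · intro d hd
      simpa [M.vert_next] using hd
    · intro d _ d' _ h
      exact M.next.injective h
    · intro d hd
      refine ⟨M.next.symm d, ?_, by simp⟩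
      have := M.vert_next (M.next.symm d)
      simp only [Equiv.apply_symm_apply] at this
      simpa [← this] using hd
    · intro d _
      rw [M.face_next]
  simp only [bd_apply, Finset.sum_add_distrib, h1]
  exact add_self_zmod _

theorem finrank_le_one_of_const {ι : Type*} (W : Submodule (ZMod 2) (ι → ZMod 2))
    (h : ∀ f ∈ W, ∀ i j, f i = f j) : Module.finrank (ZMod 2) W ≤ 1 := by
  by_cases h0 : ∃ v : W, v ≠ 0
  · obtain ⟨v, hv⟩ := h0
    obtain ⟨i, hi⟩ : ∃ i, v.1 i ≠ 0 := by
      by_contra! hc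
      exact hv (Subtype.ext (funext hc))
    have h1 : ∀ a : ZMod 2, a ≠ 0 → a = 1 := by decide
    refine finrank_le_one v fun w => ⟨w.1 i, Subtype.ext (funext fun j => ?_)⟩
    rw [SetLike.val_smul, Pi.smul_apply, h _ v.2 j i, h1 _ hi, smul_eq_mul, mul_one,
      h _ w.2 i j]
  · push Not at h0
    have : Subsingleton W := ⟨fun a b => by rw [h0 a, h0 b]⟩
    rw [Module.finrank_zero_of_subsingleton]
    exact zero_le_one

/-- A face function without boundary takes equal values across every edge, hence around every
vertex. It therefore comes from a function on vertices, which connectedness makes constant. -/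
theorem finrank_ker_bd_le : Module.finrank (ZMod 2) (LinearMap.ker M.bd) ≤ 1 := by
  refine finrank_le_one_of_const _ ?_
  intro c hc
  have h1 : ∀ d, c (Quotient.mk _ (M.rev d)) = c (Quotient.mk _ d) := by
    intro d
    have := M.bd_apply c d
    rw [LinearMap.mem_ker.1 hc] at this
    exact (eq_of_add_eq_zero_zmod this.symm).symm
  obtain ⟨h, hh⟩ := M.const_vert (fun d => c (Quotient.mk _ d))
    (fun d => by simp only [M.face_next, h1])
  have h2 := M.conn h (fun d => by rw [← hh, ← hh, h1])
  intro i j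
  induction i using Quotient.inductionOn with | _ d =>
  induction j using Quotient.inductionOn with | _ d' =>
  rw [hh, hh]
  exact h2 _ _

theorem finrank_ker_transpose_le :
    Module.finrank (ZMod 2) (LinearMap.ker M.inc.transpose.mulVecLin) ≤ 1 := by
  refine finrank_le_one_of_const _ ?_
  intro h hh
  refine M.conn h fun d => ?_
  have := M.inc_transpose_mulVec h (M.edge d)
  rw [M.sum_edge (fun d => h (M.vert d)), ← Matrix.mulVecLin_apply, LinearMap.mem_ker.1 hh] at this
  exact (eq_of_add_eq_zero_zmod this.symm).symm

theorem one_le_finrank_of_const {ι : Type*} [Fintype ι] [Nonempty ι]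
    (W : Submodule (ZMod 2) (ι → ZMod 2)) (h : (fun _ => 1) ∈ W) :
    1 ≤ Module.finrank (ZMod 2) W := by
  rw [Nat.succ_le_iff, Module.finrank_pos_iff_exists_ne_zero]
  refine ⟨⟨_, h⟩, fun h0 => ?_⟩
  obtain ⟨i⟩ := ‹Nonempty ι›
  have := congrFun (congrArg Subtype.val h0) i
  exact one_ne_zero this

theorem finrank_ker_bd : Module.finrank (ZMod 2) (LinearMap.ker M.bd) = 1 := by
  refine le_antisymm M.finrank_ker_bd_le ?_
  obtain ⟨d0⟩ := M.nonempty
  have : Nonempty M.Face := ⟨Quotient.mk _ d0⟩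
  have : Fintype M.Face := Fintype.ofFinite _
  refine one_le_finrank_of_const _ ?_
  rw [LinearMap.mem_ker]
  ext e
  obtain ⟨d, rfl⟩ := M.edge_surj e
  rw [bd_apply]
  rfl

/-- The incidence matrix has rank `|V| - 1`, because by connectedness the kernel of its transpose
consists of the constants. -/
theorem finrank_cyc : Module.finrank (ZMod 2) M.cyc + Fintype.card V = Fintype.card E + 1 := by
  classical
  have h1 := LinearMap.finrank_range_add_finrank_ker M.inc.mulVecLin
  have h2 := LinearMap.finrank_range_add_finrank_ker M.inc.transpose.mulVecLin
  have h3 := Matrix.rank_transpose M.inc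
  have h4 : 1 ≤ Module.finrank (ZMod 2) (LinearMap.ker M.inc.transpose.mulVecLin) := by
    have : Nonempty V := M.nonempty.map M.vert
    refine one_le_finrank_of_const _ ?_
    rw [LinearMap.mem_ker]
    ext e
    obtain ⟨d, rfl⟩ := M.edge_surj e
    rw [Matrix.mulVecLin_apply, inc_transpose_mulVec, M.sum_edge]
    rfl
  have h5 := M.finrank_ker_transpose_le
  unfold Matrix.rank at h3
  rw [Module.finrank_fintype_fun_eq_card] at h1 h2
  unfold cyc
  omega

theorem finrank_range_bd : Module.finrank (ZMod 2) (LinearMap.range M.bd) + 1 = Nat.card M.Face := by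
  have : Fintype M.Face := Fintype.ofFinite _
  have h1 := LinearMap.finrank_range_add_finrank_ker M.bd
  rw [Module.finrank_fintype_fun_eq_card, M.finrank_ker_bd] at h1
  rw [h1, Nat.card_eq_fintype_card]

/-- The genus is nonnegative: the boundaries form a space of dimension `|F| - 1` inside the cycle
space, whose dimension is `|E| - |V| + 1`. -/
theorem card_face_le : Fintype.card V + Nat.card M.Face ≤ Fintype.card E + 2 := by
  have h1 := M.finrank_range_bd
  have h2 := M.finrank_cyc
  have h3 := Submodule.finrank_mono M.range_bd_le
  omega

/-- In a map of genus zero every even edge set is a boundary. -/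
theorem exists_bd_eq (h : Fintype.card V + Nat.card M.Face = Fintype.card E + 2)
    {z : E → ZMod 2} (hz : z ∈ M.cyc) : ∃ c : D → ZMod 2,
      (∀ d, c (M.next d) = c (M.rev d)) ∧ ∀ d, c (M.rev d) = c d + z (M.edge d) := by
  have h1 := M.finrank_range_bd
  have h2 := M.finrank_cyc
  have h3 := Submodule.eq_of_le_of_finrank_eq M.range_bd_le (by omega)
  rw [← h3] at hz
  obtain ⟨c, rfl⟩ := hz
  refine ⟨fun d => c (Quotient.mk _ d), fun d => by simp only [M.face_next], fun d => ?_⟩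
  rw [bd_apply, ← add_assoc, add_self_zmod, zero_add]

/-- The two conditions on `c` make it constant on the cycles of the face permutation, so it descends
to a set of faces with boundary `z`. Thus boundaries fill the cycle space and the dimension bound is
attained. -/
theorem euler_of_exists_bd_eq (h : ∀ z ∈ M.cyc, ∃ c : D → ZMod 2,
      (∀ d, c (M.next d) = c (M.rev d)) ∧ ∀ d, c (M.rev d) = c d + z (M.edge d)) :
    Fintype.card V + Nat.card M.Face = Fintype.card E + 2 := by
  have h1 := M.finrank_range_bd
  have h2 := M.finrank_cyc
  have h3 : M.cyc ≤ LinearMap.range M.bd := by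
    intro z hz
    obtain ⟨c, hc1, hc2⟩ := h z hz
    have hc3 : ∀ d, c ((M.rev.trans M.next) d) = c d := fun d => by
      simp [hc1, M.rev_rev]
    refine ⟨Quotient.lift c fun d d' h => eq_of_sameCycle hc3 h, ?_⟩
    ext e
    obtain ⟨d, rfl⟩ := M.edge_surj e
    rw [bd_apply]
    simp only [Quotient.lift_mk, hc2]
    rw [← add_assoc, add_self_zmod, zero_add]
  have h4 := Submodule.finrank_mono h3
  have h5 := M.card_face_le
  omega

end CombMap

/-! ### The combinatorial map of a rotation system -/

section

variable {α : Type*} {β : Type*} {G : Graph α β}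

/-- A loopless connected finite graph with at least one edge. -/
structure Good (G : Graph α β) : Prop where
  finV : G.vertexSet.Finite
  finE : G.edgeSet.Finite
  loopless : G.Loopless
  conn : G.toSimpleGraph.Connected
  edge : G.edgeSet.Nonempty

/-- The dart at `x` along `e`. -/
def mkDart {x : α} {e : β} (h : G.Inc e x) : Dart G := ⟨(x, e), h⟩

@[simp] theorem mkDart_vertex {x : α} {e : β} (h : G.Inc e x) : (mkDart h).vertex = x := rfl

@[simp] theorem mkDart_edge {x : α} {e : β} (h : G.Inc e x) : (mkDart h).edge = e := rfl

theorem Dart.inc (d : Dart G) : G.Inc d.edge d.vertex := d.2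

theorem Dart.mk_eq (d : Dart G) : mkDart d.inc = d := rfl

theorem Dart.ext' {d d' : Dart G} (h1 : d.vertex = d'.vertex) (h2 : d.edge = d'.edge) : d = d' :=
  Subtype.ext (Prod.ext h1 h2)

theorem finite_dart (hV : G.vertexSet.Finite) (hE : G.edgeSet.Finite) : Finite (Dart G) := by
  have := hV.to_subtype
  have := hE.to_subtype
  refine Finite.of_injective
    (fun d : Dart G => ((⟨d.vertex, d.2.vertex_mem⟩, ⟨d.edge, d.2.edge_mem⟩) :
      G.vertexSet × G.edgeSet)) ?_
  intro d d' h
  rw [Prod.mk.injEq] at h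
  exact Dart.ext' (congrArg Subtype.val h.1) (congrArg Subtype.val h.2)

theorem Dart.isLink (d : Dart G) : G.IsLink d.edge d.vertex d.rev.vertex :=
  Graph.Inc.isLink_other d.2

theorem vertex_next {next : Equiv.Perm (Dart G)}
    (hcyc : ∀ x ∈ G.vertexSet, next.IsCycleOn {d : Dart G | d.vertex = x}) (d : Dart G) :
    (next d).vertex = d.vertex :=
  (hcyc d.vertex d.2.vertex_mem).1.mapsTo rfl

/-- The combinatorial map of a rotation system. -/
noncomputable def combMap (hG : Good G) (next : Equiv.Perm (Dart G))
    (hcyc : ∀ x ∈ G.vertexSet, next.IsCycleOn {d : Dart G | d.vertex = x}) :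
    CombMap G.vertexSet G.edgeSet (Dart G) where
  vert d := ⟨d.vertex, d.2.vertex_mem⟩
  edge d := ⟨d.edge, d.2.edge_mem⟩
  rev := revPerm G
  next := next
  rev_rev := Dart.rev_rev
  vert_rev_ne d h := by
    have h1 := d.isLink
    rw [show d.rev.vertex = d.vertex from congrArg Subtype.val h] at h1
    exact hG.loopless.not_isLoopAt _ _ h1
  edge_rev _ := rfl
  edge_eq d d' h := by
    have h1 : d'.edge = d.edge := congrArg Subtype.val h
    have h2 := d.isLink
    have h3 := d'.isLink
    rw [h1] at h3
    rcases h3.left_eq_or_eq h2 with h4 | h4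
    · exact Or.inl (Dart.ext' h4 h1)
    · exact Or.inr (Dart.ext' h4 h1)
  edge_surj e := by
    obtain ⟨x, y, h⟩ := G.exists_isLink_of_mem_edgeSet e.2
    exact ⟨mkDart h.inc_left, rfl⟩
  vert_next d := Subtype.ext (vertex_next hcyc d)
  -- The rotation is transitive on the darts at a vertex, so any dart there may be chosen; `0` only
  -- serves vertices without darts.
  const_vert c hc := by
    classical
    refine ⟨fun x => if h : ∃ d : Dart G, d.vertex = x then c h.choose else 0, fun d => ?_⟩
    have h : ∃ d' : Dart G, d'.vertex = d.vertex := ⟨d, rfl⟩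
    refine Eq.trans ?_ (dif_pos h).symm
    exact eq_of_sameCycle hc ((hcyc d.vertex d.2.vertex_mem).2 rfl h.choose_spec)
  conn h hh v w := by
    obtain ⟨p⟩ := hG.conn.preconnected v w
    induction p with
    | nil => rfl
    | cons hadj p ih =>
      rw [← ih]
      obtain ⟨_, e, he⟩ := hadj
      refine (hh (mkDart he.inc_left)).symm.trans (congrArg h (Subtype.ext ?_))
      exact (Dart.isLink (mkDart he.inc_left)).right_unique he
  nonempty := by
    obtain ⟨e, he⟩ := hG.edge
    obtain ⟨x, y, h⟩ := G.exists_isLink_of_mem_edgeSet he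
    exact ⟨mkDart h.inc_left⟩

theorem card_faces_le (hG : Good G) (next : Equiv.Perm (Dart G))
    (hcyc : ∀ x ∈ G.vertexSet, next.IsCycleOn {d : Dart G | d.vertex = x}) :
    G.vertexSet.ncard + Nat.card (Quotient (Equiv.Perm.SameCycle.setoid (facePerm next))) ≤
      G.edgeSet.ncard + 2 := by
  have := hG.finV.fintype
  have := hG.finE.fintype
  have := finite_dart hG.finV hG.finE
  have := Fintype.ofFinite (Dart G)
  have h := (combMap hG next hcyc).card_face_le
  rwa [← Nat.card_eq_fintype_card, ← Nat.card_eq_fintype_card] at h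

/-- `l` lists the edges at `x`. -/
def IncList (G : Graph α β) (x : α) (l : List β) : Prop :=
  l.Nodup ∧ ∀ e, e ∈ l ↔ G.Inc e x

/-- An assignment of residues modulo 2 to edges is even if it sums to zero at every vertex. -/
def IsEven (G : Graph α β) (z : β → ZMod 2) : Prop :=
  ∀ x ∈ G.vertexSet, ∃ l, IncList G x l ∧ (l.map z).sum = 0

theorem sum_dart_eq [Fintype (Dart G)] [DecidableEq α] {x : α} {l : List β} (hl : IncList G x l)
    (z : β → ZMod 2) : ∑ d : Dart G with d.vertex = x, z d.edge = (l.map z).sum := by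
  classical
  rw [← List.sum_toFinset z hl.1]
  refine Finset.sum_bij (fun d _ => d.edge) ?_ ?_ ?_ ?_
  · intro d hd
    rw [List.mem_toFinset, hl.2]
    have : d.vertex = x := by simpa using hd
    exact this ▸ d.2
  · intro d hd d' hd' h
    exact Dart.ext' ((Finset.mem_filter.1 hd).2.trans (Finset.mem_filter.1 hd').2.symm) h
  · intro e he
    rw [List.mem_toFinset, hl.2] at he
    exact ⟨mkDart he, by simp, rfl⟩
  · intro d _
    rfl

/-- In an embedding of genus zero, every even set of edges separates the two sides of its edges. -/
theorem exists_side_dart (hG : Good G) (σ : PlanarEmbedding G) {z : β → ZMod 2}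
    (hz : IsEven G z) : ∃ c : Dart G → ZMod 2,
      (∀ d, c (σ.next d) = c d.rev) ∧ ∀ d, c d.rev = c d + z d.edge := by
  classical
  have := hG.finV.fintype
  have := hG.finE.fintype
  have := finite_dart hG.finV hG.finE
  have := Fintype.ofFinite (Dart G)
  have h := (combMap hG σ.next σ.isCycleOn).exists_bd_eq
    (by rw [← Nat.card_eq_fintype_card, ← Nat.card_eq_fintype_card]; exact σ.euler)
    (z := fun e => z e) (by
      rw [CombMap.mem_cyc]
      intro v
      obtain ⟨l, hl, hs⟩ := hz v.1 v.2
      rw [← hs, ← sum_dart_eq hl]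
      exact Finset.sum_congr (Finset.ext fun d => by
        rw [Finset.mem_filter, Finset.mem_filter]
        exact ⟨fun h => ⟨h.1, congrArg Subtype.val h.2⟩, fun h => ⟨h.1, Subtype.ext h.2⟩⟩) fun _ _ => rfl)
  exact h

/-- Edge functions are taken on all of `β`, extended by zero, so that functions for a subgraph and
for the whole graph are literally the same objects. -/
theorem euler_of_exists_side (hG : Good G) (next : Equiv.Perm (Dart G))
    (hcyc : ∀ x ∈ G.vertexSet, next.IsCycleOn {d : Dart G | d.vertex = x})
    (hl : ∀ x ∈ G.vertexSet, ∃ l, IncList G x l)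
    (h : ∀ z : β → ZMod 2, (∀ e ∉ G.edgeSet, z e = 0) → IsEven G z → ∃ c : Dart G → ZMod 2,
      (∀ d, c (next d) = c d.rev) ∧ ∀ d, c d.rev = c d + z d.edge) :
    G.vertexSet.ncard + Nat.card (Quotient (Equiv.Perm.SameCycle.setoid (facePerm next))) =
      G.edgeSet.ncard + 2 := by
  classical
  have := hG.finV.fintype
  have := hG.finE.fintype
  have := finite_dart hG.finV hG.finE
  have := Fintype.ofFinite (Dart G)
  have h := (combMap hG next hcyc).euler_of_exists_bd_eq (by
    intro z hz
    rw [CombMap.mem_cyc] at hz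
    obtain ⟨c, hc1, hc2⟩ := h (fun e => if he : e ∈ G.edgeSet then z ⟨e, he⟩ else 0)
      (fun e he => dif_neg he) (by
        intro x hx
        obtain ⟨l, hl⟩ := hl x hx
        refine ⟨l, hl, ?_⟩
        rw [← sum_dart_eq hl, ← hz ⟨x, hx⟩]
        exact Finset.sum_congr (Finset.ext fun d => by
          rw [Finset.mem_filter, Finset.mem_filter]
          exact ⟨fun h => ⟨h.1, Subtype.ext h.2⟩, fun h => ⟨h.1, congrArg Subtype.val h.2⟩⟩)
          fun d _ => dif_pos d.inc.edge_mem)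
    refine ⟨c, hc1, fun d => (hc2 d).trans (congrArg _ (dif_pos d.inc.edge_mem))⟩)
  rwa [← Nat.card_eq_fintype_card, ← Nat.card_eq_fintype_card] at h

/-! ### The rotation at a vertex -/

open Classical in
/-- The edge that follows `e` in the rotation at `x`. -/
noncomputable def PlanarEmbedding.nx (σ : PlanarEmbedding G) (x : α) (e : β) : β :=
  if h : G.Inc e x then (σ.next (mkDart h)).edge else e

variable (σ : PlanarEmbedding G)

theorem PlanarEmbedding.nx_dart (d : Dart G) : σ.nx d.vertex d.edge = (σ.next d).edge :=
  dif_pos d.2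

theorem PlanarEmbedding.nx_inc {x : α} {e : β} (h : G.Inc e x) : G.Inc (σ.nx x e) x := by
  have h1 := (σ.next (mkDart h)).inc
  rw [vertex_next σ.isCycleOn, ← σ.nx_dart] at h1
  exact h1

theorem PlanarEmbedding.next_eq {x : α} {e : β} (h : G.Inc e x) :
    σ.next (mkDart h) = mkDart (σ.nx_inc h) :=
  Dart.ext' (vertex_next σ.isCycleOn _) (σ.nx_dart (mkDart h)).symm

theorem PlanarEmbedding.nx_injective {x : α} {e f : β} (he : G.Inc e x) (hf : G.Inc f x)
    (h : σ.nx x e = σ.nx x f) : e = f := by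
  have h1 : σ.next (mkDart he) = σ.next (mkDart hf) := by
    rw [σ.next_eq, σ.next_eq]
    exact Dart.ext' rfl h
  exact congrArg Dart.edge (σ.next.injective h1)

/-- The induction principle for rotations: as the rotation at `x` is a single finite cycle,
iterating it from `e` reaches every edge at `x`. -/
theorem PlanarEmbedding.nx_closed (hG : Good G) {x : α} (p : β → Prop) {e : β} (he : G.Inc e x)
    (hp : p e) (h : ∀ f, G.Inc f x → p f → p (σ.nx x f)) {f : β} (hf : G.Inc f x) : p f := by
  have := finite_dart hG.finV hG.finE
  obtain ⟨n, hn⟩ := ((σ.isCycleOn x he.vertex_mem).2 (x := (mkDart he)) (y := (mkDart hf))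
    rfl rfl).exists_nat_pow_eq
  have h1 : ∀ n : ℕ, ((σ.next ^ n) (mkDart he)).vertex = x ∧
      p ((σ.next ^ n) (mkDart he)).edge := by
    intro n
    induction n with
    | zero => exact ⟨rfl, hp⟩
    | succ n ih =>
      rw [pow_succ', Equiv.Perm.mul_apply]
      refine ⟨(vertex_next σ.isCycleOn _).trans ih.1, ?_⟩
      rw [← σ.nx_dart]
      rw [ih.1]
      have h3 := ((σ.next ^ n) (mkDart he)).inc
      rw [ih.1] at h3
      exact h _ h3 ih.2
  have h2 := (h1 n).2
  rw [hn] at h2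
  exact h2

/-- A colouring of the darts `(x, e)` that jumps precisely at the edges counted by `z`. -/
structure SideFun (σ : PlanarEmbedding G) (z : β → ZMod 2) (c : α → β → ZMod 2) : Prop where
  nx : ∀ ⦃x e⦄, G.Inc e x → c x (σ.nx x e) = c x e + z e
  link : ∀ ⦃e x y⦄, G.IsLink e x y → c y e = c x e + z e

/-- The substitute for the Jordan curve theorem: `c x e` is the colour of the face to which the dart
at `x` along `e` belongs. Rigidity and the effect of links are all derived from such colourings for
suitable cycles. -/
theorem exists_sideFun (hG : Good G) (σ : PlanarEmbedding G) {z : β → ZMod 2}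
    (hz : IsEven G z) : ∃ c, SideFun σ z c := by
  classical
  obtain ⟨c, h1, h2⟩ := exists_side_dart hG σ hz
  refine ⟨fun x e => if h : G.Inc e x then c (mkDart h) else 0, ?_, ?_⟩
  · intro x e h
    rw [dif_pos h, dif_pos (σ.nx_inc h), ← σ.next_eq h, h1, h2]
    rfl
  · intro e x y h
    rw [dif_pos h.inc_left, dif_pos h.inc_right]
    have h3 : mkDart h.inc_right = Dart.rev (mkDart h.inc_left) :=
      Dart.ext' (h.right_unique (Dart.isLink (mkDart h.inc_left))) rfl
    rw [h3, h2]
    rfl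

variable {σ} {z : β → ZMod 2} {c : α → β → ZMod 2}

theorem SideFun.const (hc : SideFun σ z c) (hG : Good G) {x : α} {e f : β}
    (h : ∀ e, G.Inc e x → z e = 0) (he : G.Inc e x) (hf : G.Inc f x) : c x f = c x e := by
  refine σ.nx_closed hG (fun f => c x f = c x e) he rfl ?_ hf
  intro g hg h1
  rw [hc.nx hg, h g hg, add_zero, h1]

/-- Otherwise `p` and `q` have the same colour. The opposite colour, entered right after `p`, could
then never be left, because only `p` and `q` switch colours; so the rotation would not return to
`p`. -/
theorem SideFun.pair (hc : SideFun σ z c) (hG : Good G) {x : α} {p q : β}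
    (hp : G.Inc p x) (hq : G.Inc q x) (hpq : p ≠ q) (zp : z p = 1)
    (h : ∀ e, G.Inc e x → e ≠ p → e ≠ q → z e = 0) : c x q = c x p + 1 := by
  by_contra hne
  have h0 : ∀ a b : ZMod 2, a ≠ b + 1 → a = b := by decide
  have hqp := h0 _ _ hne
  have h1 := σ.nx_closed hG (fun f => c x f = c x p + 1) (σ.nx_inc hp) (by rw [hc.nx hp, zp])
    (fun f hf h2 => by
      have hfp : f ≠ p := by rintro rfl; simp at h2
      have hfq : f ≠ q := by rintro rfl; rw [hqp] at h2; simp at h2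
      rw [hc.nx hf, h f hf hfp hfq, add_zero, h2]) hp
  simp at h1

end

/-! ### Rotations at vertices of degree two and three -/

section

variable {α : Type*} {β : Type*} {G : Graph α β} {σ : PlanarEmbedding G} {x : α} {p q r s : β}

theorem IncList.nx_mem {l : List β} (h : IncList G x l) {e : β} (he : e ∈ l) : σ.nx x e ∈ l :=
  (h.2 _).2 (σ.nx_inc ((h.2 e).1 he))

/-- A set of edges at `x` which is closed under the rotation contains all edges at `x`. -/
theorem IncList.closed {l : List β} (hG : Good G) (h : IncList G x l) (t : β → Prop) {e : β}
    (he : e ∈ l) (ht : t e) (hn : ∀ f ∈ l, t f → t (σ.nx x f)) : ∀ f ∈ l, t f := fun f hf =>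
  σ.nx_closed hG t ((h.2 e).1 he) ht (fun g hg => hn g ((h.2 g).2 hg)) ((h.2 f).1 hf)

theorem nx_two (hG : Good G) (h : IncList G x [p, q]) : σ.nx x p = q := by
  have h1 := h.nx_mem (σ := σ) (e := p) (by simp)
  have hd := h.1
  have h2 := h.closed hG (σ := σ) (fun e => e = p) (e := p)
  simp at h1 hd h2
  grind

/-- No proper nonempty set of edges is closed under the rotation; excluding single edges and pairs
leaves the two cyclic orders. -/
theorem nx_three (hG : Good G) (h : IncList G x [p, q, r]) :
    (σ.nx x p = q ∧ σ.nx x q = r ∧ σ.nx x r = p) ∨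
      (σ.nx x p = r ∧ σ.nx x r = q ∧ σ.nx x q = p) := by
  have hd := h.1
  have h1 := h.nx_mem (σ := σ) (e := p) (by simp)
  have h2 := h.nx_mem (σ := σ) (e := q) (by simp)
  have h3 := h.nx_mem (σ := σ) (e := r) (by simp)
  have i1 := h.closed hG (σ := σ) (fun e => e = p) (e := p)
  have i2 := h.closed hG (σ := σ) (fun e => e = q) (e := q)
  have i3 := h.closed hG (σ := σ) (fun e => e = r) (e := r)
  have j1 := h.closed hG (σ := σ) (fun e => e = p ∨ e = q) (e := p)
  have j2 := h.closed hG (σ := σ) (fun e => e = p ∨ e = r) (e := p)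
  have j3 := h.closed hG (σ := σ) (fun e => e = q ∨ e = r) (e := q)
  simp at h1 h2 h3 hd i1 i2 i3 j1 j2 j3
  grind

end

/-! ### Hybrid subgraphs when all labels are strict -/

section

variable {α : Type*} {β : Type*} {G H : Graph α β}

/-- The identity as an isomorphism. -/
def GraphIso.refl (G : Graph α β) : GraphIso G G where
  onV := id
  onE := id
  bijV := Set.bijOn_id _
  bijE := Set.bijOn_id _
  map_isLink _ _ _ h := h

theorem isHybridSubgraph_of_le (A : Set β) (h : H ≤ G) : IsHybridSubgraph A H G :=
  ⟨H, h, GraphIso.refl H, fun _ _ => rfl⟩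

theorem InducedOn.hybridInduces {A : Set β} {h : H ≤ G} {φ : PlanarEmbedding G}
    {ψ : PlanarEmbedding H} (hi : InducedOn h φ ψ) : HybridInduces A φ ψ :=
  ⟨H, h, GraphIso.refl H, ψ, fun _ _ => rfl, hi, fun _ => rfl⟩

/-- A simple graph in which every vertex has at least two edges. -/
structure Sparse (G : Graph α β) : Prop where
  simple : G.Simple
  two : ∀ x ∈ G.vertexSet, ∃ e f, e ≠ f ∧ G.Inc e x ∧ G.Inc f x

/-- The image of `x` is an end of each edge at `x`, as labels are fixed. If it is not `x`, it is the
other end of two different edges at `x`, which simplicity forbids. -/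
theorem onV_eq_of_fixes (hs : Sparse H) (hc : H.Compatible G) {G' : Graph α β} (hG' : G' ≤ G)
    (θ : GraphIso H G') (hθ : θ.Fixes Set.univ) {x : α} (hx : x ∈ H.vertexSet) :
    θ.onV x = x := by
  have h1 : ∀ e y, H.IsLink e x y → θ.onV x = x ∨ θ.onV x = y := by
    intro e y h
    have h2 := θ.map_isLink h
    rw [hθ e ⟨trivial, h.edge_mem⟩] at h2
    have h3 := (hc h.edge_mem (h2.mono hG').edge_mem _ _).2 (h2.mono hG')
    exact h3.left_eq_or_eq h
  obtain ⟨e, f, hef, ⟨y, hy⟩, ⟨y', hy'⟩⟩ := hs.two x hx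
  by_contra hne
  have h4 := (h1 e y hy).resolve_left hne
  have h5 := (h1 f y' hy').resolve_left hne
  rw [← h5, h4] at hy'
  have := hs.simple
  exact hef (hy.eq hy')

/-- With all labels strict the relabelling is the identity, so the hybrid relations reduce to
ordinary inclusion and induced embeddings. -/
theorem eq_of_fixes (hs : Sparse H) (hc : H.Compatible G) {G' : Graph α β} (hG' : G' ≤ G)
    (θ : GraphIso H G') (hθ : θ.Fixes Set.univ) : G' = H := by
  have hle : H ≤ G' := by
    refine ⟨fun x hx => ?_, fun e x y h => ?_⟩
    · have h1 := θ.bijV.mapsTo hx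
      rwa [onV_eq_of_fixes hs hc hG' θ hθ hx] at h1
    · have h1 := θ.map_isLink h
      rwa [hθ e ⟨trivial, h.edge_mem⟩, onV_eq_of_fixes hs hc hG' θ hθ h.left_mem,
        onV_eq_of_fixes hs hc hG' θ hθ h.right_mem] at h1
  refine le_antisymm (Graph.IsSubgraph.mk (fun x hx => ?_) fun e x y h => ?_) hle
  · obtain ⟨y, hy, rfl⟩ := θ.bijV.surjOn hx
    rwa [onV_eq_of_fixes hs hc hG' θ hθ hy]
  · obtain ⟨f, hf, hfe⟩ := θ.bijE.surjOn h.edge_mem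
    rw [hθ f ⟨trivial, hf⟩] at hfe
    subst hfe
    exact (hle.isLink_iff hf).2 h

theorem IsHybridSubgraph.le (hs : Sparse H) (hc : H.Compatible G)
    (h : IsHybridSubgraph Set.univ H G) : H ≤ G := by
  obtain ⟨G', hG', θ, hθ⟩ := h
  rwa [← eq_of_fixes hs hc hG' θ hθ]

theorem HybridInduces.inducedOn (hs : Sparse H) (hc : H.Compatible G) {φ : PlanarEmbedding G}
    {ψ : PlanarEmbedding H} (h : HybridInduces Set.univ φ ψ) : ∃ hle : H ≤ G, InducedOn hle φ ψ := by
  obtain ⟨G', hG', θ, ψ', hθ, hi, hcar⟩ := h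
  obtain rfl := eq_of_fixes hs hc hG' θ hθ
  refine ⟨hG', fun d => ?_⟩
  have h1 : ∀ d, θ.dart d = d := fun d =>
    Dart.ext' (onV_eq_of_fixes hs hc hG' θ hθ d.inc.vertex_mem)
      (hθ _ ⟨trivial, d.inc.edge_mem⟩)
  have h2 := hcar d
  rw [h1, h1] at h2
  rw [h2]
  exact hi d

@[simp] theorem Dart.incl_vertex (h : H ≤ G) (d : Dart H) : (d.incl h).vertex = d.vertex := rfl

@[simp] theorem Dart.incl_edge (h : H ≤ G) (d : Dart H) : (d.incl h).edge = d.edge := rfl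

/-- If no edge at `x` is lost, the first surviving dart is the immediate successor. This is what
transports rotations along the sequence. -/
theorem InducedOn.nx_eq {h : H ≤ G} {φ : PlanarEmbedding G} {ψ : PlanarEmbedding H}
    (hi : InducedOn h φ ψ) {x : α} (hx : ∀ e, G.Inc e x → H.Inc e x) {e : β} (he : H.Inc e x) :
    ψ.nx x e = φ.nx x e := by
  obtain ⟨k, hk, h1, h2⟩ := hi (mkDart he)
  have h3 : k = 1 := by
    by_contra hk1
    refine h2 1 one_pos (by omega) ?_
    rw [pow_one]
    have h4 : φ.next ((mkDart he).incl h) = mkDart (φ.nx_inc (he.mono h)) :=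
      φ.next_eq (he.mono h)
    rw [h4]
    exact ⟨mkDart (hx _ (φ.nx_inc (he.mono h))), rfl⟩
  rw [h3, pow_one] at h1
  have h4 := congrArg Dart.edge h1
  rw [Dart.incl_edge, ← φ.nx_dart, ← ψ.nx_dart] at h4
  exact h4.symm

/-- Needed when consecutive graphs coincide: a simultaneous embedding then insists on the forward
direction, whichever inclusion is at hand. -/
theorem InducedOn.symm {h : H ≤ G} {φ : PlanarEmbedding G} {ψ : PlanarEmbedding H}
    (hi : InducedOn h φ ψ) (h' : G ≤ H) : InducedOn h' ψ φ := by
  obtain rfl := le_antisymm h h'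
  intro d
  refine ⟨1, one_pos, ?_, fun j h1 h2 => by omega⟩
  have h1 := hi.nx_eq (x := d.vertex) (fun _ he => he) d.inc
  rw [ψ.nx_dart, φ.nx_dart] at h1
  exact Dart.ext' ((vertex_next ψ.isCycleOn d).trans (vertex_next φ.isCycleOn d).symm) h1

end

section

variable {α : Type*} {β : Type*} (S : HybridDeletionSequence α β)

/-- Rotations at vertices with the same edges in consecutive graphs agree in a simultaneous
embedding. -/
theorem SimultaneousEmbedding.nx_eq {S : HybridDeletionSequence α β} (hA : S.strict = Set.univ)
    (hs : ∀ i, Sparse (S.graph i))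
    (hc : ∀ i : Fin S.steps, (S.graph i.castSucc).Compatible (S.graph i.succ))
    (Φ : SimultaneousEmbedding S) (i : Fin S.steps) {x : α}
    (hx : ∀ e, (S.graph i.castSucc).Inc e x ↔ (S.graph i.succ).Inc e x) {e : β}
    (he : (S.graph i.castSucc).Inc e x) :
    (Φ.emb i.castSucc).nx x e = (Φ.emb i.succ).nx x e := by
  by_cases h : IsHybridSubgraph S.strict (S.graph i.castSucc) (S.graph i.succ)
  · have h1 := Φ.forward i h
    rw [hA] at h1
    obtain ⟨_, h2⟩ := h1.inducedOn (hs _) (hc i)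
    exact h2.nx_eq (fun e h => (hx e).2 h) he
  · have h1 := Φ.backward i h
    rw [hA] at h1
    obtain ⟨_, h2⟩ := h1.inducedOn (hs _) (hc i).symm
    exact (h2.nx_eq (fun e h => (hx e).1 h) ((hx e).1 he)).symm

/-- Embeddings which induce each other form a simultaneous embedding. -/
def SimultaneousEmbedding.ofInduced {S : HybridDeletionSequence α β} (hA : S.strict = Set.univ)
    (hs : ∀ i, Sparse (S.graph i))
    (hc : ∀ i : Fin S.steps, (S.graph i.castSucc).Compatible (S.graph i.succ))
    (emb : ∀ i, PlanarEmbedding (S.graph i))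
    (h : ∀ i : Fin S.steps,
      (∃ hle : S.graph i.castSucc ≤ S.graph i.succ, InducedOn hle (emb i.succ) (emb i.castSucc)) ∨
      ∃ hle : S.graph i.succ ≤ S.graph i.castSucc, InducedOn hle (emb i.castSucc) (emb i.succ)) :
    SimultaneousEmbedding S where
  emb := emb
  forward i hi := by
    rcases h i with ⟨hle, h1⟩ | ⟨hle, h1⟩
    · exact h1.hybridInduces
    · rw [hA] at hi
      exact (h1.symm (hi.le (hs _) (hc i))).hybridInduces
  backward i hi := by
    rcases h i with ⟨hle, h1⟩ | ⟨hle, h1⟩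
    · exact absurd (isHybridSubgraph_of_le _ hle) hi
    · exact h1.hybridInduces

end

/-! ### Rotation systems given by lists -/

theorem List.IsRotated.filter' {β : Type*} {l l' : List β} (p : β → Bool) (h : l ~r l') :
    l.filter p ~r l'.filter p := by
  obtain ⟨n, rfl⟩ := h
  rcases eq_or_ne l [] with rfl | hl
  · simp
  rw [← List.rotate_mod]
  rw [List.rotate_eq_drop_append_take (Nat.mod_lt _ (List.length_pos_of_ne_nil hl)).le]
  rw [List.filter_append]
  conv_lhs => rw [← List.take_append_drop (n % l.length) l, List.filter_append]
  exact List.isRotated_append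

/-- After rotating the list so that `e` comes first, the next kept entry is the head of the filtered
tail, and everything skipped on the way is deleted. -/
theorem formPerm_filter {β : Type*} [DecidableEq β] {l : List β} (hl : l.Nodup) (p : β → Bool)
    {e : β} (he : e ∈ l) (hp : p e) : ∃ k, 0 < k ∧
      (l.formPerm ^ k) e = (l.filter p).formPerm e ∧
      ∀ j, 0 < j → j < k → ¬ p ((l.formPerm ^ j) e) := by
  obtain ⟨s, t, rfl⟩ := List.append_of_mem he
  have hrot : (s ++ e :: t) ~r (e :: (t ++ s)) := by
    rw [← List.cons_append]
    exact List.isRotated_append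
  have hl' : (e :: (t ++ s)).Nodup := hrot.nodup_iff.1 hl
  rw [List.formPerm_eq_of_isRotated hl hrot,
    List.formPerm_eq_of_isRotated (hl.filter p) (List.IsRotated.filter' p hrot)]
  generalize t ++ s = u at hl'
  rw [List.filter_cons_of_pos hp]
  rcases hu : u.filter p with _ | ⟨b, v⟩
  -- Nothing but `e` is kept: a full turn leads back to `e`, its own successor in the filtered list.
  · refine ⟨(e :: u).length, by simp, ?_, ?_⟩
    · rw [List.formPerm_pow_length_eq_one_of_nodup _ hl', List.formPerm_singleton]
    · intro j hj1 hj2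
      rw [List.formPerm_pow_apply_head _ _ hl']
      simp only [Nat.mod_eq_of_lt hj2]
      obtain ⟨j, rfl⟩ := Nat.exists_eq_succ_of_ne_zero hj1.ne'
      rw [List.getElem_cons_succ]
      exact List.filter_eq_nil_iff.1 hu _ (List.getElem_mem _)
  · obtain ⟨as, bs, rfl, h1, h2, -⟩ := List.filter_eq_cons_iff.1 hu
    have hlen : as.length + 1 < (e :: (as ++ b :: bs)).length := by simp
    refine ⟨as.length + 1, by omega, ?_, ?_⟩
    · rw [List.formPerm_pow_apply_head _ _ hl', List.formPerm_apply_head]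
      · simp only [Nat.mod_eq_of_lt hlen]
        simp
      · rw [← hu, ← List.filter_cons_of_pos hp]
        exact hl'.filter p
    · intro j hj1 hj2
      rw [List.formPerm_pow_apply_head _ _ hl']
      simp only [Nat.mod_eq_of_lt (hj2.trans hlen)]
      obtain ⟨j, rfl⟩ := Nat.exists_eq_succ_of_ne_zero hj1.ne'
      rw [List.getElem_cons_succ, List.getElem_append_left (by omega)]
      exact h1 _ (List.getElem_mem _)

section

variable {α : Type*} {β : Type*} {G H : Graph α β}

theorem IncList.perm {x : α} {l l' : List β} (h : IncList G x l) (h' : IncList G x l') :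
    l.Perm l' :=
  (List.perm_ext_iff_of_nodup h.1 h'.1).2 fun e => (h.2 e).trans (h'.2 e).symm

open Classical in
theorem IncList.filter {x : α} {l : List β} (h : IncList G x l) (hle : H ≤ G) :
    IncList H x (l.filter fun e => decide (e ∈ H.edgeSet)) := by
  refine ⟨h.1.filter _, fun e => ?_⟩
  rw [List.mem_filter, h.2, decide_eq_true_iff]
  exact ⟨fun h => (hle.inc_congr h.2).2 h.1, fun h => ⟨h.mono hle, h.edge_mem⟩⟩

/-- Lists of the edges at all vertices. -/
def IsRot (G : Graph α β) (rot : α → List β) : Prop := ∀ x ∈ G.vertexSet, IncList G x (rot x)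

variable {rot : α → List β}

open Classical in
/-- The rotation given by lists of edges. -/
noncomputable def rotNext (h : IsRot G rot) : Equiv.Perm (Dart G) where
  toFun d := mkDart (x := d.vertex) (e := (rot d.vertex).formPerm d.edge)
    (((h _ d.inc.vertex_mem).2 _).1
      (List.formPerm_mem_iff_mem.2 (((h _ d.inc.vertex_mem).2 _).2 d.inc)))
  invFun d := mkDart (x := d.vertex) (e := (rot d.vertex).formPerm.symm d.edge)
    (((h _ d.inc.vertex_mem).2 _).1 (List.formPerm_mem_iff_mem.1 (by
      rw [Equiv.apply_symm_apply]; exact (((h _ d.inc.vertex_mem).2 _).2 d.inc))))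
  left_inv d := Dart.ext' rfl (Equiv.symm_apply_apply _ _)
  right_inv d := Dart.ext' rfl (Equiv.apply_symm_apply _ _)

theorem rotNext_vertex (h : IsRot G rot) (d : Dart G) : (rotNext h d).vertex = d.vertex := rfl

open Classical in
theorem rotNext_edge (h : IsRot G rot) (d : Dart G) :
    (rotNext h d).edge = (rot d.vertex).formPerm d.edge := rfl

open Classical in
theorem rotNext_pow (h : IsRot G rot) (d : Dart G) (n : ℕ) :
    ((rotNext h ^ n) d).vertex = d.vertex ∧
      ((rotNext h ^ n) d).edge = ((rot d.vertex).formPerm ^ n) d.edge := by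
  induction n with
  | zero => exact ⟨rfl, rfl⟩
  | succ n ih =>
    rw [pow_succ', pow_succ', Equiv.Perm.mul_apply, Equiv.Perm.mul_apply, rotNext_vertex,
      rotNext_edge, ih.1, ih.2]
    exact ⟨rfl, rfl⟩

theorem rotNext_isCycleOn (h : IsRot G rot) (x : α) (hx : x ∈ G.vertexSet) :
    (rotNext h).IsCycleOn {d : Dart G | d.vertex = x} := by
  classical
  refine ⟨Equiv.bijOn _ fun d => Iff.rfl, ?_⟩
  rintro d rfl d' hd'
  obtain ⟨n, hn⟩ := (h _ hx).1.isCycleOn_formPerm.exists_pow_eq' (List.finite_toSet _)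
    (((h _ hx).2 _).2 d.inc) (((h _ hx).2 d'.edge).2 (hd' ▸ d'.inc))
  refine ⟨(n : ℤ), Dart.ext' ?_ ?_⟩
  · rw [zpow_natCast, (rotNext_pow h d n).1, hd']
  · rw [zpow_natCast, (rotNext_pow h d n).2, hn]

/-- The embedding given by lists of edges, if it has genus zero. -/
noncomputable def embOfRot (h : IsRot G rot)
    (he : G.vertexSet.ncard + Nat.card (Quotient (Equiv.Perm.SameCycle.setoid
      (facePerm (rotNext h)))) = G.edgeSet.ncard + 2) : PlanarEmbedding G :=
  ⟨rotNext h, rotNext_isCycleOn h, he⟩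

open Classical in
theorem rotNext_induced {rot' : α → List β} (h : IsRot G rot) (h' : IsRot H rot') (hle : H ≤ G)
    (hf : ∀ x ∈ H.vertexSet, rot' x = (rot x).filter fun e => decide (e ∈ H.edgeSet))
    (d : Dart H) : ∃ k : ℕ, 0 < k ∧ (rotNext h ^ k) (d.incl hle) = (rotNext h' d).incl hle ∧
      ∀ j : ℕ, 0 < j → j < k → (rotNext h ^ j) (d.incl hle) ∉ Set.range (Dart.incl hle) := by
  have hx := d.inc.vertex_mem
  obtain ⟨k, hk, h1, h2⟩ := formPerm_filter (h _ (hle.1 hx)).1 (fun e => decide (e ∈ H.edgeSet))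
    (((h _ (hle.1 hx)).2 d.edge).2 (d.inc.mono hle)) (by simpa using d.inc.edge_mem)
  refine ⟨k, hk, Dart.ext' (rotNext_pow h _ k).1 ?_, fun j hj1 hj2 => ?_⟩
  · rw [(rotNext_pow h _ k).2]
    refine h1.trans ?_
    rw [← hf _ hx]
    rfl
  · rintro ⟨d', hd'⟩
    refine h2 j hj1 hj2 ?_
    have h3 := congrArg Dart.edge hd'
    rw [(rotNext_pow h _ j).2] at h3
    rw [decide_eq_true_iff]
    have h4 := d'.inc.edge_mem
    rw [← Dart.incl_edge hle, h3] at h4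
    exact h4

theorem sum_map_filter_of_eq_zero (z : β → ZMod 2) (p : β → Bool) (l : List β)
    (hz : ∀ e ∈ l, ¬ p e → z e = 0) : ((l.filter p).map z).sum = (l.map z).sum := by
  induction l with
  | nil => rfl
  | cons a l ih =>
    rw [List.filter_cons]
    have h1 := ih fun e he => hz e (by simp [he])
    split_ifs with h
    · simp [h1]
    · simp [h1, hz a (by simp) h]

/-- Restricting an embedding to a connected subgraph preserves Euler's formula. -/
theorem euler_of_induced (hG : Good G) (hH : Good H) (hle : H ≤ G) (σ : PlanarEmbedding G)
    (hrot : IsRot G rot) (next : Equiv.Perm (Dart H))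
    (hcyc : ∀ x ∈ H.vertexSet, next.IsCycleOn {d : Dart H | d.vertex = x})
    (hi : ∀ d : Dart H, ∃ k : ℕ, 0 < k ∧ (σ.next ^ k) (d.incl hle) = (next d).incl hle ∧
      ∀ j : ℕ, 0 < j → j < k → (σ.next ^ j) (d.incl hle) ∉ Set.range (Dart.incl hle)) :
    H.vertexSet.ncard + Nat.card (Quotient (Equiv.Perm.SameCycle.setoid (facePerm next))) =
      H.edgeSet.ncard + 2 := by
  classical
  refine euler_of_exists_side hH next hcyc
    (fun x hx => ⟨_, (hrot x (hle.1 hx)).filter hle⟩) fun z hz hev => ?_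
  -- Since `z` vanishes off `H`, the further edges of `G` do not change the sums, and vertices
  -- outside `H` contribute nothing.
  have hev' : IsEven G z := by
    intro x hx
    refine ⟨_, hrot x hx, ?_⟩
    rw [← sum_map_filter_of_eq_zero z (fun e => decide (e ∈ H.edgeSet)) _
      (fun e _ h => hz e (by simpa using h))]
    have h1 := (hrot x hx).filter hle
    by_cases hxH : x ∈ H.vertexSet
    · obtain ⟨l, hl, hs⟩ := hev x hxH
      rw [← hs]
      exact (List.Perm.map z (h1.perm hl)).sum_eq
    · rw [List.eq_nil_iff_forall_not_mem.2 fun e he => hxH ((h1.2 e).1 he).vertex_mem]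
      rfl
  obtain ⟨c, h1, h2⟩ := exists_side_dart hG σ hev'
  refine ⟨fun d => c (d.incl hle), fun d => ?_, fun d => ?_⟩
  · obtain ⟨k, hk, hk1, hk2⟩ := hi d
    show c ((next d).incl hle) = c (d.rev.incl hle)
    rw [← hk1]
    -- Between a dart of `H` and its successor in `H` the rotation of `σ` meets only edges with `z =
    -- 0`, so the colour changes only once, at the start.
    have h3 : ∀ j : ℕ, 0 < j → j ≤ k →
        c ((σ.next ^ j) (d.incl hle)) = c (d.incl hle) + z d.edge := by
      intro j hj
      induction j, hj using Nat.le_induction with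
      | base =>
        intro _
        rw [pow_one, h1, h2]
        rfl
      | succ j hj ih =>
        intro hjk
        rw [pow_succ', Equiv.Perm.mul_apply, h1, h2, ih (by omega)]
        have h4 : z ((σ.next ^ j) (d.incl hle)).edge = 0 := by
          refine hz _ fun hmem => hk2 j hj (by omega) ?_
          exact ⟨mkDart ((hle.inc_congr hmem).2 ((σ.next ^ j) (d.incl hle)).inc), rfl⟩
        rw [h4, add_zero]
    rw [h3 k hk le_rfl, ← Dart.incl_edge hle, ← h2]
    congr 1
    refine Dart.ext' ?_ rfl
    exact ((d.incl hle).isLink).right_unique (d.isLink.mono hle)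
  · show c (d.rev.incl hle) = c (d.incl hle) + z d.edge
    rw [← Dart.incl_edge hle, ← h2]
    congr 1
    refine Dart.ext' ?_ rfl
    exact (d.isLink.mono hle).right_unique ((d.incl hle).isLink)

/-- A labelling of the faces with sufficiently many labels certifies genus zero. -/
theorem euler_of_labels (hG : Good G) (hrot : IsRot G rot) {L : Type*} (F : α → β → L)
    (hF : ∀ d : Dart G, F d.vertex (rotNext hrot d).edge = F d.rev.vertex d.edge)
    (ι : β → α ⊕ L) (hι : Set.InjOn ι G.edgeSet) (a b : α ⊕ L) (hab : a ≠ b)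
    (hm : ∀ e ∈ G.edgeSet, ι e ≠ a ∧ ι e ≠ b)
    (hT : ∀ t : α ⊕ L, (t = a ∨ t = b ∨ t ∈ ι '' G.edgeSet) →
      Sum.elim (· ∈ G.vertexSet) (fun y => ∃ x e, G.Inc e x ∧ F x e = y) t) :
    G.vertexSet.ncard + Nat.card (Quotient (Equiv.Perm.SameCycle.setoid
      (facePerm (rotNext hrot)))) = G.edgeSet.ncard + 2 := by
  -- One inequality is nonnegativity of the genus. For the other, `ι` together with `a` and `b`
  -- gives `|E| + 2` different elements, each a vertex or a label that occurs; labels are constant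
  -- on faces, so at most `|F|` occur.
  refine le_antisymm (card_faces_le hG _ (rotNext_isCycleOn hrot)) ?_
  have := finite_dart hG.finV hG.finE
  let f : Quotient (Equiv.Perm.SameCycle.setoid (facePerm (rotNext hrot))) → L :=
    Quotient.lift (fun d : Dart G => F d.vertex d.edge) fun d d' h => eq_of_sameCycle
      (c := fun d : Dart G => F d.vertex d.edge) (fun d => by
        have h1 := hF d.rev
        rw [Dart.rev_rev] at h1
        exact h1) h
  have hsub : insert a (insert b (ι '' G.edgeSet)) ⊆
      Sum.inl '' G.vertexSet ∪ Sum.inr '' Set.range f := by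
    intro t ht
    have h1 := hT t (by simpa only [Set.mem_insert_iff] using ht)
    rcases t with x | y
    · exact Or.inl ⟨x, h1, rfl⟩
    · obtain ⟨x, e, h, rfl⟩ := h1
      exact Or.inr ⟨_, ⟨Quotient.mk _ (mkDart h), rfl⟩, rfl⟩
  have hfin : (Sum.inl '' G.vertexSet ∪ Sum.inr '' Set.range f : Set (α ⊕ L)).Finite :=
    (hG.finV.image _).union ((Set.finite_range f).image _)
  have h1 := Set.ncard_le_ncard hsub hfin
  rw [Set.ncard_insert_of_notMem _ ((hG.finE.image _).insert _),
    Set.ncard_insert_of_notMem _ (hG.finE.image _), hι.ncard_image] at h1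
  · have h2 := Set.ncard_union_le (Sum.inl '' G.vertexSet) (Sum.inr '' Set.range f : Set (α ⊕ L))
    rw [Set.ncard_image_of_injective _ Sum.inl_injective,
      Set.ncard_image_of_injective _ Sum.inr_injective] at h2
    have h3 : (Set.range f).ncard ≤ Nat.card (Quotient (Equiv.Perm.SameCycle.setoid
      (facePerm (rotNext hrot)))) := by
      rw [← Set.image_univ, ← Set.ncard_univ]
      exact Set.ncard_image_le Set.finite_univ
    omega
  · rintro ⟨e, he, h⟩
    exact (hm e he).2 h
  · rintro (h | ⟨e, he, h⟩)
    · exact hab h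
    · exact (hm e he).1 h

end

/-! ### Nets: villages with linked houses -/

/-- A non-crossing matching of `{1, …, N}`, as an involution. -/
structure Page (N : ℕ) where
  mate : ℕ → ℕ
  invol : ∀ i, mate (mate i) = i
  fixed : ∀ i, i ∉ Set.Icc 1 N → mate i = i
  -- The left side needs no clause: `mate j < i` is excluded by applying the condition to `mate j`
  -- and `i`.
  nonCrossing : ∀ i j, i < j → j < mate i → mate j < mate i

theorem Page.mem {N : ℕ} (π : Page N) {i : ℕ} (hi : i ∈ Set.Icc 1 N) : π.mate i ∈ Set.Icc 1 N := by
  by_contra h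
  have h1 := π.fixed _ h
  rw [π.invol] at h1
  exact h (h1 ▸ hi)

/-- The ends of the edges of a net: `wall i 7` links the houses `i` and `π i`, and `claw i 4` links
their inhabitants. -/
def netEnds (s : ℕ) (π : ℕ → ℕ) : VillageEdge → VillageVertex × VillageVertex
  | .spoke k => (.centre, .rim k)
  | .surface k => (.rim k, .rim (if k = 4 * s then 1 else k + 1))
  | .wall i k => if k = 7 then (.house i 6, .house (π i) 2) else
      (houseVertex i k, houseVertex i (k + 1))
  | .claw i k => if k = 4 then (.inhabitant i, .inhabitant (π i)) else
      (.inhabitant i, .house i (2 * k))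

/-- The edges of a net. In stage 1 the net is a village. In stage 2, the houses `i` and `π i` are
linked; in stage 3 they are partly detached from the planet; in stage 4 their inhabitants are linked
as well. -/
def NetEdge (s N : ℕ) (π : ℕ → ℕ) (t : ℕ) : VillageEdge → Prop
  | .spoke k => 1 ≤ k ∧ k ≤ 4 * s
  | .surface k => 1 ≤ k ∧ k ≤ 4 * s
  -- From stage 3 on, the left house of a pair lacks wall 6 and the right one lacks wall 1. The
  -- remaining walls and the link form one arch. An unmatched house satisfies both inequalities and
  -- keeps all its walls.
  | .wall i k => (1 ≤ i ∧ i ≤ N) ∧ ((2 ≤ k ∧ k ≤ 5) ∨ (k = 1 ∧ (t ≤ 2 ∨ i ≤ π i)) ∨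
      (k = 6 ∧ (t ≤ 2 ∨ π i ≤ i)) ∨ (k = 7 ∧ 2 ≤ t ∧ i < π i))
  | .claw i k => (1 ≤ i ∧ i ≤ N) ∧ ((1 ≤ k ∧ k ≤ 3) ∨ (k = 4 ∧ 4 ≤ t ∧ i < π i))

theorem isVillageVertex_netEnds {s N : ℕ} (hN : N ≤ s) (π : Page N) {t : ℕ} {e : VillageEdge}
    (he : NetEdge s N π.mate t e) :
    IsVillageVertex s (Set.Icc 1 N) (netEnds s π.mate e).1 ∧
      IsVillageVertex s (Set.Icc 1 N) (netEnds s π.mate e).2 := by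
  cases e with
  | spoke k => exact ⟨trivial, he⟩
  | surface k => exact isVillageVertex_ends (m := s) (I := Set.Icc 1 N) (e := .surface k) he
  | wall i k =>
    have h1 : i ∈ Set.Icc 1 N ∩ Set.Icc 1 s := ⟨he.1, he.1.1, he.1.2.trans hN⟩
    have h2 := π.mem h1.1
    simp only [netEnds]
    split_ifs with h
    · exact ⟨⟨h1, by simp⟩, ⟨⟨h2, h2.1, h2.2.trans hN⟩, by simp⟩⟩
    · have h3 : 1 ≤ k ∧ k ≤ 6 := by
        have := he.2
        omega
      exact ⟨isVillageVertex_houseVertex h1 ⟨h3.1, by omega⟩,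
        isVillageVertex_houseVertex h1 ⟨by omega, by omega⟩⟩
  | claw i k =>
    have h1 : i ∈ Set.Icc 1 N ∩ Set.Icc 1 s := ⟨he.1, he.1.1, he.1.2.trans hN⟩
    have h2 := π.mem h1.1
    simp only [netEnds]
    split_ifs with h
    · exact ⟨h1, h2, h2.1, h2.2.trans hN⟩
    · refine ⟨h1, h1, ?_⟩
      have := he.2
      constructor <;> omega

/-- The net with houses `1, …, N` on a planet of equator `s`, linked along a page. -/
def net {s N : ℕ} (hN : N ≤ s) (π : Page N) (t : ℕ) : Graph VillageVertex VillageEdge where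
  vertexSet := {x | IsVillageVertex s (Set.Icc 1 N) x}
  edgeSet := {e | NetEdge s N π.mate t e}
  IsLink e x y := NetEdge s N π.mate t e ∧
    s(x, y) = s((netEnds s π.mate e).1, (netEnds s π.mate e).2)
  isLink_symm := fun _ _ => ⟨fun _ _ h => ⟨h.1, Sym2.eq_swap.trans h.2⟩⟩
  eq_or_eq_of_isLink_of_isLink := by
    intro e x y v w h h'
    have := h.2.trans h'.2.symm
    rw [Sym2.eq_iff] at this
    tauto
  edge_mem_iff_exists_isLink := fun _ => ⟨fun h => ⟨_, _, h, rfl⟩, fun ⟨_, _, h⟩ => h.1⟩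
  left_mem_of_isLink := by
    intro e x y h
    have h1 := isVillageVertex_netEnds hN π h.1
    have h2 := h.2
    rw [Sym2.eq_iff] at h2
    rcases h2 with h2 | h2
    · exact h2.1 ▸ h1.1
    · exact h2.1 ▸ h1.2

section

variable {s N : ℕ} {hN : N ≤ s} {π : Page N} {t : ℕ}

theorem net_isLink_iff {e : VillageEdge} {x y : VillageVertex} :
    (net hN π t).IsLink e x y ↔ NetEdge s N π.mate t e ∧
      ((x = (netEnds s π.mate e).1 ∧ y = (netEnds s π.mate e).2) ∨
        (x = (netEnds s π.mate e).2 ∧ y = (netEnds s π.mate e).1)) :=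
  and_congr_right fun _ => Sym2.eq_iff

theorem net_inc_iff {e : VillageEdge} {x : VillageVertex} :
    (net hN π t).Inc e x ↔ NetEdge s N π.mate t e ∧
      (x = (netEnds s π.mate e).1 ∨ x = (netEnds s π.mate e).2) := by
  constructor
  · rintro ⟨y, h⟩
    rw [net_isLink_iff] at h
    tauto
  · rintro ⟨h, rfl | rfl⟩
    · exact ⟨_, net_isLink_iff.2 ⟨h, Or.inl ⟨rfl, rfl⟩⟩⟩
    · exact ⟨_, net_isLink_iff.2 ⟨h, Or.inr ⟨rfl, rfl⟩⟩⟩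

theorem mem_net_edgeSet {e : VillageEdge} :
    e ∈ (net hN π t).edgeSet ↔ NetEdge s N π.mate t e := Iff.rfl

end

/-- The edges that can occur at a vertex of a net, in clockwise order, when the planet has its
centre inside, and the inhabitant of the house `i` is inside if `g i` is true. -/
def netRot (s : ℕ) (π : ℕ → ℕ) (g : ℕ → Bool) : VillageVertex → List VillageEdge
  | .centre => (List.range (4 * s)).map fun k => .spoke (k + 1)
  | .rim k =>
    if k % 4 = 1 then
      [.surface (if k = 1 then 4 * s else k - 1), .wall (k / 4 + 1) 1, .surface k, .spoke k]
    else if k % 4 = 3 then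
      [.surface (if k = 1 then 4 * s else k - 1), .wall (k / 4 + 1) 6, .surface k, .spoke k]
    else [.surface (if k = 1 then 4 * s else k - 1), .surface k, .spoke k]
  | .house i k =>
    if k = 2 then
      -- A link carries the label of its left house, so at `v_2` it appears with index `π i`.
      -- Entries that are not edges at the current stage are removed in `netList`.
      if g i then [.wall i 1, .wall (π i) 7, .wall i 2, .claw i 1]
      else [.wall i 1, .wall (π i) 7, .claw i 1, .wall i 2]
    else if k = 3 then [.wall i 2, .wall i 3]
    else if k = 4 then
      if g i then [.wall i 3, .wall i 4, .claw i 2] else [.wall i 3, .claw i 2, .wall i 4]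
    else if k = 5 then [.wall i 4, .wall i 5]
    else
      if g i then [.wall i 7, .wall i 6, .claw i 3, .wall i 5]
      else [.wall i 7, .wall i 6, .wall i 5, .claw i 3]
  | .inhabitant i =>
    if g i then [.claw i 1, .claw i 2, .claw i 3, .claw (min i (π i)) 4]
    else [.claw i 1, .claw (min i (π i)) 4, .claw i 3, .claw i 2]

section

variable {s N : ℕ} {hN : N ≤ s} {π : Page N} {t : ℕ}

theorem netRot_nodup (g : ℕ → Bool) {x : VillageVertex}
    (hx : IsVillageVertex s (Set.Icc 1 N) x) : (netRot s π.mate g x).Nodup := by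
  cases x with
  | centre =>
    refine List.Nodup.map ?_ List.nodup_range
    intro a b h
    simpa using h
  | rim k =>
    have h : 1 ≤ k ∧ k ≤ 4 * s := hx
    have h' : (if k = 1 then 4 * s else k - 1) ≠ k := by split_ifs <;> omega
    simp only [netRot]
    split_ifs at h' ⊢ <;> simp [h']
  | house i k =>
    simp only [netRot]
    split_ifs <;> simp
  | inhabitant i =>
    simp only [netRot]
    split_ifs <;> simp

theorem mem_netRot (g : ℕ → Bool) {x : VillageVertex} {e : VillageEdge}
    (hx : IsVillageVertex s (Set.Icc 1 N) x) (he : NetEdge s N π.mate t e) :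
    e ∈ netRot s π.mate g x ↔ x = (netEnds s π.mate e).1 ∨ x = (netEnds s π.mate e).2 := by
  cases x with
  | centre =>
    cases e with
    | spoke k =>
      have h : 1 ≤ k ∧ k ≤ 4 * s := he
      simp only [netRot, netEnds, List.mem_map, List.mem_range, true_or, iff_true]
      exact ⟨k - 1, by omega, by congr 1; omega⟩
    | surface k => simp [netRot, netEnds]
    | wall i k => simp [netRot, netEnds, houseVertex]; split_ifs <;> simp
    | claw i k => simp [netRot, netEnds]; split_ifs <;> simp
  | rim k =>
    have h : 1 ≤ k ∧ k ≤ 4 * s := hx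
    cases e with
    | spoke j => simp [netRot, netEnds]; split_ifs <;> simp <;> omega
    | surface j =>
      have h : 1 ≤ j ∧ j ≤ 4 * s := he
      simp [netRot, netEnds]; split_ifs <;> simp <;> omega
    | wall i j =>
      have hi := he.1
      have hj := he.2
      simp only [netRot, netEnds, houseVertex]
      split_ifs <;> simp <;> omega
    | claw i j => simp [netRot, netEnds]; split_ifs <;> simp
  | house i k =>
    have h : 2 ≤ k ∧ k ≤ 6 := hx.2
    cases e with
    | spoke j => simp [netRot, netEnds]; split_ifs <;> simp
    | surface j => simp [netRot, netEnds]; split_ifs <;> simp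
    | wall i' j =>
      have hi := he.1
      have hj := he.2
      have h1 := π.invol i
      have h2 := π.invol i'
      have h3 : i' = π.mate i ↔ i = π.mate i' := ⟨fun h => h ▸ h1.symm, fun h => h ▸ h2.symm⟩
      simp only [netRot, netEnds, houseVertex]
      split_ifs <;> simp <;> omega
    | claw i' j =>
      have hj := he.2
      simp only [netRot, netEnds]
      split_ifs <;> simp <;> omega
  | inhabitant i =>
    cases e with
    | spoke j => simp [netRot, netEnds]; split_ifs <;> simp
    | surface j => simp [netRot, netEnds]; split_ifs <;> simp
    | wall i' j => simp [netRot, netEnds, houseVertex]; split_ifs <;> simp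
    | claw i' j =>
      have hj := he.2
      have h1 := π.invol i
      have h2 := π.invol i'
      have h3 : i' = π.mate i ↔ i = π.mate i' := ⟨fun h => h ▸ h1.symm, fun h => h ▸ h2.symm⟩
      simp only [netRot, netEnds]
      split_ifs <;> simp <;> grind

open Classical in
/-- The rotation lists of a net. -/
noncomputable def netList (s N : ℕ) (π : ℕ → ℕ) (t : ℕ) (g : ℕ → Bool) (x : VillageVertex) :
    List VillageEdge :=
  (netRot s π g x).filter fun e => decide (NetEdge s N π t e)

theorem isRot_netList (hN : N ≤ s) (π : Page N) (t : ℕ) (g : ℕ → Bool) :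
    IsRot (net hN π t) (netList s N π.mate t g) := by
  intro x hx
  refine ⟨(netRot_nodup g hx).filter _, fun e => ?_⟩
  classical
  rw [netList, List.mem_filter, decide_eq_true_iff, net_inc_iff]
  exact ⟨fun h => ⟨h.2, (mem_netRot g hx h.2).1 h.1⟩, fun h => ⟨(mem_netRot g hx h.1).2 h.2, h.1⟩⟩

end

/-! ### Inclusions between nets, simplicity and minimum degree -/

section

variable {s N : ℕ} {hN : N ≤ s} {π : Page N} {t : ℕ}

theorem villageEnds_eq_netEnds {I : Set ℕ} {e : VillageEdge} (he : IsVillageEdge s I e)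
    (π : ℕ → ℕ) : villageEnds s e = netEnds s π e := by
  cases e with
  | spoke k => rfl
  | surface k => rfl
  | wall i k =>
    have : k ≠ 7 := by
      rintro rfl
      exact absurd he.2.2 (by norm_num)
    simp [villageEnds, netEnds, this]
  | claw i k =>
    have h1 := he.2.1
    have h2 := he.2.2
    have h3 : k ≠ 4 := by omega
    have h4 : 2 * k ≠ 1 := by omega
    have h5 : 2 * k ≠ 7 := by omega
    simp [villageEnds, netEnds, h3, houseVertex, h4, h5]

theorem isVillageEdge_iff_netEdge (hN : N ≤ s) (π : ℕ → ℕ) (e : VillageEdge) :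
    IsVillageEdge s (Set.Icc 1 N) e ↔ NetEdge s N π 1 e := by
  cases e with
  | spoke k => exact Iff.rfl
  | surface k => exact Iff.rfl
  | wall i k =>
    simp only [IsVillageEdge, NetEdge, Set.mem_inter_iff, Set.mem_Icc]
    omega
  | claw i k =>
    simp only [IsVillageEdge, NetEdge, Set.mem_inter_iff, Set.mem_Icc]
    omega

/-- A net of stage 1 has no links and does not depend on the page, which allows passing from one
page to another. -/
theorem net_one (hN : N ≤ s) (π : Page N) : net hN π 1 = village s (Set.Icc 1 N) := by
  refine Graph.ext rfl fun e x y => ?_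
  constructor
  · rintro ⟨h1, h2⟩
    have h3 := (isVillageEdge_iff_netEdge hN _ _).2 h1
    exact ⟨h3, h2.trans (by rw [villageEnds_eq_netEnds h3 π.mate])⟩
  · rintro ⟨h1, h2⟩
    exact ⟨(isVillageEdge_iff_netEdge hN _ _).1 h1,
      h2.trans (by rw [villageEnds_eq_netEnds h1 π.mate])⟩

theorem net_mono {t' : ℕ} (h : ∀ e, NetEdge s N π.mate t e → NetEdge s N π.mate t' e) :
    net hN π t ≤ net hN π t' :=
  Graph.IsSubgraph.mk (fun _ hx => hx) fun _ _ _ hl => ⟨h _ hl.1, hl.2⟩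

theorem net_one_le_two : net hN π 1 ≤ net hN π 2 := by
  refine net_mono fun e => ?_
  cases e <;> simp only [NetEdge] <;> omega

theorem net_three_le_two : net hN π 3 ≤ net hN π 2 := by
  refine net_mono fun e => ?_
  cases e <;> simp only [NetEdge] <;> omega

theorem net_three_le_four : net hN π 3 ≤ net hN π 4 := by
  refine net_mono fun e => ?_
  cases e <;> simp only [NetEdge] <;> omega

theorem village_mono {I J : Set ℕ} (h : I ⊆ J) : village s I ≤ village s J := by
  refine Graph.IsSubgraph.mk (fun x hx => ?_) fun e x y hl => ⟨?_, hl.2⟩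
  · cases x with
    | centre => trivial
    | rim k => exact hx
    | house i k => exact ⟨⟨h hx.1.1, hx.1.2⟩, hx.2⟩
    | inhabitant i => exact ⟨h hx.1, hx.2⟩
  · have he := hl.1
    cases e with
    | spoke k => exact he
    | surface k => exact he
    | wall i k => exact ⟨⟨h he.1.1, he.1.2⟩, he.2⟩
    | claw i k => exact ⟨⟨h he.1.1, he.1.2⟩, he.2⟩

theorem netEnds_injective (π : Page N) {e f : VillageEdge} (he : NetEdge s N π.mate t e)
    (hf : NetEdge s N π.mate t f)
    (h : s((netEnds s π.mate e).1, (netEnds s π.mate e).2) =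
      s((netEnds s π.mate f).1, (netEnds s π.mate f).2)) : e = f := by
  rw [Sym2.eq_iff] at h
  cases e with
  | spoke k =>
    cases f with
    | spoke j => simpa [netEnds] using h
    | surface j => simp [netEnds] at h
    | wall j l => simp only [netEnds, houseVertex] at h; split_ifs at h <;> simp at h
    | claw j l => simp only [netEnds] at h; split_ifs at h <;> simp at h
  | surface k =>
    have he : 1 ≤ k ∧ k ≤ 4 * s := he
    cases f with
    | surface j =>
      have hf : 1 ≤ j ∧ j ≤ 4 * s := hf
      simp only [netEnds] at h
      split_ifs at h <;> simp at h ⊢ <;> omega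
    | wall j l =>
      have hf := hf.2
      simp only [netEnds, houseVertex] at h; split_ifs at h <;> simp at h ⊢ <;> omega
    | _ => simp only [netEnds] at h; split_ifs at h <;> simp at h ⊢
  | wall i k =>
    have he := he.2
    have h1 := π.invol i
    cases f with
    | wall j l =>
      have hf := hf.2
      have h2 := π.invol j
      simp only [netEnds, houseVertex] at h
      split_ifs at h <;> simp at h ⊢ <;> omega
    | _ => simp only [netEnds, houseVertex] at h; split_ifs at h <;> simp at h ⊢ <;> omega
  | claw i k =>
    have he := he.2
    have h1 := π.invol i
    cases f with
    | claw j l =>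
      have hf := hf.2
      have h2 := π.invol j
      simp only [netEnds] at h
      split_ifs at h <;> simp at h ⊢ <;> grind
    | _ => simp only [netEnds, houseVertex] at h; split_ifs at h <;> simp at h ⊢

theorem net_simple (hN : N ≤ s) (π : Page N) (t : ℕ) : (net hN π t).Simple := by
  refine { not_isLoopAt := ?_, eq_of_isLink := ?_ }
  · intro e x hl
    have h1 := (net_isLink_iff.1 hl).2
    have he := hl.1
    have h2 : (netEnds s π.mate e).1 = (netEnds s π.mate e).2 := by grind
    cases e with
    | spoke k => simp [netEnds] at h2
    | surface k =>
      have he : 1 ≤ k ∧ k ≤ 4 * s := he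
      simp only [netEnds] at h2
      split_ifs at h2 <;> simp at h2 <;> omega
    | wall i k =>
      simp only [netEnds, houseVertex] at h2
      split_ifs at h2 <;> simp at h2 <;> omega
    | claw i k =>
      have he := he.2
      simp only [netEnds] at h2
      split_ifs at h2 <;> simp at h2; omega
  · intro e f x y he hf
    exact netEnds_injective π he.1 hf.1 (he.2.symm.trans hf.2)

theorem net_sparse (hN : N ≤ s) (π : Page N) (t : ℕ) (hs : 0 < s) : Sparse (net hN π t) := by
  refine ⟨net_simple hN π t, fun x hx => ?_⟩
  simp only [net_inc_iff]
  cases x with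
  | centre =>
    exact ⟨.spoke 1, .spoke 2, by simp, ⟨⟨by omega, by omega⟩, Or.inl rfl⟩,
      ⟨⟨by omega, by omega⟩, Or.inl rfl⟩⟩
  | rim k => exact ⟨.surface k, .spoke k, by simp, ⟨hx, Or.inl rfl⟩, ⟨hx, Or.inr rfl⟩⟩
  | house i k =>
    have h1 := hx.1.1
    have h2 : 2 ≤ k ∧ k ≤ 6 := hx.2
    rcases (show k = 2 ∨ k = 6 ∨ (3 ≤ k ∧ k ≤ 5) by omega) with rfl | rfl | h3
    · exact ⟨.wall i 2, .claw i 1, by simp, ⟨⟨h1, by omega⟩, Or.inl rfl⟩,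
        ⟨⟨h1, by omega⟩, Or.inr rfl⟩⟩
    · exact ⟨.wall i 5, .claw i 3, by simp, ⟨⟨h1, by omega⟩, Or.inr rfl⟩,
        ⟨⟨h1, by omega⟩, Or.inr rfl⟩⟩
    · refine ⟨.wall i k, .wall i (k - 1), by simp; omega, ⟨⟨h1, by omega⟩, Or.inl ?_⟩,
        ⟨⟨h1, by omega⟩, Or.inr ?_⟩⟩
      · simp only [netEnds, houseVertex]
        split_ifs <;> first | rfl | (exfalso; omega)
      · simp only [netEnds, houseVertex]
        split_ifs <;> first | rfl | (exfalso; omega) | (congr 1; omega)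
  | inhabitant i =>
    exact ⟨.claw i 1, .claw i 2, by simp, ⟨⟨hx.1, by omega⟩, Or.inl rfl⟩,
      ⟨⟨hx.1, by omega⟩, Or.inl rfl⟩⟩

end

/-! ### 2-connectedness -/

section

variable {α β : Type*} {G : Graph α β}

/-- `y` can be reached from `x` in `G` without visiting `z`. -/
def ReachAvoid (G : Graph α β) (z : α) : α → α → Prop :=
  Relation.ReflTransGen fun a b => G.Adj a b ∧ a ≠ z ∧ b ≠ z

theorem ReachAvoid.symm {x y z : α} (h : ReachAvoid G z x y) : ReachAvoid G z y x := by
  have : Std.Symm fun a b => G.Adj a b ∧ a ≠ z ∧ b ≠ z :=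
    ⟨fun _ _ h => ⟨h.1.symm, h.2.2, h.2.1⟩⟩
  exact (Relation.ReflTransGen.stdSymm (r := fun a b => G.Adj a b ∧ a ≠ z ∧ b ≠ z)).symm _ _ h

theorem ReachAvoid.adj {x y z : α} (h : G.Adj x y) (hx : x ≠ z) (hy : y ≠ z) :
    ReachAvoid G z x y := Relation.ReflTransGen.single ⟨h, hx, hy⟩

/-- Along a path both ends of which are joined to `r` if they differ from `z`, every vertex other
than `z` is joined to `r`. -/
theorem ReachAvoid.ear {z r : α} (p : ℕ → α) (n : ℕ) (hp : ∀ j < n, G.Adj (p j) (p (j + 1)))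
    (hinj : ∀ i ≤ n, ∀ j ≤ n, p i = p j → i = j) (h0 : p 0 ≠ z → ReachAvoid G z (p 0) r)
    (hn : p n ≠ z → ReachAvoid G z (p n) r) {j : ℕ} (hj : j ≤ n) (hz : p j ≠ z) :
    ReachAvoid G z (p j) r := by
  have down : ∀ j ≤ n, (∀ i ≤ j, p i ≠ z) → ReachAvoid G z (p j) r := by
    intro j
    induction j with
    | zero => intro _ h; exact h0 (h 0 le_rfl)
    | succ j ih =>
      intro hj h
      exact (ReachAvoid.adj (hp j hj).symm (h _ le_rfl) (h j (by omega))).trans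
        (ih (by omega) fun i hi => h i (by omega))
  have up : ∀ k j, j + k = n → (∀ i, j ≤ i → i ≤ n → p i ≠ z) → ReachAvoid G z (p j) r := by
    intro k
    induction k with
    | zero =>
      intro j hj h
      obtain rfl : j = n := by omega
      exact hn (h _ le_rfl le_rfl)
    | succ k ih =>
      intro j hj h
      exact (ReachAvoid.adj (hp j (by omega)) (h _ le_rfl (by omega))
        (h _ (by omega) (by omega))).trans
        (ih (j + 1) (by omega) fun i hi => h i (by omega))
  -- Deleting `z` breaks the path in at most one place, so one of the two ends can still be reached.
  by_cases h : ∀ i ≤ j, p i ≠ z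
  · exact down j hj h
  · push Not at h
    obtain ⟨i, hi, rfl⟩ := h
    refine up (n - j) j (by omega) fun i' h1 h2 h3 => ?_
    have := hinj i' h2 i (by omega) h3
    obtain rfl : i = j := by omega
    exact hz rfl

theorem reachable_of_reachAvoid {z x y : α} (h : ReachAvoid G z x y) (hx : x ∈ G.vertexSet)
    (hy : y ∈ G.vertexSet) : G.toSimpleGraph.Reachable ⟨x, hx⟩ ⟨y, hy⟩ := by
  induction h with
  | refl => exact SimpleGraph.Reachable.refl _
  | tail h1 h2 ih =>
    rename_i b c
    refine (ih h2.1.left_mem).trans ?_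
    by_cases heq : b = c
    · subst heq; exact SimpleGraph.Reachable.refl _
    · exact SimpleGraph.Adj.reachable ⟨fun h => heq (congrArg Subtype.val h), h2.1⟩

theorem induce_reachable_of_reachAvoid {z x y : α} (hz : z ∈ G.vertexSet)
    (h : ReachAvoid G z x y) (hx : x ∈ G.vertexSet) (hxz : x ≠ z)
    (hy : y ∈ G.vertexSet) (hyz : y ≠ z) :
    (G.toSimpleGraph.induce {(⟨z, hz⟩ : G.vertexSet)}ᶜ).Reachable
      ⟨⟨x, hx⟩, fun h => hxz (congrArg Subtype.val h)⟩
      ⟨⟨y, hy⟩, fun h => hyz (congrArg Subtype.val h)⟩ := by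
  induction h with
  | refl => exact SimpleGraph.Reachable.refl _
  | tail h1 h2 ih =>
    rename_i b c
    refine (ih h2.1.left_mem h2.2.1).trans ?_
    by_cases heq : b = c
    · subst heq; exact SimpleGraph.Reachable.refl _
    · exact SimpleGraph.Adj.reachable
        (show G.toSimpleGraph.Adj _ _ from ⟨fun h => heq (congrArg Subtype.val h), h2.1⟩)

theorem twoConnected_of_reachAvoid (h2 : 2 < G.vertexSet.ncard)
    (h : ∀ z ∈ G.vertexSet, ∃ r ∈ G.vertexSet, r ≠ z ∧
      ∀ y ∈ G.vertexSet, y ≠ z → ReachAvoid G z y r) : TwoConnected G := by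
  have key : ∀ z ∈ G.vertexSet, ∀ x ∈ G.vertexSet, ∀ y ∈ G.vertexSet, x ≠ z → y ≠ z →
      ReachAvoid G z x y := by
    intro z hz x hx y hy hxz hyz
    obtain ⟨r, -, -, hr⟩ := h z hz
    exact (hr x hx hxz).trans (hr y hy hyz).symm
  refine ⟨h2, ?_, ?_⟩
  · have hne : G.vertexSet.Nonempty := Set.nonempty_of_ncard_ne_zero (by omega)
    have := hne.to_subtype
    refine ⟨fun ⟨x, hx⟩ ⟨y, hy⟩ => ?_⟩
    -- Connectedness itself follows by avoiding some third vertex.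
    obtain ⟨z, hz, hzxy⟩ : ∃ z ∈ G.vertexSet, z ∉ ({x, y} : Set α) := by
      by_contra! hc
      have h3 := Set.ncard_le_ncard (s := G.vertexSet) (t := {x, y}) hc (by simp)
      have h4 := Set.ncard_insert_le x ({y} : Set α)
      rw [Set.ncard_singleton] at h4
      omega
    refine reachable_of_reachAvoid (z := z) (key z hz x hx y hy ?_ ?_) hx hy
    · rintro rfl; simp at hzxy
    · rintro rfl; simp at hzxy
  · rintro ⟨z, hz⟩
    obtain ⟨r, hr, hrz, -⟩ := h z hz
    have : Nonempty ↑({(⟨z, hz⟩ : G.vertexSet)}ᶜ : Set G.vertexSet) :=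
      ⟨⟨⟨r, hr⟩, fun h => hrz (congrArg Subtype.val h)⟩⟩
    refine ⟨fun ⟨⟨x, hx⟩, hxz⟩ ⟨⟨y, hy⟩, hyz⟩ => ?_⟩
    have hx' : x ≠ z := fun h => hxz (Subtype.ext h)
    have hy' : y ≠ z := fun h => hyz (Subtype.ext h)
    exact induce_reachable_of_reachAvoid hz (key z hz x hx y hy hx' hy') hx hx' hy hy'

end

/-! ### Size and 2-connectedness of nets -/

section

variable {s N : ℕ} {hN : N ≤ s} {π : Page N} {t : ℕ}

theorem ncard_Icc (a b : ℕ) : (Set.Icc a b).ncard = b + 1 - a := by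
  rw [← Finset.coe_Icc, Set.ncard_coe_finset, Nat.card_Icc]

theorem net_finite_vertexSet (hN : N ≤ s) (π : Page N) (t : ℕ) :
    (net hN π t).vertexSet.Finite ∧ (net hN π t).vertexSet.ncard ≤ 1 + 4 * s + 6 * N := by
  have hsub : (net hN π t).vertexSet ⊆ (({VillageVertex.centre} ∪
      VillageVertex.rim '' Set.Icc 1 (4 * s)) ∪
      (fun p : ℕ × ℕ => VillageVertex.house p.1 p.2) '' (Set.Icc 1 N ×ˢ Set.Icc 2 6)) ∪
      VillageVertex.inhabitant '' Set.Icc 1 N := by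
    intro x hx
    cases x with
    | centre => exact Or.inl (Or.inl (Or.inl rfl))
    | rim k => exact Or.inl (Or.inl (Or.inr ⟨k, hx, rfl⟩))
    | house i k => exact Or.inl (Or.inr ⟨(i, k), ⟨hx.1.1, hx.2⟩, rfl⟩)
    | inhabitant i => exact Or.inr ⟨i, hx.1, rfl⟩
  have f1 := Set.finite_Icc 1 (4 * s)
  have f2 := (Set.finite_Icc 1 N).prod (Set.finite_Icc 2 6)
  have f3 := Set.finite_Icc 1 N
  have hfin := ((((Set.finite_singleton VillageVertex.centre).union
    (f1.image VillageVertex.rim)).union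
    (f2.image fun p : ℕ × ℕ => VillageVertex.house p.1 p.2)).union
    (f3.image VillageVertex.inhabitant))
  refine ⟨hfin.subset hsub, ?_⟩
  have h0 := Set.ncard_le_ncard hsub hfin
  have h1 := (Set.ncard_union_le _ _).trans (Nat.add_le_add ((Set.ncard_union_le _ _).trans
    (Nat.add_le_add ((Set.ncard_union_le _ _).trans (Nat.add_le_add
      (Set.ncard_singleton VillageVertex.centre).le (Set.ncard_image_le f1)))
      (Set.ncard_image_le f2))) (Set.ncard_image_le f3)) |> h0.trans
  rw [Set.ncard_prod, ncard_Icc, ncard_Icc, ncard_Icc] at h1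
  omega

theorem net_finite_edgeSet (hN : N ≤ s) (π : Page N) (t : ℕ) :
    (net hN π t).edgeSet.Finite ∧ (net hN π t).edgeSet.ncard ≤ 8 * s + 11 * N := by
  have hsub : (net hN π t).edgeSet ⊆ ((VillageEdge.spoke '' Set.Icc 1 (4 * s) ∪
      VillageEdge.surface '' Set.Icc 1 (4 * s)) ∪
      (fun p : ℕ × ℕ => VillageEdge.wall p.1 p.2) '' (Set.Icc 1 N ×ˢ Set.Icc 1 7)) ∪
      (fun p : ℕ × ℕ => VillageEdge.claw p.1 p.2) '' (Set.Icc 1 N ×ˢ Set.Icc 1 4) := by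
    intro e he
    cases e with
    | spoke k => exact Or.inl (Or.inl (Or.inl ⟨k, he, rfl⟩))
    | surface k => exact Or.inl (Or.inl (Or.inr ⟨k, he, rfl⟩))
    | wall i k =>
      have := he.2
      exact Or.inl (Or.inr ⟨(i, k), ⟨he.1, by constructor <;> simp only <;> omega⟩, rfl⟩)
    | claw i k =>
      have := he.2
      exact Or.inr ⟨(i, k), ⟨he.1, by constructor <;> simp only <;> omega⟩, rfl⟩
  have f1 := Set.finite_Icc 1 (4 * s)
  have f2 := (Set.finite_Icc 1 N).prod (Set.finite_Icc 1 7)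
  have f3 := (Set.finite_Icc 1 N).prod (Set.finite_Icc 1 4)
  have hfin := (((f1.image VillageEdge.spoke).union (f1.image VillageEdge.surface)).union
    (f2.image fun p : ℕ × ℕ => VillageEdge.wall p.1 p.2)).union
    (f3.image fun p : ℕ × ℕ => VillageEdge.claw p.1 p.2)
  refine ⟨hfin.subset hsub, ?_⟩
  have h0 := Set.ncard_le_ncard hsub hfin
  have h1 := (Set.ncard_union_le _ _).trans (Nat.add_le_add ((Set.ncard_union_le _ _).trans
    (Nat.add_le_add ((Set.ncard_union_le _ _).trans (Nat.add_le_add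
      (Set.ncard_image_le f1) (Set.ncard_image_le f1)))
      (Set.ncard_image_le f2))) (Set.ncard_image_le f3)) |> h0.trans
  rw [Set.ncard_prod, Set.ncard_prod, ncard_Icc, ncard_Icc, ncard_Icc, ncard_Icc] at h1
  omega

theorem net_adj (e : VillageEdge) (he : NetEdge s N π.mate t e) :
    (net hN π t).Adj (netEnds s π.mate e).1 (netEnds s π.mate e).2 :=
  ⟨e, he, rfl⟩

theorem net_adj_spoke {k : ℕ} (hk : 1 ≤ k ∧ k ≤ 4 * s) :
    (net hN π t).Adj .centre (.rim k) := net_adj (.spoke k) hk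

theorem net_adj_surface {k : ℕ} (hk : 1 ≤ k ∧ k < 4 * s) :
    (net hN π t).Adj (.rim k) (.rim (k + 1)) := by
  have h := net_adj (hN := hN) (π := π) (t := t) (.surface k) ⟨hk.1, hk.2.le⟩
  rwa [netEnds, if_neg hk.2.ne] at h

theorem net_adj_wall {i k : ℕ} (hk : k ≠ 7) (he : NetEdge s N π.mate t (.wall i k)) :
    (net hN π t).Adj (houseVertex i k) (houseVertex i (k + 1)) := by
  have h := net_adj (hN := hN) (.wall i k) he
  rwa [netEnds, if_neg hk] at h

theorem net_adj_link {i : ℕ} (he : NetEdge s N π.mate t (.wall i 7)) :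
    (net hN π t).Adj (.house i 6) (.house (π.mate i) 2) := by
  have h := net_adj (hN := hN) (.wall i 7) he
  rwa [netEnds, if_pos rfl] at h

theorem net_adj_claw {i k : ℕ} (hk : k ≠ 4) (he : NetEdge s N π.mate t (.claw i k)) :
    (net hN π t).Adj (.inhabitant i) (.house i (2 * k)) := by
  have h := net_adj (hN := hN) (.claw i k) he
  rwa [netEnds, if_neg hk] at h

/-- The planet stays connected when a vertex is deleted. -/
theorem net_reach_planet (hN : N ≤ s) (π : Page N) (t : ℕ) (hs : 0 < s) (z : VillageVertex) :
    ∃ r ∈ (net hN π t).vertexSet, r ≠ z ∧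
      (.centre ≠ z → ReachAvoid (net hN π t) z .centre r) ∧
      ∀ k, 1 ≤ k → k ≤ 4 * s → .rim k ≠ z → ReachAvoid (net hN π t) z (.rim k) r := by
  -- Without the centre the rim still contains a path through all its vertices; otherwise each
  -- remaining rim vertex is adjacent to the centre.
  by_cases hz : z = .centre
  · subst hz
    refine ⟨.rim 1, ⟨le_rfl, by omega⟩, by simp, fun h => absurd rfl h, fun k hk => ?_⟩
    induction k, hk using Nat.le_induction with
    | base => exact fun _ _ => Relation.ReflTransGen.refl
    | succ k hk ih =>
      intro h _
      exact (ReachAvoid.adj (net_adj_surface ⟨hk, h⟩).symm (by simp) (by simp)).trans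
        (ih (by omega) (by simp))
  · refine ⟨.centre, trivial, fun h => hz h.symm, fun _ => Relation.ReflTransGen.refl,
      fun k h1 h2 h => ?_⟩
    exact ReachAvoid.adj (net_adj_spoke ⟨h1, h2⟩).symm h fun h => hz h.symm

theorem houseVertex_injOn {i j k l : ℕ} (hi : 1 ≤ i) (hj : 1 ≤ j) 
    (h : houseVertex i k = houseVertex j l) : i = j ∧ k = l := by
  unfold houseVertex at h
  split_ifs at h <;> simp at h <;> omega

/-- The walls of a house, or of two linked houses, are joined to the planet at both ends. -/
theorem net_reach_house (hN : N ≤ s) (π : Page N) (t : ℕ) {z r : VillageVertex}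
    (hr : ∀ k, 1 ≤ k → k ≤ 4 * s → .rim k ≠ z → ReachAvoid (net hN π t) z (.rim k) r)
    {i k : ℕ} (hi : 1 ≤ i ∧ i ≤ N) (hk : 1 ≤ k ∧ k ≤ 7) (hz : houseVertex i k ≠ z) :
    ReachAvoid (net hN π t) z (houseVertex i k) r := by
  have hstart : ∀ i, 1 ≤ i ∧ i ≤ N → houseVertex i 1 ≠ z →
      ReachAvoid (net hN π t) z (houseVertex i 1) r := fun i hi h => hr _ (by omega) (by omega) h
  have hend : ∀ i, 1 ≤ i ∧ i ≤ N → houseVertex i 7 ≠ z →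
      ReachAvoid (net hN π t) z (houseVertex i 7) r := fun i hi h => hr _ (by omega) (by omega) h
  -- A house with all its walls is an ear of the planet on its own; otherwise the ear is the arch
  -- formed by two linked houses.
  by_cases hone : t ≤ 2 ∨ π.mate i = i
  · have := ReachAvoid.ear (G := net hN π t) (z := z) (r := r) (fun j => houseVertex i (j + 1)) 6
      (fun j hj => net_adj_wall (by omega) ⟨hi, by omega⟩)
      (fun a ha b hb h => by
        have := houseVertex_injOn hi.1 hi.1 h
        omega) (hstart i hi) (hend i hi) (j := k - 1) (by omega)
        (by rwa [Nat.sub_add_cancel hk.1])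
    simp only [Nat.sub_add_cancel hk.1] at this
    exact this
  · push Not at hone
    -- The arch has twelve vertices: positions 0 to 5 are `v_1, …, v_6` of the left house, and
    -- positions 6 to 11 are `v_2, …, v_7` of the right one.
    have hpair : ∀ i, 1 ≤ i ∧ i ≤ N → i < π.mate i → ∀ j, j ≤ 11 →
        (if j ≤ 5 then houseVertex i (j + 1) else houseVertex (π.mate i) (j - 4)) ≠ z →
        ReachAvoid (net hN π t) z
          (if j ≤ 5 then houseVertex i (j + 1) else houseVertex (π.mate i) (j - 4)) r := by
      intro i hi hlt j hj hz
      have hm : 1 ≤ π.mate i ∧ π.mate i ≤ N := π.mem hi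
      refine ReachAvoid.ear (G := net hN π t) (z := z) (r := r)
        (fun j => if j ≤ 5 then houseVertex i (j + 1) else houseVertex (π.mate i) (j - 4)) 11
        ?_ ?_ (hstart i hi) (hend _ hm) hj hz
      · intro j hj
        have h1 := π.invol i
        rcases Nat.lt_trichotomy j 5 with h | rfl | h
        · simp only [if_pos h.le, if_pos (show j + 1 ≤ 5 from h)]
          exact net_adj_wall (by omega) ⟨hi, by omega⟩
        · exact net_adj_link ⟨hi, by omega⟩
        · simp only [if_neg (show ¬ j ≤ 5 by omega), if_neg (show ¬ j + 1 ≤ 5 by omega)]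
          rw [show j + 1 - 4 = j - 4 + 1 by omega]
          exact net_adj_wall (by omega) ⟨hm, by omega⟩
      · intro a ha b hb h
        split_ifs at h
        · have := houseVertex_injOn hi.1 hi.1 h
          omega
        · have := houseVertex_injOn hi.1 hm.1 h
          omega
        · have := houseVertex_injOn hm.1 hi.1 h
          omega
        · have := houseVertex_injOn hm.1 hm.1 h
          omega
    rcases Nat.lt_or_ge i (π.mate i) with hlt | hge
    · by_cases h7 : k = 7
      · subst h7; exact hend i hi hz
      · have := hpair i hi hlt (k - 1) (by omega)
        rw [if_pos (by omega), Nat.sub_add_cancel hk.1] at this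
        exact this hz
    · by_cases h1 : k = 1
      · subst h1; exact hstart i hi hz
      · have := hpair (π.mate i) (π.mem hi) (by rw [π.invol]; omega) (k + 4) (by omega)
        rw [if_neg (by omega), π.invol, Nat.add_sub_cancel] at this
        exact this hz

theorem net_twoConnected (hN : N ≤ s) (π : Page N) (t : ℕ) (hs : 0 < s) :
    TwoConnected (net hN π t) := by
  refine twoConnected_of_reachAvoid ?_ fun z hz => ?_
  · have h1 : ({.rim 1, .rim 2, .rim 3} : Set VillageVertex) ⊆ (net hN π t).vertexSet := by
      rintro x (rfl | rfl | rfl) <;> exact ⟨by omega, by omega⟩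
    have h2 := Set.ncard_le_ncard h1 (net_finite_vertexSet hN π t).1
    rw [Set.ncard_insert_of_notMem (by simp), Set.ncard_insert_of_notMem (by simp),
      Set.ncard_singleton] at h2
    exact h2
  · obtain ⟨r, hr, hrz, hc, hrim⟩ := net_reach_planet hN π t hs z
    refine ⟨r, hr, hrz, fun y hy hyz => ?_⟩
    have hhouse : ∀ i k, 1 ≤ i ∧ i ≤ N → 2 ≤ k ∧ k ≤ 6 → .house i k ≠ z →
        ReachAvoid (net hN π t) z (.house i k) r := by
      intro i k hi hk h
      have h1 : houseVertex i k = .house i k := by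
        rw [houseVertex, if_neg (by omega), if_neg (by omega)]
      rw [← h1] at h ⊢
      exact net_reach_house hN π t hrim hi ⟨by omega, by omega⟩ h
    cases y with
    | centre => exact hc hyz
    | rim k => exact hrim k hy.1 hy.2 hyz
    | house i k => exact hhouse i k hy.1.1 hy.2 hyz
    | inhabitant i =>
      have hi : 1 ≤ i ∧ i ≤ N := hy.1
      by_cases h : .house i 2 = z
      · have h4 : .house i 4 ≠ z := by rw [← h]; simp
        exact (ReachAvoid.adj (net_adj_claw (k := 2) (by omega) ⟨hi, by omega⟩) hyz h4).trans
          (hhouse i 4 hi (by omega) h4)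
      · exact (ReachAvoid.adj (net_adj_claw (k := 1) (by omega) ⟨hi, by omega⟩) hyz h).trans
          (hhouse i 2 hi (by omega) h)

theorem net_good (hN : N ≤ s) (π : Page N) (t : ℕ) (hs : 0 < s) : Good (net hN π t) where
  finV := (net_finite_vertexSet hN π t).1
  finE := (net_finite_edgeSet hN π t).1
  loopless := (net_simple hN π t).toLoopless
  conn := (net_twoConnected hN π t hs).2.1
  edge := ⟨.spoke 1, le_rfl, by omega⟩

end

/-! ### Planarity of linked villages -/

/-- The relation holds between cyclically consecutive entries of a list. -/
def CycChain {β : Type*} (R : β → β → Prop) : List β → Prop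
  | [] => True
  | a :: l => List.IsChain R (a :: l ++ [a])

/-- Reduces a statement about a rotation to a chain of equations along an explicit list, which
simplification can check. -/
theorem CycChain.formPerm {β : Type*} [DecidableEq β] {R : β → β → Prop} {l : List β}
    (hl : l.Nodup) (h : CycChain R l) {e : β} (he : e ∈ l) : R e (l.formPerm e) := by
  obtain ⟨i, hi, rfl⟩ := List.getElem_of_mem he
  rw [List.formPerm_apply_getElem _ hl]
  cases l with
  | nil => simp at hi
  | cons a l =>
    have h1 := List.isChain_iff_getElem.1 h i (by simpa using hi)
    rw [List.getElem_append_left hi] at h1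
    rcases Nat.lt_or_ge (i + 1) (a :: l).length with h2 | h2
    · rw [List.getElem_append_left h2] at h1
      simpa only [Nat.mod_eq_of_lt h2] using h1
    · have h3 : i + 1 = (a :: l).length := by omega
      simp only [h3, Nat.mod_self, List.getElem_cons_zero]
      rw [List.getElem_append_right h2] at h1
      simpa using h1

/-- The faces of linked villages: the triangles of the wheel, the regions below links, the rooms of
the houses, and the strips between two linked houses. -/
inductive NetFace : Type
  | tri (k : ℕ)
  | region (i : ℕ)
  | room (i k : ℕ)
  | strip (i : ℕ)

/-- The innermost link above the part of the planet between the houses `p` and `p + 1`. -/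
def Page.reg {N : ℕ} (π : Page N) (p : ℕ) : ℕ :=
  ((Finset.range (p + 1)).filter fun j => p < π.mate j).sup id

section

variable {N : ℕ} (π : Page N)

theorem Page.reg_eq_of {p q : ℕ} (h : ∀ j, j ≤ p ∧ p < π.mate j ↔ j ≤ q ∧ q < π.mate j) :
    π.reg p = π.reg q := by
  unfold Page.reg
  congr 1
  ext j
  simp only [Finset.mem_filter, Finset.mem_range, Nat.lt_succ_iff]
  exact h j

theorem Page.reg_eq {p r : ℕ} (h1 : r ≤ p) (h2 : p < π.mate r)
    (h3 : ∀ j, j ≤ p → p < π.mate j → j ≤ r) : π.reg p = r := by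
  refine le_antisymm (Finset.sup_le fun j hj => ?_) (Finset.le_sup (f := id) ?_)
  · simp only [Finset.mem_filter, Finset.mem_range, Nat.lt_succ_iff] at hj
    exact h3 j hj.1 hj.2
  · simp only [Finset.mem_filter, Finset.mem_range, Nat.lt_succ_iff]
    exact ⟨h1, h2⟩

/-- No link passes above this part of the planet; `0`, the value of the empty supremum, stands for
the outer region. -/
theorem Page.reg_of_ge {p : ℕ} (hp : N ≤ p) : π.reg p = 0 := by
  refine le_antisymm (Finset.sup_le fun j hj => ?_) (Nat.zero_le _)
  simp only [Finset.mem_filter, Finset.mem_range] at hj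
  by_cases h : j ∈ Set.Icc 1 N
  · have := (π.mem h).2
    omega
  · rw [π.fixed j h] at hj
    omega

theorem Page.reg_zero : π.reg 0 = 0 := by
  refine le_antisymm (Finset.sup_le fun j hj => ?_) (Nat.zero_le _)
  simp only [Finset.mem_filter, Finset.mem_range] at hj
  exact Nat.lt_succ_iff.1 hj.1

theorem Page.reg_unmatched {i : ℕ} (hi : 1 ≤ i) (h : π.mate i = i) :
    π.reg (i - 1) = π.reg i := by
  refine π.reg_eq_of fun j => ?_
  have h1 : π.mate j = i → j = i := fun h' => by rw [← π.invol j, h', h]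
  have h2 : j = i → π.mate j = i := fun h' => by rw [h', h]
  omega

theorem Page.reg_left {i : ℕ} (h : i < π.mate i) : π.reg i = i :=
  π.reg_eq le_rfl h fun _ hj _ => hj

/-- A link starting after `i` that covered this place would reach beyond `π.mate i` and thus cross
the link of `i`. -/
theorem Page.reg_mate_sub_one {i : ℕ} (h : i < π.mate i) : π.reg (π.mate i - 1) = i := by
  refine π.reg_eq (by omega) (by omega) fun j h1 h2 => ?_
  by_contra h3
  have := π.nonCrossing i j (by omega) (by omega)
  omega

/-- By non-crossing, the links above the place just left of a pair are those above the place just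
right of it. -/
theorem Page.reg_mate {i : ℕ} (h : i < π.mate i) : π.reg (i - 1) = π.reg (π.mate i) := by
  refine π.reg_eq_of fun j => ?_
  have h0 := π.invol i
  have h1 := π.invol j
  have h2 : π.mate j = i → j = π.mate i := fun h' => by rw [← h', h1]
  have h3 : j = π.mate i → π.mate j = i := fun h' => by rw [h', h0]
  have h4 : j = i → π.mate j = π.mate i := fun h' => by rw [h']
  have h5 := π.nonCrossing i j
  have h6 := π.nonCrossing j i
  have h7 : i ≠ 0 := by
    rintro rfl
    rw [π.fixed 0 (by simp)] at h
    exact lt_irrefl _ h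
  constructor <;> intro _ <;> omega

/-- The face below the house `i`. -/
def netBot (t i : ℕ) : NetFace :=
  if N < i then .region (π.reg i)
  -- A linked house has lost a wall at this stage, so the space below it opens into the region below
  -- the arch, which is indexed by the left house.
  else if t = 4 then
    (if i < π.mate i then .region i else if π.mate i < i then .region (π.mate i) else .room i 0)
  else .room i 0

/-- The face above the house `i`. -/
def netTop (i : ℕ) : NetFace :=
  if π.mate i < i then .region (π.reg i) else .region (π.reg (i - 1))

/-- The face to the left of an edge, directed from its first to its second end. -/
def netLeft (s t : ℕ) (g : ℕ → Bool) : VillageEdge → NetFace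
  | .spoke k => .tri (if k = 1 then 4 * s else k - 1)
  | .surface k =>
    if k % 4 = 1 ∨ k % 4 = 2 then netBot π t ((k + 3) / 4) else .region (π.reg ((k + 3) / 4))
  | .wall i k =>
    if k = 1 then .region (π.reg (i - 1))
    else if k = 6 then .region (π.reg i)
    else if k = 7 then
      -- The edge between linked inhabitants runs above the link if they are outside and below it if
      -- they are inside; the strip lies between this edge and the link.
      if t = 4 ∧ g i = false then .strip i else .region (π.reg (i - 1))
    else if g i then netTop π i
    else if k ≤ 3 then .room i 1 else .room i 2
  | .claw i k =>
    if k = 1 then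
      if g i then if t = 4 ∧ π.mate i < i then .strip (π.mate i) else netBot π t i
      else .room i 1
    else if k = 2 then if g i then .room i 1 else .room i 2
    else if k = 3 then
      if g i then .room i 2 else if t = 4 ∧ i < π.mate i then .strip i else netTop π i
    else if g i then .strip i else netTop π i

/-- The face to the right of an edge, directed from its first to its second end. -/
def netRight (t : ℕ) (g : ℕ → Bool) : VillageEdge → NetFace
  | .spoke k => .tri k
  | .surface k => .tri k
  | .wall i k =>
    if k = 1 then netBot π t i
    else if k = 6 then netBot π t i
    else if k = 7 then
      if t = 4 ∧ g i = true then .strip i else .region i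
    else if g i = false then netBot π t i
    else if k ≤ 3 then .room i 1 else .room i 2
  | .claw i k =>
    if k = 1 then
      if g i then .room i 1
      else if t = 4 ∧ π.mate i < i then .strip (π.mate i) else netTop π i
    else if k = 2 then if g i then .room i 2 else .room i 1
    else if k = 3 then
      if g i then if t = 4 ∧ i < π.mate i then .strip i else netBot π t i else .room i 2
    else if g i then netBot π t i else .strip i

open Classical in
/-- The face to the left of an edge, directed away from `x`. -/
noncomputable def netSide (s t : ℕ) (g : ℕ → Bool) (x : VillageVertex) (e : VillageEdge) :
    NetFace :=
  if x = (netEnds s π.mate e).1 then netLeft π s t g e else netRight π t g e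

open Classical in
/-- The face to the right of an edge, directed away from `x`. -/
noncomputable def netSide' (s t : ℕ) (g : ℕ → Bool) (x : VillageVertex) (e : VillageEdge) :
    NetFace :=
  if x = (netEnds s π.mate e).1 then netRight π t g e else netLeft π s t g e

end

section

variable {s N : ℕ} {hN : N ≤ s} {π : Page N} {t : ℕ} {g : ℕ → Bool}

/-- House `i + 1` is attached at the rim vertices `4 * i + 1` and `4 * i + 3`. Apart from
bookkeeping, all depends on how `reg` changes when a house is passed on the planet. -/
theorem netSide_chain_rim (hN : N ≤ s) (ht : t = 2 ∨ t = 4) {k : ℕ}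
    (hk : 1 ≤ k ∧ k ≤ 4 * s) :
    CycChain (fun e e' => netSide π s t g (.rim k) e' = netSide' π s t g (.rim k) e)
      (netList s N π.mate t g (.rim k)) := by
  have h0 := π.reg_zero
  have h1 : π.reg s = 0 := π.reg_of_ge hN
  have h2 : ∀ i, N < i → π.mate i = i := fun i hi => π.fixed i fun h => by
    have := h.2
    omega
  have h3 : ∀ i, 1 ≤ i → π.mate i = i → π.reg (i - 1) = π.reg i := fun i hi h =>
    π.reg_unmatched hi h
  have h4 : ∀ i, i < π.mate i → π.reg i = i := fun i h => π.reg_left h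
  have h5 : ∀ i, π.mate i < i → π.reg (i - 1) = π.mate i := fun i h => by
    have := π.reg_mate_sub_one (i := π.mate i) (by rwa [π.invol])
    rwa [π.invol] at this
  obtain ⟨i, rfl | rfl | rfl | rfl⟩ : ∃ i, k = 4 * i + 1 ∨ k = 4 * i + 2 ∨ k = 4 * i + 3 ∨
      k = 4 * i + 4 := ⟨(k - 1) / 4, by omega⟩
  · have e1 : (4 * i + 1) % 4 = 1 := by omega
    have e2 : (4 * i + 1) / 4 = i := by omega
    have e3 : (4 * i + 1 + 3) / 4 = i + 1 := by omega
    have e4 : (4 * i + 3) / 4 = i := by omega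
    have hp : netLeft π s t g (.surface (if 4 * i + 1 = 1 then 4 * s else 4 * i)) =
        .region (π.reg i) := by
      by_cases hi : i = 0
      · have e5 : (4 * s + 3) / 4 = s := by omega
        simp [hi, netLeft, h0, h1, e5]
      · simp [hi, netLeft, e4]
    have hpk : 4 * i + 1 ≠ (if 4 * i + 1 = 1 then 4 * s else 4 * i) := by split_ifs <;> omega
    have hpb : 1 ≤ (if 4 * i + 1 = 1 then 4 * s else 4 * i) ∧
      (if 4 * i + 1 = 1 then 4 * s else 4 * i) ≤ 4 * s := by split_ifs <;> omega
    have e7 : 4 * (i + 1) - 3 = 4 * i + 1 := by omega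
    have hl : netRot s π.mate g (.rim (4 * i + 1)) =
        [.surface (if 4 * i + 1 = 1 then 4 * s else 4 * i), .wall (i + 1) 1, .surface (4 * i + 1),
          .spoke (4 * i + 1)] := by
      rw [netRot, if_pos e1, e2, Nat.add_sub_cancel]
    rw [netList, hl]
    clear hl
    have hpi : (if 4 * i + 1 = 1 then 4 * s else 4 * i) = if i = 0 then 4 * s else 4 * i := by simp
    generalize (if 4 * i + 1 = 1 then 4 * s else 4 * i) = p at *
    rcases Nat.lt_or_ge N (i + 1) with hN' | hN'
    · have hb : netBot π t (i + 1) = .region (π.reg i) := by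
        rw [netBot, if_pos hN', ← h3 (i + 1) (by omega) (h2 _ hN'), Nat.add_sub_cancel]
      have hN'' := hN'.not_ge
      simp [NetEdge, hk, hpb, hpk, hN'', CycChain, netSide, netSide', netEnds, hp, e1, e3,
        netLeft.eq_2, hb, netRight, netLeft.eq_1]
      exact hpi
    · have hN'' := hN'.not_gt
      rcases Nat.lt_or_ge (π.mate (i + 1)) (i + 1) with hlt | hge
      · have h6 := h5 _ hlt
        have h7 := hlt.not_gt
        rw [Nat.add_sub_cancel] at h6
        rcases ht with rfl | rfl <;>
        simp [NetEdge, hk, hpb, hpk, hN', CycChain, netSide, netSide', netEnds, hp, e1, e3,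
          netLeft.eq_2, netBot, netRight, netLeft.eq_1, hlt, h7, h6, hN'', houseVertex, e7,
          hlt.not_ge, netLeft.eq_3] <;>
        exact hpi
      · simp [NetEdge, hk, hpb, hpk, hN', CycChain, netSide, netSide', netEnds, hp, e1, e3,
          netLeft.eq_2, netRight, netLeft.eq_1, hge, houseVertex, e7, netLeft.eq_3]
        exact hpi
  · have e1 : (4 * i + 2) % 4 = 2 := by omega
    have e2 : (4 * i + 1) % 4 = 1 := by omega
    have e3 : (4 * i + 1 + 3) / 4 = i + 1 := by omega
    have e4 : (4 * i + 2 + 3) / 4 = i + 1 := by omega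
    simp [netList, netRot, NetEdge, hk, show 4 * i + 1 ≤ 4 * s by omega, CycChain, netSide,
      netSide', netEnds, e1, e2, e3, e4, netLeft, netRight]
  · have e1 : (4 * i + 3) % 4 = 3 := by omega
    have e2 : (4 * i + 3) / 4 = i := by omega
    have e3 : (4 * i + 3 + 3) / 4 = i + 1 := by omega
    have e4 : (4 * i + 2) % 4 = 2 := by omega
    have e5 : (4 * i + 2 + 3) / 4 = i + 1 := by omega
    have e6 : 4 * i + 2 ≤ 4 * s := by omega
    have e7 : 4 * (i + 1) - 1 = 4 * i + 3 := by omega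
    rcases Nat.lt_or_ge N (i + 1) with hN' | hN'
    · have hN'' := hN'.not_ge
      simp [netList, netRot, NetEdge, hk, e6, hN'', CycChain, netSide, netSide', netEnds, e1, e2,
        e3, e4, e5, netLeft, netRight, netBot, hN']
    · have hN'' := hN'.not_gt
      rcases Nat.lt_or_ge (i + 1) (π.mate (i + 1)) with hlt | hge
      · have h6 := h4 _ hlt
        rcases ht with rfl | rfl <;>
        simp [netList, netRot, NetEdge, hk, e6, hN'', CycChain, netSide, netSide', netEnds, e1, e2,
          e3, e4, e5, netLeft, netRight, netBot, hN', hlt, h6, hlt.not_ge, houseVertex, e7]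
      · simp [netList, netRot, NetEdge, hk, e6, CycChain, netSide, netSide', netEnds, e1, e2,
          e3, e4, e5, netLeft, netRight, hN', hge, houseVertex, e7]
  · have e1 : (4 * i + 4) % 4 = 0 := by omega
    have e2 : (4 * i + 3) % 4 = 3 := by omega
    have e3 : (4 * i + 3 + 3) / 4 = i + 1 := by omega
    have e4 : (4 * i + 4 + 3) / 4 = i + 1 := by omega
    simp [netList, netRot, NetEdge, hk, show 4 * i + 3 ≤ 4 * s by omega, CycChain, netSide,
      netSide', netEnds, e1, e2, e3, e4, netLeft, netRight]

-- A house may be the left or right one of a pair or unmatched, at either stage, with its inhabitant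
-- inside or outside. As `g` agrees on pairs, both ends of a link see the strip on the same side of
-- it.
set_option maxHeartbeats 1600000 in
theorem netSide_chain_house (ht : t = 2 ∨ t = 4) (hg : ∀ i, g (π.mate i) = g i) {i k : ℕ}
    (hi : 1 ≤ i ∧ i ≤ N) (hk : 2 ≤ k ∧ k ≤ 6) :
    CycChain (fun e e' => netSide π s t g (.house i k) e' = netSide' π s t g (.house i k) e)
      (netList s N π.mate t g (.house i k)) := by
  have h1 : π.mate i < i → π.reg (π.mate i - 1) = π.reg i := fun h => by
    have := π.reg_mate (i := π.mate i) (by rwa [π.invol])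
    rwa [π.invol] at this
  have h2 : π.mate i < i → π.reg (i - 1) = π.mate i := fun h => by
    have := π.reg_mate_sub_one (i := π.mate i) (by rwa [π.invol])
    rwa [π.invol] at this
  have h3 := π.reg_left (i := i)
  have h4 := π.reg_mate (i := i)
  have h5 := π.invol i
  have h6 := hg i
  have h7 : 1 ≤ π.mate i ∧ π.mate i ≤ N := π.mem hi
  have h8 : π.mate i = i → π.reg (i - 1) = π.reg i := π.reg_unmatched hi.1
  have h9 : ¬ N < i := by omega
  obtain rfl | rfl | rfl | rfl | rfl : k = 2 ∨ k = 3 ∨ k = 4 ∨ k = 5 ∨ k = 6 := by omega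
  all_goals
    rcases Nat.lt_trichotomy i (π.mate i) with hlt | heq | hlt <;>
    rcases ht with rfl | rfl <;>
    cases hgi : g i
  all_goals
    first
    | have hlt' := hlt.not_gt
      have hle := hlt.le
      have hle' := hlt.not_ge
      have hne' := hlt.ne'
      simp [hlt, hlt', hle, hle', hne', netList, netRot, NetEdge, hgi, hi, h7, h5, netSide, netSide',
        CycChain, netEnds, houseVertex, netLeft, netRight, netTop, netBot, h9, h6, h1, h2, h3, h4]
    | have heq' := heq.symm
      have h1 := h8 heq'
      simp [heq', h1, netList, netRot, NetEdge, hgi, hi, netSide, netSide',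
        CycChain, netEnds, houseVertex, netLeft, netRight, netTop, netBot, h9]

set_option maxHeartbeats 1600000 in
theorem netSide_chain_inhabitant (ht : t = 2 ∨ t = 4) (hg : ∀ i, g (π.mate i) = g i) {i : ℕ}
    (hi : 1 ≤ i ∧ i ≤ N) :
    CycChain (fun e e' => netSide π s t g (.inhabitant i) e' = netSide' π s t g (.inhabitant i) e)
      (netList s N π.mate t g (.inhabitant i)) := by
  have h1 : π.mate i < i → π.reg (π.mate i - 1) = π.reg i := fun h => by
    have := π.reg_mate (i := π.mate i) (by rwa [π.invol])
    rwa [π.invol] at this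
  have h5 := π.invol i
  have h6 := hg i
  have h7 : 1 ≤ π.mate i ∧ π.mate i ≤ N := π.mem hi
  have h9 : ¬ N < i := by omega
  have h10 : ¬ N < π.mate i := by omega
  rcases Nat.lt_trichotomy i (π.mate i) with hlt | heq | hlt <;>
    rcases ht with rfl | rfl <;>
    cases hgi : g i
  all_goals
    first
    | have hlt' := hlt.not_gt
      have hle := hlt.le
      have hne' := hlt.ne'
      simp [hlt, hlt', hle, hne', netList, netRot, NetEdge, hgi, hi, h7, h5, netSide, netSide',
        CycChain, netEnds, netLeft, netRight, netTop, netBot, h9, h10, h6, h1]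
    | have heq' := heq.symm
      simp [heq', netList, netRot, NetEdge, hgi, hi, netSide, netSide',
        CycChain, netEnds, netLeft, netRight, netTop, netBot, h9]

open Classical in
theorem netSide_centre {e : VillageEdge} (he : e ∈ netList s N π.mate t g .centre) :
    netSide π s t g .centre ((netList s N π.mate t g .centre).formPerm e) =
      netSide' π s t g .centre e := by
  have hl : netList s N π.mate t g .centre = (List.range (4 * s)).map fun k => .spoke (k + 1) := by
    rw [netList, netRot, List.filter_eq_self]
    intro e he
    obtain ⟨k, hk, rfl⟩ := List.mem_map.1 he
    rw [List.mem_range] at hk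
    simpa [NetEdge] using hk
  have hnd : ((List.range (4 * s)).map fun k => VillageEdge.spoke (k + 1)).Nodup :=
    netRot_nodup (N := N) (π := π) g (x := .centre) trivial
  rw [hl] at he ⊢
  obtain ⟨i, hi, rfl⟩ := List.getElem_of_mem he
  rw [List.formPerm_apply_getElem _ hnd]
  simp only [List.length_map, List.length_range] at hi
  simp only [List.getElem_map, List.getElem_range, List.length_map, List.length_range, netSide,
    netSide', netEnds, if_true, netLeft, netRight]
  rcases Nat.lt_or_ge (i + 1) (4 * s) with h | h
  · rw [Nat.mod_eq_of_lt h]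
    simp
  · have : i + 1 = 4 * s := by omega
    simp [this]

end

section

variable {s N : ℕ} {hN : N ≤ s} {π : Page N} {t : ℕ} {g : ℕ → Bool}

theorem netEnds_ne (hN : N ≤ s) (π : Page N) {e : VillageEdge}
    (he : NetEdge s N π.mate t e) : (netEnds s π.mate e).1 ≠ (netEnds s π.mate e).2 := by
  have h := (net_simple hN π t).toLoopless
  have hl : (net hN π t).IsLink e (netEnds s π.mate e).1 (netEnds s π.mate e).2 :=
    net_isLink_iff.2 ⟨he, Or.inl ⟨rfl, rfl⟩⟩
  exact hl.ne

theorem netSide_first (π : Page N) {e : VillageEdge} :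
    netSide π s t g (netEnds s π.mate e).1 e = netLeft π s t g e := if_pos rfl

theorem netSide_second (hN : N ≤ s) (π : Page N) {e : VillageEdge}
    (he : NetEdge s N π.mate t e) :
    netSide π s t g (netEnds s π.mate e).2 e = netRight π t g e :=
  if_neg (netEnds_ne hN π he).symm

theorem netSide_rev {e : VillageEdge} {x y : VillageVertex} (h : (net hN π t).IsLink e x y) :
    netSide π s t g y e = netSide' π s t g x e := by
  obtain ⟨he, ⟨rfl, rfl⟩ | ⟨rfl, rfl⟩⟩ := net_isLink_iff.1 h
  · rw [netSide_second hN π he, netSide', if_pos rfl]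
  · rw [netSide_first π, netSide', if_neg (netEnds_ne hN π he).symm]

open Classical in
theorem netSide_formPerm (hN : N ≤ s) (ht : t = 2 ∨ t = 4) (hg : ∀ i, g (π.mate i) = g i)
    {x : VillageVertex} (hx : IsVillageVertex s (Set.Icc 1 N) x) {e : VillageEdge}
    (he : e ∈ netList s N π.mate t g x) :
    netSide π s t g x ((netList s N π.mate t g x).formPerm e) = netSide' π s t g x e := by
  have hl : (netList s N π.mate t g x).Nodup := (netRot_nodup g hx).filter _
  cases x with
  | centre => exact netSide_centre he
  | rim k => exact (netSide_chain_rim hN ht hx).formPerm hl he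
  | house i k => exact (netSide_chain_house ht hg hx.1.1 hx.2).formPerm hl he
  | inhabitant i => exact (netSide_chain_inhabitant ht hg hx.1).formPerm hl he

/-- Charges the edges of a net to vertices and faces. -/
def netCharge (π : Page N) (t : ℕ) : VillageEdge → VillageVertex ⊕ NetFace
  | .spoke k => .inl (.rim k)
  | .surface k => .inr (.tri k)
  | .wall i k =>
    if k = 1 then .inr (if t = 4 ∧ i < π.mate i then .region i else .room i 0)
    else if k = 7 then .inr (if t = 4 then .strip i else .region i)
    else .inl (.house i k)
  | .claw i k =>
    if k = 1 then .inl (.inhabitant i)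
    -- Inhabitants are only joined where `wall i 6` has been removed, so the vertex `v_6` of the
    -- left house is still unused.
    else if k = 4 then .inl (.house i 6)
    else .inr (.room i (k - 1))

theorem netCharge_injOn (ht : t = 2 ∨ t = 4) :
    Set.InjOn (netCharge π t) (net hN π t).edgeSet := by
  intro e he f hf h
  rw [mem_net_edgeSet] at he hf
  cases e <;> cases f <;> simp only [netCharge] at h
  all_goals simp only [NetEdge] at he hf
  all_goals rcases ht with rfl | rfl
  all_goals (try split_ifs at h) <;> simp at h <;> grind

/-- The charges are distinct and omit the centre and the outer region `0`, so there are at least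
`|E| + 2` vertices and faces altogether. -/
theorem euler_netList (hN : N ≤ s) (hs : 0 < s) (ht : t = 2 ∨ t = 4)
    (hg : ∀ i, g (π.mate i) = g i) :
    (net hN π t).vertexSet.ncard + Nat.card (Quotient (Equiv.Perm.SameCycle.setoid
      (facePerm (rotNext (isRot_netList hN π t g))))) = (net hN π t).edgeSet.ncard + 2 := by
  refine euler_of_labels (net_good hN π t hs) (isRot_netList hN π t g) (netSide π s t g)
    (fun d => ?_) (netCharge π t) (netCharge_injOn ht) (.inl .centre) (.inr (.region 0)) (by simp)
    (fun e he => ?_) ?_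
  · rw [rotNext_edge, netSide_rev d.isLink]
    exact netSide_formPerm hN ht hg d.inc.vertex_mem
      (((isRot_netList hN π t g _ d.inc.vertex_mem).2 _).2 d.inc)
  · rw [mem_net_edgeSet] at he
    cases e <;> simp only [netCharge]
    all_goals simp only [NetEdge] at he
    all_goals (try split_ifs) <;> simp <;> omega
  · have hL : ∀ e, NetEdge s N π.mate t e → ∃ x e', (net hN π t).Inc e' x ∧
        netSide π s t g x e' = netLeft π s t g e := fun e he =>
      ⟨_, e, net_inc_iff.2 ⟨he, Or.inl rfl⟩, netSide_first π⟩
    have hR : ∀ e, NetEdge s N π.mate t e → ∃ x e', (net hN π t).Inc e' x ∧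
        netSide π s t g x e' = netRight π t g e := fun e he =>
      ⟨_, e, net_inc_iff.2 ⟨he, Or.inr rfl⟩, netSide_second hN π he⟩
    rintro u (rfl | rfl | ⟨e, he, rfl⟩)
    · exact trivial
    · have h := hL (.surface (4 * s)) ⟨by omega, le_rfl⟩
      have h1 : (4 * s + 3) / 4 = s := by omega
      simpa [netLeft, h1, π.reg_of_ge hN] using h
    · rw [mem_net_edgeSet] at he
      cases e with
      | spoke k => exact he
      | surface k => exact hR _ he
      | wall i k =>
        have hi : i ∈ Set.Icc 1 N ∩ Set.Icc 1 s := ⟨he.1, he.1.1, he.1.2.trans hN⟩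
        have hi' : ¬ N < i := by
          have := he.1
          omega
        have hk := he.2
        simp only [netCharge]
        split_ifs with h1 h2 h3 h4
        · subst h1
          have h := hR _ he
          simpa [netRight, netBot, hi', h2.1, h2.2] using h
        · subst h1
          have h := hR _ he
          rcases ht with rfl | rfl
          · simpa [netRight, netBot, hi'] using h
          · have h3 : ¬ i < π.mate i := by simpa using h2
            have h4 : ¬ π.mate i < i := by omega
            simpa [netRight, netBot, hi', h3, h4] using h
        · subst h3
          cases hgi : g i
          · simpa [netLeft, h4, hgi] using hL _ he
          · simpa [netRight, h4, hgi] using hR _ he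
        · subst h3
          simpa [netRight, h4] using hR _ he
        · exact ⟨hi, by omega, by omega⟩
      | claw i k =>
        have hi : i ∈ Set.Icc 1 N ∩ Set.Icc 1 s := ⟨he.1, he.1.1, he.1.2.trans hN⟩
        have hk := he.2
        simp only [netCharge]
        split_ifs with h1 h2
        · exact hi
        · exact ⟨hi, by norm_num, by norm_num⟩
        · obtain rfl | rfl : k = 2 ∨ k = 3 := by omega
          · cases hgi : g i
            · simpa [netRight, hgi] using hR _ he
            · simpa [netLeft, hgi] using hL _ he
          · cases hgi : g i
            · simpa [netRight, hgi] using hR _ he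
            · simpa [netLeft, hgi] using hL _ he

end

/-! ### Embeddings of nets -/

/-- The page without links. -/
def Page.id (N : ℕ) : Page N := ⟨fun i => i, fun _ => rfl, fun _ _ => rfl, fun _ _ h h' => by omega⟩

section

variable {s N N' : ℕ} {hN : N ≤ s} {hN' : N' ≤ s} {π : Page N} {π' : Page N'} {t t' : ℕ}
  {g : ℕ → Bool}

theorem netList_eq_filter (h : ∀ e, NetEdge s N π.mate t' e → NetEdge s N π.mate t e)
    (x : VillageVertex) : netList s N π.mate t' g x = (netList s N π.mate t g x).filter fun e =>
      @decide (e ∈ (net hN π t').edgeSet) (Classical.propDecidable _) := by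
  classical
  rw [netList, netList, List.filter_filter]
  refine List.filter_congr fun e _ => ?_
  rw [← Bool.decide_and, decide_eq_decide, mem_net_edgeSet]
  exact ⟨fun h' => ⟨h', h e h'⟩, fun h' => h'.1⟩

theorem net_one_le (hN : N ≤ s) (hN' : N' ≤ s) (π : Page N) (π' : Page N') (h : N' ≤ N)
    (ht : t = 1 ∨ t = 2) : net hN' π' 1 ≤ net hN π t := by
  have h1 : net hN' π' 1 ≤ net hN π 1 := by
    rw [net_one, net_one]
    exact village_mono (Set.Icc_subset_Icc_right h)
  rcases ht with rfl | rfl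
  · exact h1
  · exact h1.trans net_one_le_two

/-- Only the links between houses and between inhabitants depend on the page in the rotation lists,
and the filter removes both. Hence the two pages may differ. -/
theorem netList_one_eq_filter (hN : N ≤ s) (h : N' ≤ N) (ht : t = 1 ∨ t = 2) (x : VillageVertex) :
    netList s N' π'.mate 1 g x = (netList s N π.mate t g x).filter fun e =>
      @decide (e ∈ (net hN' π' 1).edgeSet) (Classical.propDecidable _) := by
  classical
  have hle := net_one_le hN hN' π π' h ht
  have h1 : (netList s N π.mate t g x).filter (fun e => decide (e ∈ (net hN' π' 1).edgeSet)) =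
      (netRot s π.mate g x).filter (fun e => decide (NetEdge s N' π'.mate 1 e)) := by
    rw [netList, List.filter_filter]
    refine List.filter_congr fun e _ => ?_
    rw [← Bool.decide_and, decide_eq_decide, mem_net_edgeSet]
    exact ⟨fun h' => h'.1, fun h' => ⟨h', hle.edgeSet_mono h'⟩⟩
  rw [netList]
  refine Eq.trans ?_ h1.symm
  have w7 : ∀ i, ¬ NetEdge s N' π'.mate 1 (.wall i 7) := fun i => by simp [NetEdge]
  have c4 : ∀ i, ¬ NetEdge s N' π'.mate 1 (.claw i 4) := fun i => by simp [NetEdge]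
  cases x with
  | centre => rfl
  | rim k => rfl
  | house i k =>
    simp only [netRot]
    split_ifs <;> simp [List.filter_cons, w7]
  | inhabitant i =>
    simp only [netRot]
    split_ifs <;> simp [List.filter_cons, c4]

/-- Stages 1 and 3 are subgraphs of stage 2 and inherit genus zero, so face labels are needed only
for stages 2 and 4. -/
theorem euler_netList' (hN : N ≤ s) (π : Page N) (hs : 0 < s) (ht : 1 ≤ t ∧ t ≤ 4)
    (hg : ∀ i, g (π.mate i) = g i) :
    (net hN π t).vertexSet.ncard + Nat.card (Quotient (Equiv.Perm.SameCycle.setoid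
      (facePerm (rotNext (isRot_netList hN π t g))))) = (net hN π t).edgeSet.ncard + 2 := by
  have key : ∀ hle : net hN π t ≤ net hN π 2, (net hN π t).vertexSet.ncard +
      Nat.card (Quotient (Equiv.Perm.SameCycle.setoid
      (facePerm (rotNext (isRot_netList hN π t g))))) = (net hN π t).edgeSet.ncard + 2 :=
    fun hle => euler_of_induced (net_good hN π 2 hs) (net_good hN π t hs) hle
      (embOfRot (isRot_netList hN π 2 g) (euler_netList hN hs (Or.inl rfl) hg))
      (isRot_netList hN π 2 g) _ (rotNext_isCycleOn _)
      (rotNext_induced (isRot_netList hN π 2 g) (isRot_netList hN π t g) hle fun x _ =>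
        netList_eq_filter (fun e he => hle.edgeSet_mono he) x)
  obtain rfl | rfl | rfl | rfl : t = 1 ∨ t = 2 ∨ t = 3 ∨ t = 4 := by omega
  · exact key net_one_le_two
  · exact euler_netList hN hs (Or.inl rfl) hg
  · exact key net_three_le_two
  · exact euler_netList hN hs (Or.inr rfl) hg

/-- The embedding of a net in which the inhabitant of the house `i` is inside if `g i` is true. -/
noncomputable def netEmb (hN : N ≤ s) (π : Page N) (hs : 0 < s) (ht : 1 ≤ t ∧ t ≤ 4)
    (hg : ∀ i, g (π.mate i) = g i) : PlanarEmbedding (net hN π t) :=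
  embOfRot (isRot_netList hN π t g) (euler_netList' hN π hs ht hg)

open Classical in
theorem netEmb_nx (hs : 0 < s) (ht : 1 ≤ t ∧ t ≤ 4) (hg : ∀ i, g (π.mate i) = g i)
    {x : VillageVertex} {e : VillageEdge} (h : (net hN π t).Inc e x) :
    (netEmb hN π hs ht hg).nx x e = (netList s N π.mate t g x).formPerm e :=
  dif_pos h

theorem netEmb_induced (hs : 0 < s) (ht : 1 ≤ t ∧ t ≤ 4) (ht' : 1 ≤ t' ∧ t' ≤ 4)
    (hg : ∀ i, g (π.mate i) = g i) (hle : net hN π t' ≤ net hN π t) :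
    InducedOn hle (netEmb hN π hs ht hg) (netEmb hN π hs ht' hg) :=
  rotNext_induced (isRot_netList hN π t g) (isRot_netList hN π t' g) hle fun x _ => netList_eq_filter (fun _ he => hle.edgeSet_mono he) x

theorem netEmb_one_induced (hs : 0 < s) (h : N' ≤ N) (ht : t = 1 ∨ t = 2) (ht' : 1 ≤ t ∧ t ≤ 4)
    (ht1 : 1 ≤ 1 ∧ 1 ≤ 4)
    (hg : ∀ i, g (π.mate i) = g i) (hg' : ∀ i, g (π'.mate i) = g i) :
    InducedOn (net_one_le hN hN' π π' h ht) (netEmb hN π hs ht' hg)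
      (netEmb hN' π' hs ht1 hg') :=
  rotNext_induced (isRot_netList hN π t g) (isRot_netList hN' π' 1 g) _ fun x _ => netList_one_eq_filter hN h ht x

end

/-! ### Closed walks as even sets of edges -/

section

variable {α : Type*} {β : Type*} {G : Graph α β}

/-- The list describes a walk from `u` to `v`. -/
def TraceWalk (G : Graph α β) : α → List (β × α) → α → Prop
  | u, [], v => u = v
  | u, p :: l, v => G.IsLink p.1 u p.2 ∧ TraceWalk G p.2 l v

open Classical in
/-- The parity of the number of occurrences of an edge in a walk. -/
noncomputable def trace : List (β × α) → β → ZMod 2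
  | [], _ => 0
  | p :: l, f => (if f = p.1 then 1 else 0) + trace l f

open Classical in
theorem sum_map_ite_eq {l : List β} (hl : l.Nodup) (e : β) :
    (l.map fun f => if f = e then (1 : ZMod 2) else 0).sum = if e ∈ l then 1 else 0 := by
  induction l with
  | nil => simp
  | cons a l ih =>
    rw [List.nodup_cons] at hl
    rw [List.map_cons, List.sum_cons, ih hl.2]
    by_cases h : a = e
    · subst h
      simp [hl.1]
    · simp [h, Ne.symm h]

-- Each time the walk passes through a vertex it uses two edge ends there; only the two ends of the
-- walk contribute modulo 2.
open Classical in
theorem sum_map_trace (hG : G.Loopless) {x : α} {r : List β} (hr : IncList G x r)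
    (l : List (β × α)) {u v : α} (h : TraceWalk G u l v) :
    (r.map (trace l)).sum = (if x = u then 1 else 0) + if x = v then 1 else 0 := by
  induction l generalizing u with
  | nil =>
    obtain rfl : u = v := h
    have : r.map (trace ([] : List (β × α))) = r.map fun _ => 0 := rfl
    rw [this, CombMap.add_self_zmod]
    simp
  | cons p l ih =>
    obtain ⟨h1, h2⟩ := h
    have h3 : (r.map (trace (p :: l))).sum =
        (r.map fun f => if f = p.1 then (1 : ZMod 2) else 0).sum + (r.map (trace l)).sum :=
      List.sum_map_add
    rw [h3, sum_map_ite_eq hr.1, ih h2, ← add_assoc]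
    congr 1
    have h4 : G.Inc p.1 x ↔ x = u ∨ x = p.2 :=
      ⟨fun h => h.eq_or_eq_of_isLink h1, by
        rintro (rfl | rfl)
        exacts [h1.inc_left, h1.inc_right]⟩
    rw [if_congr ((hr.2 p.1).trans h4) rfl rfl]
    have h5 := h1.ne
    have h6 : (1 : ZMod 2) + 1 = 0 := rfl
    split_ifs <;> simp_all

theorem isEven_trace (hG : Good G) {rot : α → List β} (hr : IsRot G rot) {u : α}
    {l : List (β × α)} (h : TraceWalk G u l u) : IsEven G (trace l) := fun x hx =>
  ⟨_, hr x hx, by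
    classical
    rw [sum_map_trace hG.loopless (hr x hx) l h, CombMap.add_self_zmod]⟩

theorem SideFun.const_list {σ : PlanarEmbedding G} {z : β → ZMod 2} {c : α → β → ZMod 2}
    (hc : SideFun σ z c) (hG : Good G) {x : α} {l : List β} (hl : IncList G x l)
    (h : ∀ e ∈ l, z e = 0) : ∀ e ∈ l, ∀ f ∈ l, c x e = c x f := fun _ he _ hf =>
  hc.const hG (fun e he => h e ((hl.2 e).2 he)) ((hl.2 _).1 hf) ((hl.2 _).1 he)

theorem SideFun.pair_list {σ : PlanarEmbedding G} {z : β → ZMod 2} {c : α → β → ZMod 2}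
    (hc : SideFun σ z c) (hG : Good G) {x : α} {l : List β} (hl : IncList G x l) {p q : β}
    (hp : p ∈ l) (hq : q ∈ l) (hpq : p ≠ q) (zp : z p = 1)
    (h : ∀ e ∈ l, e ≠ p → e ≠ q → z e = 0) : c x q = c x p + 1 :=
  hc.pair hG ((hl.2 _).1 hp) ((hl.2 _).1 hq) hpq zp fun e he => h e ((hl.2 e).2 he)

/-- At a vertex of degree three, a cycle through `p` and `q` leaves `r` on the side that is
determined by the rotation. -/
theorem SideFun.three {σ : PlanarEmbedding G} {z : β → ZMod 2} {c : α → β → ZMod 2}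
    (hc : SideFun σ z c) (hG : Good G) {x : α} {p q r : β} (hl : IncList G x [p, q, r])
    (zp : z p = 1) (zr : z r = 0) :
    c x q = c x p + 1 ∧ (σ.nx x p = q ↔ c x r = c x p) := by
  have hp := hc.nx ((hl.2 p).1 (by simp))
  have hr := hc.nx ((hl.2 r).1 (by simp))
  have hd := hl.1
  simp at hd
  rcases nx_three hG (σ := σ) hl with ⟨h1, h2, h3⟩ | ⟨h1, h2, h3⟩
  · rw [h1, zp] at hp
    rw [h3, zr, add_zero] at hr
    simp [hp, hr, h1]
  · rw [h1, zp] at hp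
    rw [h2, zr, add_zero] at hr
    have : r ≠ q := fun h => hd.2 h.symm
    simp [hp, hr, h1, this]

end

/-! ### The edges at the vertices of a net -/

/-- The number of the rim vertex that precedes the rim vertex `k`. -/
def prevRim (s k : ℕ) : ℕ := if k = 1 then 4 * s else k - 1

theorem prevRim_bounds {s k : ℕ} (hk : 1 ≤ k ∧ k ≤ 4 * s) :
    1 ≤ prevRim s k ∧ prevRim s k ≤ 4 * s ∧ prevRim s k ≠ k := by
  unfold prevRim
  split_ifs <;> omega

theorem prevRim_add_one (s k : ℕ) (hk : k ≠ 0) : prevRim s (k + 1) = k := by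
  simp [prevRim, hk]

section

variable {s N : ℕ} {hN : N ≤ s} {π : Page N} {t : ℕ}

theorem net_surface_prev {k : ℕ} (hk : 1 ≤ k ∧ k ≤ 4 * s) :
    (net hN π t).IsLink (.surface (prevRim s k)) (.rim (prevRim s k)) (.rim k) := by
  refine net_isLink_iff.2 ⟨⟨(prevRim_bounds hk).1, (prevRim_bounds hk).2.1⟩, Or.inl ⟨rfl, ?_⟩⟩
  simp only [netEnds, prevRim]
  congr 1
  split_ifs <;> omega

theorem net_spoke {k : ℕ} (hk : 1 ≤ k ∧ k ≤ 4 * s) :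
    (net hN π t).IsLink (.spoke k) .centre (.rim k) :=
  net_isLink_iff.2 ⟨hk, Or.inl ⟨rfl, rfl⟩⟩

theorem net_surface_inc {k : ℕ} (hk : 1 ≤ k ∧ k ≤ 4 * s) :
    (net hN π t).Inc (.surface k) (.rim k) := net_inc_iff.2 ⟨hk, Or.inl rfl⟩

theorem incList_rim (hN : N ≤ s) (π : Page N) (t : ℕ) {k : ℕ} (hk : 1 ≤ k ∧ k ≤ 4 * s)
    (h : k % 4 = 0 ∨ k % 4 = 2 ∨ N < k / 4 + 1) :
    IncList (net hN π t) (.rim k) [.surface (prevRim s k), .surface k, .spoke k] := by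
  have h1 := isRot_netList hN π t (fun _ => true) (.rim k) hk
  have h2 := prevRim_bounds hk
  have h3 : netList s N π.mate t (fun _ => true) (.rim k) =
      [.surface (prevRim s k), .surface k, .spoke k] := by
    rw [netList, netRot, ← prevRim]
    generalize prevRim s k = p at h2
    split_ifs with h4 h5
    · have h6 : ¬ k / 4 + 1 ≤ N := by omega
      simp [NetEdge, hk, h2, h6]
    · have h6 : ¬ k / 4 + 1 ≤ N := by omega
      simp [NetEdge, hk, h2, h6]
    · simp [NetEdge, hk, h2]
  rwa [h3] at h1

theorem incList_rim_left (hN : N ≤ s) (π : Page N) {t : ℕ} (ht : t ≤ 2) {i : ℕ}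
    (hi : i + 1 ≤ N) : IncList (net hN π t) (.rim (4 * i + 1))
      [.surface (prevRim s (4 * i + 1)), .wall (i + 1) 1, .surface (4 * i + 1),
        .spoke (4 * i + 1)] := by
  have hk : 1 ≤ 4 * i + 1 ∧ 4 * i + 1 ≤ 4 * s := by omega
  have h1 := isRot_netList hN π t (fun _ => true) (.rim (4 * i + 1)) hk
  have h2 := prevRim_bounds hk
  have h3 : netList s N π.mate t (fun _ => true) (.rim (4 * i + 1)) =
      [.surface (prevRim s (4 * i + 1)), .wall (i + 1) 1, .surface (4 * i + 1),
        .spoke (4 * i + 1)] := by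
    have e1 : (4 * i + 1) % 4 = 1 := by omega
    have e2 : (4 * i + 1) / 4 = i := by omega
    rw [netList, netRot, if_pos e1, ← prevRim, e2]
    simp [NetEdge, hk, h2, hi, ht]
  rwa [h3] at h1

theorem incList_rim_right (hN : N ≤ s) (π : Page N) {t : ℕ} (ht : t ≤ 2) {i : ℕ}
    (hi : i + 1 ≤ N) : IncList (net hN π t) (.rim (4 * i + 3))
      [.surface (4 * i + 2), .wall (i + 1) 6, .surface (4 * i + 3),
        .spoke (4 * i + 3)] := by
  have hk : 1 ≤ 4 * i + 3 ∧ 4 * i + 3 ≤ 4 * s := by omega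
  have h1 := isRot_netList hN π t (fun _ => true) (.rim (4 * i + 3)) hk
  have h3 : netList s N π.mate t (fun _ => true) (.rim (4 * i + 3)) =
      [.surface (4 * i + 2), .wall (i + 1) 6, .surface (4 * i + 3), .spoke (4 * i + 3)] := by
    have e1 : (4 * i + 3) % 4 = 3 := by omega
    have e2 : (4 * i + 3) / 4 = i := by omega
    have e3 : 4 * i + 2 ≤ 4 * s := by omega
    rw [netList, netRot, if_neg (by omega), if_pos e1, e2]
    simp [NetEdge, hk, hi, ht, e3]
  rwa [h3] at h1

theorem incList_house (hN : N ≤ s) (π : Page N) {t i k : ℕ} (hi : 1 ≤ i ∧ i ≤ N)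
    (hk : 2 ≤ k ∧ k ≤ 6) {l : List VillageEdge}
    (h : netList s N π.mate t (fun _ => true) (.house i k) = l) :
    IncList (net hN π t) (.house i k) l :=
  h ▸ isRot_netList hN π t (fun _ => true) (.house i k) ⟨⟨hi, hi.1, hi.2.trans hN⟩, hk⟩

variable {i : ℕ}

theorem incList_two (hN : N ≤ s) (π : Page N) (hi : 1 ≤ i ∧ i ≤ N)
    (h : t = 1 ∨ (i < π.mate i)) :
    IncList (net hN π t) (.house i 2) [.wall i 1, .wall i 2, .claw i 1] := by
  refine incList_house hN π hi (by norm_num) ?_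
  have h1 := π.invol i
  have h2 : t = 1 ∨ i ≤ π.mate i := by omega
  have h3 : ¬ (2 ≤ t ∧ π.mate i < i) := by omega
  have h4 : t ≤ 2 ∨ i ≤ π.mate i := by omega
  simp [netList, netRot, NetEdge, hi, h1, h3, h4]

theorem incList_three (hN : N ≤ s) (π : Page N) (t : ℕ) (hi : 1 ≤ i ∧ i ≤ N) :
    IncList (net hN π t) (.house i 3) [.wall i 2, .wall i 3] := by
  refine incList_house hN π hi (by norm_num) ?_
  simp [netList, netRot, NetEdge, hi]

theorem incList_four (hN : N ≤ s) (π : Page N) (t : ℕ) (hi : 1 ≤ i ∧ i ≤ N) :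
    IncList (net hN π t) (.house i 4) [.wall i 3, .wall i 4, .claw i 2] := by
  refine incList_house hN π hi (by norm_num) ?_
  simp [netList, netRot, NetEdge, hi]

theorem incList_five (hN : N ≤ s) (π : Page N) (t : ℕ) (hi : 1 ≤ i ∧ i ≤ N) :
    IncList (net hN π t) (.house i 5) [.wall i 4, .wall i 5] := by
  refine incList_house hN π hi (by norm_num) ?_
  simp [netList, netRot, NetEdge, hi]

theorem incList_six (hN : N ≤ s) (π : Page N) (hi : 1 ≤ i ∧ i ≤ N)
    (h : t = 1 ∨ π.mate i < i) :
    IncList (net hN π t) (.house i 6) [.wall i 6, .claw i 3, .wall i 5] := by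
  refine incList_house hN π hi (by norm_num) ?_
  have h3 : ¬ (2 ≤ t ∧ i < π.mate i) := by omega
  have h4 : t ≤ 2 ∨ π.mate i ≤ i := by omega
  simp [netList, netRot, NetEdge, hi, h3, h4]

theorem incList_inhabitant (hN : N ≤ s) (π : Page N) (ht : t ≤ 3) (hi : 1 ≤ i ∧ i ≤ N) :
    IncList (net hN π t) (.inhabitant i) [.claw i 1, .claw i 2, .claw i 3] := by
  have h1 := isRot_netList hN π t (fun _ => true) (.inhabitant i) ⟨hi, hi.1, hi.2.trans hN⟩
  have h3 : ¬ 4 ≤ t := by omega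
  have h4 : netList s N π.mate t (fun _ => true) (.inhabitant i) =
      [.claw i 1, .claw i 2, .claw i 3] := by
    simp [netList, netRot, NetEdge, hi, h3]
  rwa [h4] at h1

theorem incList_six_link (hN : N ≤ s) (π : Page N) (ht : 3 ≤ t) (hi : 1 ≤ i ∧ i ≤ N)
    (h : i < π.mate i) :
    IncList (net hN π t) (.house i 6) [.wall i 7, .claw i 3, .wall i 5] := by
  refine incList_house hN π hi (by norm_num) ?_
  have h3 : ¬ t ≤ 2 := by omega
  have h4 : 2 ≤ t := by omega
  simp [netList, netRot, NetEdge, hi, h3, h4, h]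

theorem incList_two_link (hN : N ≤ s) (π : Page N) (ht : 3 ≤ t) (hi : 1 ≤ i ∧ i ≤ N)
    (h : i < π.mate i) :
    IncList (net hN π t) (.house (π.mate i) 2) [.wall i 7, .wall (π.mate i) 2,
      .claw (π.mate i) 1] := by
  have hi' : 1 ≤ π.mate i ∧ π.mate i ≤ N := π.mem hi
  refine incList_house hN π hi' (by norm_num) ?_
  have h3 : ¬ t ≤ 2 := by omega
  have h4 : 2 ≤ t := by omega
  have h5 := π.invol i
  simp [netList, netRot, NetEdge, hi, hi', h3, h4, h, h5]

/-! ### Links -/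

theorem net_link_wall {k : ℕ} (h : NetEdge s N π.mate t (.wall i k)) (hk : 2 ≤ k ∧ k ≤ 5) :
    (net hN π t).IsLink (.wall i k) (.house i k) (.house i (k + 1)) := by
  refine net_isLink_iff.2 ⟨h, Or.inl ?_⟩
  have h1 : k ≠ 7 := by omega
  have h2 : k ≠ 1 := by omega
  have h3 : k ≠ 0 := by omega
  have h4 : k ≠ 6 := by omega
  simp [netEnds, houseVertex, h1, h2, h3, h4]

theorem net_link_wall_one (h : NetEdge s N π.mate t (.wall i 1)) :
    (net hN π t).IsLink (.wall i 1) (.rim (4 * i - 3)) (.house i 2) :=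
  net_isLink_iff.2 ⟨h, Or.inl (by simp [netEnds, houseVertex])⟩

theorem net_link_wall_six (h : NetEdge s N π.mate t (.wall i 6)) :
    (net hN π t).IsLink (.wall i 6) (.house i 6) (.rim (4 * i - 1)) :=
  net_isLink_iff.2 ⟨h, Or.inl (by simp [netEnds, houseVertex])⟩

theorem net_link_wall_seven (h : NetEdge s N π.mate t (.wall i 7)) :
    (net hN π t).IsLink (.wall i 7) (.house i 6) (.house (π.mate i) 2) :=
  net_isLink_iff.2 ⟨h, Or.inl (by simp [netEnds])⟩

theorem net_link_claw {k : ℕ} (h : NetEdge s N π.mate t (.claw i k)) (hk : k ≤ 3) :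
    (net hN π t).IsLink (.claw i k) (.inhabitant i) (.house i (2 * k)) := by
  have h1 : k ≠ 4 := by omega
  exact net_isLink_iff.2 ⟨h, Or.inl (by simp [netEnds, h1])⟩

theorem net_link_claw_four (h : NetEdge s N π.mate t (.claw i 4)) :
    (net hN π t).IsLink (.claw i 4) (.inhabitant i) (.inhabitant (π.mate i)) :=
  net_isLink_iff.2 ⟨h, Or.inl (by simp [netEnds])⟩

end

/-! ### Rotations at vertices of small degree -/

section

variable {α : Type*} {β : Type*} {G : Graph α β} {σ τ : PlanarEmbedding G} {x : α}
  {p q r s : β}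

/-- The rotation is injective and has no proper closed subset; excluding cycles of length one, two
and three through `p` leaves six cyclic orders. -/
theorem nx_four (hG : Good G) (h : IncList G x [p, q, r, s]) :
    (σ.nx x p = q ∧ σ.nx x q = r ∧ σ.nx x r = s ∧ σ.nx x s = p) ∨
    (σ.nx x p = q ∧ σ.nx x q = s ∧ σ.nx x s = r ∧ σ.nx x r = p) ∨
    (σ.nx x p = r ∧ σ.nx x r = q ∧ σ.nx x q = s ∧ σ.nx x s = p) ∨
    (σ.nx x p = r ∧ σ.nx x r = s ∧ σ.nx x s = q ∧ σ.nx x q = p) ∨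
    (σ.nx x p = s ∧ σ.nx x s = q ∧ σ.nx x q = r ∧ σ.nx x r = p) ∨
    (σ.nx x p = s ∧ σ.nx x s = r ∧ σ.nx x r = q ∧ σ.nx x q = p) := by
  have hd := h.1
  have hmem : ∀ e ∈ [p, q, r, s], σ.nx x e ∈ [p, q, r, s] := fun e he => h.nx_mem he
  have hcl : ∀ t : β → Prop, t p → (∀ f ∈ [p, q, r, s], t f → t (σ.nx x f)) →
      t q ∧ t r ∧ t s := by
    intro t h1 h2
    have h3 := h.closed hG t (by simp) h1 h2
    exact ⟨h3 q (by simp), h3 r (by simp), h3 s (by simp)⟩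
  have hinj : ∀ e ∈ [p, q, r, s], ∀ f ∈ [p, q, r, s], σ.nx x e = σ.nx x f → e = f :=
    fun e he f hf => σ.nx_injective ((h.2 e).1 he) ((h.2 f).1 hf)
  simp only [List.nodup_cons, List.mem_cons, List.not_mem_nil, or_false, not_or] at hd
  obtain ⟨⟨d1, d2, d3⟩, ⟨d4, d5⟩, d6, -⟩ := hd
  have m1 := hmem p (by simp)
  have m2 := hmem q (by simp)
  have m3 := hmem r (by simp)
  have m4 := hmem s (by simp)
  simp only [List.mem_cons, List.not_mem_nil, or_false] at m1 m2 m3 m4 hcl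
  have i1 := hinj p (by simp) q (by simp)
  have i2 := hinj p (by simp) r (by simp)
  have i3 := hinj p (by simp) s (by simp)
  have i4 := hinj q (by simp) r (by simp)
  have i5 := hinj q (by simp) s (by simp)
  have i6 := hinj r (by simp) s (by simp)
  clear hmem hinj
  have c1 := hcl (fun e => e = p) rfl
  have c2 : ∀ e, e ≠ p → (e = q ∨ e = r ∨ e = s) → ¬ (σ.nx x p = e ∧ σ.nx x e = p) := by
    rintro e he he' ⟨h1, h2⟩
    have := hcl (fun f => f = p ∨ f = e) (Or.inl rfl)
    grind
  have c3 : ∀ e f, e ≠ p → f ≠ p → (e = q ∨ e = r ∨ e = s) → (f = q ∨ f = r ∨ f = s) →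
      ¬ (σ.nx x p = e ∧ σ.nx x e = f ∧ σ.nx x f = p) := by
    rintro e f he hf he' hf' ⟨h1, h2, h3⟩
    have := hcl (fun g => g = p ∨ g = e ∨ g = f) (Or.inl rfl)
    grind
  have c1 : σ.nx x p ≠ p := fun h1 => d1 (c1 (by rintro f - rfl; exact h1)).1.symm
  have c2q := c2 q (Ne.symm d1) (by simp)
  have c2r := c2 r (Ne.symm d2) (by simp)
  have c2s := c2 s (Ne.symm d3) (by simp)
  have c3q := fun f h1 h2 => c3 q f (Ne.symm d1) h1 (by simp) h2
  have c3r := fun f h1 h2 => c3 r f (Ne.symm d2) h1 (by simp) h2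
  have c3s := fun f h1 h2 => c3 s f (Ne.symm d3) h1 (by simp) h2
  clear c2 c3 hcl
  rcases m1 with m1 | m1 | m1 | m1 <;> grind

theorem nx_eq_of_three (hG : Good G) (h : IncList G x [p, q, r])
    (h' : σ.nx x p = q ↔ τ.nx x p = q) {e : β} (he : G.Inc e x) : σ.nx x e = τ.nx x e := by
  have hd := h.1
  have he' := (h.2 e).2 he
  have h1 := nx_three hG (σ := σ) h
  have h2 := nx_three hG (σ := τ) h
  simp at hd he'
  grind

theorem nx_eq_of_two (hG : Good G) (h : IncList G x [p, q]) {e : β} (he : G.Inc e x) :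
    σ.nx x e = τ.nx x e := by
  have he' := (h.2 e).2 he
  have h' : IncList G x [q, p] := ⟨(List.Perm.swap q p []).nodup h.1, fun e => by
    rw [← h.2 e]
    simp [or_comm]⟩
  simp at he'
  rcases he' with rfl | rfl
  · rw [nx_two hG h, nx_two hG h]
  · rw [nx_two hG h', nx_two hG h']

/-- As `q` and `s` lie on different sides, `p` and `r` separate them in the rotation. Only two
mirror-image orders remain, and the colour of `s` tells them apart. -/
theorem nx_four_of_side {z : β → ZMod 2} {c : α → β → ZMod 2} (hc : SideFun σ z c) (hG : Good G)
    (h : IncList G x [p, q, r, s]) (zp : z p = 1) (zq : z q = 0) (zr : z r = 1) (zs : z s = 0)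
    (hqs : c x q = c x s + 1) :
    (c x s = c x p ∧ σ.nx x s = p ∧ σ.nx x p = q ∧ σ.nx x q = r ∧ σ.nx x r = s) ∨
      (c x s = c x p + 1 ∧ σ.nx x p = s ∧ σ.nx x q = p ∧ σ.nx x r = q ∧ σ.nx x s = r) := by
  have hp := hc.nx ((h.2 p).1 (by simp))
  have hq := hc.nx ((h.2 q).1 (by simp))
  have hr := hc.nx ((h.2 r).1 (by simp))
  have hs := hc.nx ((h.2 s).1 (by simp))
  have h6 : (1 : ZMod 2) + 1 = 0 := rfl
  have h7 : ∀ a : ZMod 2, a + 1 + 1 = a := fun a => by rw [add_assoc, h6, add_zero]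
  have h8 : ∀ a : ZMod 2, a ≠ a + 1 := by decide
  rcases nx_four hG (σ := σ) h with h | h | h | h | h | h <;>
  obtain ⟨h1, h2, h3, h4⟩ := h <;> grind

end

/-! ### The rigidity of villages -/

section

variable {s N : ℕ} {hN : N ≤ s} {π : Page N} {t i : ℕ}

/-- The equator of the planet. -/
def equator : VillageEdge → ZMod 2
  | .surface _ => 1
  | _ => 0

theorem equator_inc {k : ℕ} (hk : 1 ≤ k ∧ k ≤ 4 * s) {e : VillageEdge}
    (he : (net hN π t).Inc e (.rim k)) (h1 : e ≠ .surface (prevRim s k)) (h2 : e ≠ .surface k) :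
    equator e = 0 := by
  cases e with
  | surface j =>
    exfalso
    obtain ⟨hj, h⟩ := net_inc_iff.1 he
    have hj' : 1 ≤ j ∧ j ≤ 4 * s := hj
    simp only [netEnds, VillageVertex.rim.injEq, prevRim, ne_eq, VillageEdge.surface.injEq] at h h1 h2
    split_ifs at h h1 <;> omega
  | _ => rfl

theorem isEven_equator (hN : N ≤ s) (π : Page N) (t : ℕ) : IsEven (net hN π t) equator := by
  intro x hx
  refine ⟨_, isRot_netList hN π t (fun _ => true) x hx, ?_⟩
  cases x with
  | rim k =>
    have hk : 1 ≤ k ∧ k ≤ 4 * s := hx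
    have h2 := prevRim_bounds hk
    have h6 : (1 : ZMod 2) + 1 = 0 := rfl
    rw [netList, netRot, ← prevRim]
    generalize prevRim s k = p at h2
    have e1 : NetEdge s N π.mate t (.surface p) := ⟨h2.1, h2.2.1⟩
    have e2 : NetEdge s N π.mate t (.surface k) := hk
    have e3 : NetEdge s N π.mate t (.spoke k) := hk
    split_ifs <;> simp only [List.filter_cons, e1, e2, e3, decide_true, if_true] <;>
      (try split_ifs) <;> simp [equator, h6]
  | _ =>
    refine List.sum_eq_zero fun a ha => ?_
    obtain ⟨e, he, rfl⟩ := List.mem_map.1 ha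
    have h1 := List.mem_of_mem_filter he
    cases e with
    | surface j =>
      exfalso
      simp only [netRot] at h1
      (try split_ifs at h1) <;> simp at h1
    | _ => rfl

variable {σ τ : PlanarEmbedding (net hN π t)} {c : VillageVertex → VillageEdge → ZMod 2}

/-- The colours beside the equator are carried along the rim, and the colour of the spokes is
carried through the centre. So all rim vertices show the same pattern, and their rotations can be
compared. -/
theorem SideFun.equator_const (hc : SideFun σ equator c) (hs : 0 < s) :
    ∃ κ l, ∀ k, 1 ≤ k ∧ k ≤ 4 * s → c (.rim k) (.spoke k) = κ ∧ c (.rim k) (.surface k) = l ∧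
      c (.rim k) (.surface (prevRim s k)) = l + 1 := by
  have hG := net_good hN π t hs
  have h7 : ∀ a : ZMod 2, a + 1 + 1 = a := by decide
  have hp : ∀ k, 1 ≤ k ∧ k ≤ 4 * s →
      c (.rim k) (.surface k) = c (.rim k) (.surface (prevRim s k)) + 1 := fun k hk =>
    hc.pair hG (net_surface_prev hk).inc_right (net_surface_inc hk)
      (by simpa using (prevRim_bounds hk).2.2) rfl fun e he => equator_inc hk he
  have hl : ∀ k, 1 ≤ k → k ≤ 4 * s → c (.rim k) (.surface k) = c (.rim 1) (.surface 1) := by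
    intro k hk
    induction k, hk using Nat.le_induction with
    | base => exact fun _ => rfl
    | succ k hk ih =>
      intro hk'
      have h1 := hc.link (net_surface_prev (hN := hN) (π := π) (t := t) (k := k + 1) ⟨by omega, hk'⟩)
      have h2 := hp (k + 1) ⟨by omega, hk'⟩
      rw [prevRim_add_one s k (by omega)] at h1 h2
      rw [h2, h1, ih (by omega)]
      exact h7 _
  refine ⟨c .centre (.spoke 1), c (.rim 1) (.surface 1), fun k hk => ⟨?_, hl k hk.1 hk.2, ?_⟩⟩
  · have h1 := hc.link (net_spoke (hN := hN) (π := π) (t := t) hk)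
    rw [h1]
    have h2 : equator (.spoke k) = 0 := rfl
    rw [h2, add_zero]
    refine hc.const hG (fun e he => ?_) (net_spoke ⟨le_rfl, by omega⟩).inc_left
      (net_spoke hk).inc_left
    cases e with
    | surface j =>
      exfalso
      have := (net_inc_iff.1 he).2
      simp [netEnds] at this
    | _ => rfl
  · rw [← hl k hk.1 hk.2, hp k hk, h7]

/-- A side function of a cycle that avoids the house is constant on the house. -/
theorem SideFun.house_const {σ : PlanarEmbedding (net hN π 1)} {z : VillageEdge → ZMod 2}
    (hc : SideFun σ z c) (hi : 1 ≤ i ∧ i ≤ N) (hz : ∀ k, z (.wall i k) = 0)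
    (hz' : ∀ k, z (.claw i k) = 0) :
    c (.rim (4 * i - 3)) (.wall i 1) = c (.rim (4 * i - 1)) (.wall i 6) := by
  have hG := net_good hN π 1 (by omega : 0 < s)
  have he : ∀ k, 1 ≤ k ∧ k ≤ 6 → NetEdge s N π.mate 1 (.wall i k) := fun k hk =>
    ⟨hi, by omega⟩
  have l1 := hc.link (net_link_wall_one (hN := hN) (he 1 (by norm_num)))
  have l2 := hc.link (net_link_wall (hN := hN) (he 2 (by norm_num)) (by norm_num))
  have l3 := hc.link (net_link_wall (hN := hN) (he 3 (by norm_num)) (by norm_num))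
  have l4 := hc.link (net_link_wall (hN := hN) (he 4 (by norm_num)) (by norm_num))
  have l5 := hc.link (net_link_wall (hN := hN) (he 5 (by norm_num)) (by norm_num))
  have l6 := hc.link (net_link_wall_six (hN := hN) (he 6 (by norm_num)))
  have k2 := hc.const_list hG (incList_two hN π hi (Or.inl rfl)) (by simp [hz, hz'])
    (.wall i 1) (by simp) (.wall i 2) (by simp)
  have k3 := hc.const_list hG (incList_three hN π 1 hi) (by simp [hz])
    (.wall i 2) (by simp) (.wall i 3) (by simp)
  have k4 := hc.const_list hG (incList_four hN π 1 hi) (by simp [hz, hz'])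
    (.wall i 3) (by simp) (.wall i 4) (by simp)
  have k5 := hc.const_list hG (incList_five hN π 1 hi) (by simp [hz])
    (.wall i 4) (by simp) (.wall i 5) (by simp)
  have k6 := hc.const_list hG (incList_six hN π hi (Or.inl rfl)) (by simp [hz, hz'])
    (.wall i 5) (by simp) (.wall i 6) (by simp)
  rw [hz, add_zero] at l1 l2 l3 l4 l5 l6
  rw [← l1, k2, ← l2, k3, ← l3, k4, ← l4, k5, ← l5, k6, l6]

/-- A side function of a cycle that meets the equator only at `k` and `k + 1` is constant on the
rest of the equator. -/
theorem SideFun.around {z : VillageEdge → ZMod 2} (hc : SideFun σ z c) (hs : 0 < s) {k : ℕ}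
    (hk : 1 ≤ k ∧ k + 2 ≤ 4 * s) (hz : ∀ j, 1 ≤ j ∧ j ≤ 4 * s → j ≠ k → j ≠ k + 1 →
      ∀ e, (net hN π t).Inc e (.rim j) → z e = 0) :
    c (.rim (k + 2)) (.surface (k + 2)) = c (.rim k) (.surface (prevRim s k)) := by
  have hG := net_good hN π t hs
  have h1 : ∀ j, k + 2 ≤ j → j ≤ 4 * s →
      c (.rim j) (.surface j) = c (.rim (k + 2)) (.surface (k + 2)) := by
    intro j hj
    induction j, hj using Nat.le_induction with
    | base => exact fun _ => rfl
    | succ j hj ih =>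
      intro hj'
      have hb : 1 ≤ j + 1 ∧ j + 1 ≤ 4 * s := ⟨by omega, hj'⟩
      have h2 := net_surface_prev (hN := hN) (π := π) (t := t) hb
      have h3 := hz (j + 1) hb (by omega) (by omega)
      rw [hc.const hG h3 h2.inc_right (net_surface_inc hb), hc.link h2, h3 _ h2.inc_right,
        prevRim_add_one s j (by omega), add_zero, ih (by omega)]
  have h2 : ∀ j, 1 ≤ j → j ≤ k →
      c (.rim j) (.surface (prevRim s j)) = c (.rim (k + 2)) (.surface (k + 2)) := by
    intro j hj
    induction j, hj using Nat.le_induction with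
    | base =>
      intro _
      have h2 := net_surface_prev (hN := hN) (π := π) (t := t) (k := 1) ⟨le_rfl, by omega⟩
      have h3 : prevRim s 1 = 4 * s := rfl
      rw [hc.link h2, h3, h1 _ hk.2 le_rfl,
        hz (4 * s) ⟨by omega, le_rfl⟩ (by omega) (by omega) _ (net_surface_inc ⟨by omega, le_rfl⟩),
        add_zero]
    | succ j hj ih =>
      intro hj'
      have hb : 1 ≤ j + 1 ∧ j + 1 ≤ 4 * s := ⟨by omega, by omega⟩
      have hb' : 1 ≤ j ∧ j ≤ 4 * s := ⟨by omega, by omega⟩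
      have h2 := net_surface_prev (hN := hN) (π := π) (t := t) hb
      have h3 := hz j hb' (by omega) (by omega)
      rw [hc.link h2, prevRim_add_one s j (by omega), h3 _ (net_surface_inc hb'), add_zero,
        hc.const hG h3 (net_surface_prev hb').inc_right (net_surface_inc hb'), ih (by omega)]
  exact (h2 k hk.1 le_rfl).symm

end

section

variable {s N : ℕ} {hN : N ≤ s} {π : Page N} {i : ℕ} {σ τ : PlanarEmbedding (net hN π 1)}
  {c : VillageVertex → VillageEdge → ZMod 2}

/-- Houses are on the outer side of the equator. -/
theorem SideFun.equator_house (hc : SideFun σ equator c) (hi : i + 1 ≤ N) :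
    c (.rim (4 * i + 1)) (.wall (i + 1) 1) = c (.rim (4 * i + 1)) (.spoke (4 * i + 1)) + 1 := by
  have hG := net_good hN π 1 (by omega : 0 < s)
  have hrot := isRot_netList hN π 1 fun _ => true
  set k := 4 * i + 1 with hk
  have hb0 : 1 ≤ k ∧ k ≤ 4 * s := by omega
  have hb1 : 1 ≤ k + 1 ∧ k + 1 ≤ 4 * s := by omega
  have hb2 : 1 ≤ k + 2 ∧ k + 2 ≤ 4 * s := by omega
  have hbp := prevRim_bounds hb0
  have hp4 : k = 1 ∧ prevRim s k = 4 * s ∨ 1 < k ∧ prevRim s k = k - 1 := by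
    unfold prevRim
    split_ifs <;> omega
  have hl0 := incList_rim_left hN π (t := 1) (by norm_num) hi
  have hl1 := incList_rim hN π 1 hb1 (by omega)
  have hl2 := incList_rim_right hN π (t := 1) (by norm_num) hi
  rw [← hk] at hl0
  rw [prevRim_add_one s k (by omega)] at hl1
  have m1 : 4 * i + 2 ≠ k ∧ 4 * i + 3 ≠ k := by omega
  have m2 : 4 * i + 2 ≠ prevRim s k ∧ 4 * i + 3 ≠ prevRim s k := by omega
  have e1 : 4 * (i + 1) - 3 = k := by omega
  have e2 : 4 * (i + 1) - 1 = k + 2 := by omega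
  have s1 : (net hN π 1).IsLink (.surface k) (.rim k) (.rim (k + 1)) := by
    have h := net_surface_prev (hN := hN) (π := π) (t := 1) hb1
    rwa [prevRim_add_one s k (by omega)] at h
  have s2 : (net hN π 1).IsLink (.surface (k + 1)) (.rim (k + 1)) (.rim (k + 2)) := by
    have h := net_surface_prev (hN := hN) (π := π) (t := 1) hb2
    rwa [prevRim_add_one s (k + 1) (by omega)] at h
  -- Two triangles of the wheel at the left end of the house: one over the surface edge after it,
  -- one over the surface edge before it.
  obtain ⟨c1, hc1⟩ := exists_sideFun hG σ (isEven_trace hG hrot (u := .centre)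
    (l := [(.spoke k, .rim k), (.surface k, .rim (k + 1)), (.spoke (k + 1), .centre)])
    ⟨net_spoke hb0, s1, (net_spoke hb1).symm, rfl⟩)
  obtain ⟨c2, hc2⟩ := exists_sideFun hG σ (isEven_trace hG hrot (u := .centre)
    (l := [(.spoke (prevRim s k), .rim (prevRim s k)), (.surface (prevRim s k), .rim k),
      (.spoke k, .centre)])
    ⟨net_spoke ⟨hbp.1, hbp.2.1⟩, net_surface_prev hb0, (net_spoke hb0).symm, rfl⟩)
  -- The house, followed by the rest of the equator from its right end, connects the wall with the
  -- preceding surface edge while avoiding the first triangle except at rim vertex `k`.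
  have a1 : c1 (.rim k) (.wall (i + 1) 1) = c1 (.rim k) (.surface (prevRim s k)) := by
    have h1 := hc1.house_const (i := i + 1) ⟨by omega, hi⟩ (by simp [trace]) (by simp [trace])
    have h2 := hc1.around (k := k) (by omega) ⟨hb0.1, hb2.2⟩ fun j hj h1 h2 e he => by
      have h3 := (net_inc_iff.1 he).2
      have n1 : e ≠ .spoke k := by
        rintro rfl
        simp [netEnds] at h3
        omega
      have n2 : e ≠ .surface k := by
        rintro rfl
        have : k ≠ 4 * s := by omega
        simp [netEnds, this] at h3
        omega
      have n3 : e ≠ .spoke (k + 1) := by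
        rintro rfl
        simp [netEnds] at h3
        omega
      simp [trace, n1, n2, n3]
    have h3 := hc1.const_list hG hl2 (by simp [trace, m1]) (.wall (i + 1) 6) (by simp)
      (.surface (4 * i + 3)) (by simp)
    rw [e1, e2] at h1
    rw [h1, ← h2]
    exact h3
  -- The house and the part of the equator below it close up without meeting the second triangle
  -- except at rim vertex `k`.
  have a2 : c2 (.rim k) (.wall (i + 1) 1) = c2 (.rim k) (.surface k) := by
    have h1 := hc2.house_const (i := i + 1) ⟨by omega, hi⟩ (by simp [trace]) (by simp [trace])
    have n1 : k ≠ prevRim s k := by omega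
    have n2 : k + 1 ≠ prevRim s k := by omega
    have n3 : k + 2 ≠ prevRim s k := by omega
    have h2 := hc2.const_list hG hl1 (by simp [trace, n1, n2]) (.surface k) (by simp)
      (.surface (k + 1)) (by simp)
    have h3 := hc2.const_list hG hl2 (by simp [trace, m1, m2]) (.wall (i + 1) 6) (by simp)
      (.surface (4 * i + 2)) (by simp)
    have h4 := hc2.link s1
    have h5 := hc2.link s2
    have z1 : trace [(VillageEdge.spoke (prevRim s k), VillageVertex.rim (prevRim s k)),
      (.surface (prevRim s k), .rim k), (.spoke k, .centre)] (.surface k) = 0 := by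
      simp [trace, n1]
    have z2 : trace [(VillageEdge.spoke (prevRim s k), VillageVertex.rim (prevRim s k)),
      (.surface (prevRim s k), .rim k), (.spoke k, .centre)] (.surface (k + 1)) = 0 := by
      simp [trace, n2]
    rw [z1, add_zero] at h4
    rw [z2, add_zero] at h5
    rw [e1, e2] at h1
    rw [h1, ← h4, h2, ← h5]
    exact h3
  -- If the wall were on the side of the spoke, it would leave its rim vertex between the spoke and
  -- one of the two surface edges. The triangle there would then separate it from the other surface
  -- edge, against `a1` or `a2`.
  by_contra hne
  have h0 : ∀ a b : ZMod 2, a ≠ b + 1 → a = b := by decide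
  have a0 := h0 _ _ hne
  have n1 := hbp.2.2
  have za : trace [(VillageEdge.spoke k, VillageVertex.rim k), (.surface k, .rim (k + 1)),
    (.spoke (k + 1), .centre)] (.surface (prevRim s k)) = 0 := by simp [trace, n1]
  have zb : trace [(VillageEdge.spoke (prevRim s k), VillageVertex.rim (prevRim s k)),
      (.surface (prevRim s k), .rim k), (.spoke k, .centre)] (.surface k) = 0 := by
    simp [trace, n1.symm]
  have ha := (hl0.2 (.surface (prevRim s k))).1 (by simp)
  have hh := (hl0.2 (.wall (i + 1) 1)).1 (by simp)
  have hb := (hl0.2 (.surface k)).1 (by simp)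
  have hp := (hl0.2 (.spoke k)).1 (by simp)
  have x1 := hc.nx ha
  have x2 := hc.nx hh
  have x3 := hc.nx hb
  have x4 := hc.nx hp
  have y1 := hc1.nx ha
  have y2 := hc1.nx hh
  have y3 := hc1.nx hb
  have y4 := hc1.nx hp
  have w1 := hc2.nx ha
  have w2 := hc2.nx hh
  have w3 := hc2.nx hb
  have w4 := hc2.nx hp
  simp only [equator, add_zero] at x1 x2 x3 x4
  rw [za] at y1
  rw [zb] at w3
  simp [trace] at y2 y3 y4
  simp [trace, n1.symm] at w1 w2 w4
  have h8 : ∀ a : ZMod 2, a ≠ a + 1 := by decide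
  rcases nx_four hG (σ := σ) hl0 with h | h | h | h | h | h <;>
    obtain ⟨h1, h2, h3, h4⟩ := h <;> grind

end

theorem IncList.rotate_three {α : Type*} {β : Type*} {G : Graph α β} {x : α} {p q r : β}
    (h : IncList G x [p, q, r]) : IncList G x [r, p, q] := by
  refine ⟨(List.isRotated_append (l := [p, q]) (l' := [r])).nodup_iff.1 h.1, fun e => ?_⟩
  rw [← h.2 e]
  simp only [List.mem_cons, List.not_mem_nil, or_false]
  tauto

section

variable {s N : ℕ} {hN : N ≤ s} {π : Page N} {i : ℕ} {σ τ : PlanarEmbedding (net hN π 1)}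
  {c : VillageVertex → VillageEdge → ZMod 2}

/-- The position of the inhabitant relative to a cycle through all walls determines the rotations
of the house. -/
theorem SideFun.house {z : VillageEdge → ZMod 2} (hc : SideFun σ z c) (hi : 1 ≤ i ∧ i ≤ N)
    (hz : ∀ k, 1 ≤ k ∧ k ≤ 6 → z (.wall i k) = 1) (hz' : ∀ k, z (.claw i k) = 0) :
    ∃ μ ω, c (.house i 2) (.wall i 1) = μ ∧ (∀ k, 1 ≤ k ∧ k ≤ 3 →
        c (.inhabitant i) (.claw i k) = ω) ∧
      (σ.nx (.house i 2) (.wall i 1) = .wall i 2 ↔ ω = μ) ∧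
      (σ.nx (.house i 4) (.wall i 3) = .wall i 4 ↔ ω = μ) ∧
      (σ.nx (.house i 6) (.wall i 5) = .wall i 6 ↔ ω = μ) := by
  have hG := net_good hN π 1 (by omega : 0 < s)
  have he : ∀ k, 1 ≤ k ∧ k ≤ 6 → NetEdge s N π.mate 1 (.wall i k) := fun k hk =>
    ⟨hi, by omega⟩
  have hcl : ∀ k, 1 ≤ k ∧ k ≤ 3 → NetEdge s N π.mate 1 (.claw i k) := fun k hk =>
    ⟨hi, by omega⟩
  have l2 := hc.link (net_link_wall (hN := hN) (he 2 (by norm_num)) (by norm_num))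
  have l3 := hc.link (net_link_wall (hN := hN) (he 3 (by norm_num)) (by norm_num))
  have l4 := hc.link (net_link_wall (hN := hN) (he 4 (by norm_num)) (by norm_num))
  have l5 := hc.link (net_link_wall (hN := hN) (he 5 (by norm_num)) (by norm_num))
  rw [hz _ (by norm_num)] at l2 l3 l4 l5
  have m1 := hc.link (net_link_claw (hN := hN) (hcl 1 (by norm_num)) (by norm_num))
  have m2 := hc.link (net_link_claw (hN := hN) (hcl 2 (by norm_num)) (by norm_num))
  have m3 := hc.link (net_link_claw (hN := hN) (hcl 3 (by norm_num)) (by norm_num))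
  rw [hz', add_zero] at m1 m2 m3
  have k2 := hc.three hG (incList_two hN π hi (Or.inl rfl)) (hz 1 (by norm_num)) (hz' 1)
  have k4 := hc.three hG (incList_four hN π 1 hi) (hz 3 (by norm_num)) (hz' 2)
  have k6 := hc.three hG (incList_six hN π hi (Or.inl rfl)).rotate_three
    (hz 5 (by norm_num)) (hz' 3)
  have k3 := hc.pair_list hG (incList_three hN π 1 hi) (p := .wall i 2) (q := .wall i 3)
    (by simp) (by simp) (by simp) (hz 2 (by norm_num)) (by simp)
  have k5 := hc.pair_list hG (incList_five hN π 1 hi) (p := .wall i 4) (q := .wall i 5)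
    (by simp) (by simp) (by simp) (hz 4 (by norm_num)) (by simp)
  have kw := hc.const_list hG (incList_inhabitant hN π (t := 1) (by norm_num) hi)
    (by simp [hz'])
  have w2 := kw (.claw i 2) (by simp) (.claw i 1) (by simp)
  have w3 := kw (.claw i 3) (by simp) (.claw i 1) (by simp)
  have h7 : ∀ a : ZMod 2, a + 1 + 1 = a := by decide
  -- Going to the other end of a wall and on to the following wall switches the colour twice.
  have e4 : c (.house i 4) (.wall i 3) = c (.house i 2) (.wall i 1) := by
    rw [l3, k3, l2, k2.1]
    simp only [h7]
  have e6 : c (.house i 6) (.wall i 5) = c (.house i 2) (.wall i 1) := by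
    rw [l5, k5, l4, k4.1, e4]
    simp only [h7]
  refine ⟨_, c (.inhabitant i) (.claw i 1), rfl, fun k hk => ?_, ?_, ?_, ?_⟩
  · obtain rfl | rfl | rfl : k = 1 ∨ k = 2 ∨ k = 3 := by omega
    exacts [rfl, w2, w3]
  · rw [k2.2, ← m1]
  · rw [k4.2, ← e4, ← w2, ← m2]
  · rw [k6.2, ← e6, ← w3, ← m3]

/-- The rotation at the inhabitant is determined by the rotation at the middle of the house. -/
theorem nx_inhabitant (hi : 1 ≤ i ∧ i ≤ N) :
    σ.nx (.inhabitant i) (.claw i 1) = .claw i 2 ↔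
      σ.nx (.house i 4) (.wall i 3) = .wall i 4 := by
  have hG := net_good hN π 1 (by omega : 0 < s)
  have hrot := isRot_netList hN π 1 fun _ => true
  have he : ∀ k, 1 ≤ k ∧ k ≤ 6 → NetEdge s N π.mate 1 (.wall i k) := fun k hk =>
    ⟨hi, by omega⟩
  have hcl : ∀ k, 1 ≤ k ∧ k ≤ 3 → NetEdge s N π.mate 1 (.claw i k) := fun k hk =>
    ⟨hi, by omega⟩
  have n2 := net_link_wall (hN := hN) (he 2 (by norm_num)) (by norm_num)
  have n3 := net_link_wall (hN := hN) (he 3 (by norm_num)) (by norm_num)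
  have n4 := net_link_wall (hN := hN) (he 4 (by norm_num)) (by norm_num)
  have n5 := net_link_wall (hN := hN) (he 5 (by norm_num)) (by norm_num)
  have o1 := net_link_claw (hN := hN) (hcl 1 (by norm_num)) (by norm_num)
  have o2 := net_link_claw (hN := hN) (hcl 2 (by norm_num)) (by norm_num)
  have o3 := net_link_claw (hN := hN) (hcl 3 (by norm_num)) (by norm_num)
  -- In the cycle through claws 1, 2 and walls 2, 3, the remaining claw and wall 4 are connected off
  -- the cycle through walls 4, 5 and `v_6`. They lie on one side, which relates the rotations at
  -- the inhabitant and at `v_4`.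
  obtain ⟨c, hc⟩ := exists_sideFun hG σ (isEven_trace hG hrot (u := .house i 2)
    (l := [(.wall i 2, .house i 3), (.wall i 3, .house i 4), (.claw i 2, .inhabitant i),
      (.claw i 1, .house i 2)]) ⟨n2, n3, o2.symm, o1, rfl⟩)
  have m2 := hc.link o2
  have m3 := hc.link o3
  have l4 := hc.link n4
  have l5 := hc.link n5
  simp [trace] at m2 m3 l4 l5
  have kw := hc.three hG (incList_inhabitant hN π (t := 1) (by norm_num) hi) (by simp [trace])
    (by simp [trace])
  have k4 := hc.three hG (incList_four hN π 1 hi).rotate_three (by simp [trace]) (by simp [trace])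
  have k5 := hc.const_list hG (incList_five hN π 1 hi) (by simp [trace])
    (.wall i 4) (by simp) (.wall i 5) (by simp)
  have k6 := hc.const_list hG (incList_six hN π hi (Or.inl rfl)) (by simp [trace])
    (.wall i 5) (by simp) (.claw i 3) (by simp)
  have h7 : ∀ a : ZMod 2, a + 1 + 1 = a := by decide
  have hd := (incList_four hN π 1 hi).1
  have h4 : σ.nx (.house i 4) (.wall i 3) = .wall i 4 ↔ σ.nx (.house i 4) (.claw i 2) =
      .wall i 3 := by
    have h1 := nx_three hG (σ := σ) (incList_four hN π 1 hi)
    simp at hd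
    grind
  rw [kw.2, h4, k4.2]
  have h5 : c (.inhabitant i) (.claw i 1) = c (.house i 4) (.claw i 2) := by
    have h6 := kw.1
    rw [m2, h6]
    exact (h7 _).symm
  rw [h5, ← m3, ← k6, l5, ← k5, l4]

/-- The walk around the bounding cycle of the house `i + 1`. -/
def houseWalk (i : ℕ) : List (VillageEdge × VillageVertex) :=
  [(.wall (i + 1) 1, .house (i + 1) 2), (.wall (i + 1) 2, .house (i + 1) 3),
    (.wall (i + 1) 3, .house (i + 1) 4), (.wall (i + 1) 4, .house (i + 1) 5),
    (.wall (i + 1) 5, .house (i + 1) 6), (.wall (i + 1) 6, .rim (4 * i + 3)),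
    (.surface (4 * i + 2), .rim (4 * i + 2)), (.surface (4 * i + 1), .rim (4 * i + 1))]

theorem isEven_houseWalk (hN : N ≤ s) (π : Page N) (hi : i + 1 ≤ N) :
    IsEven (net hN π 1) (trace (houseWalk i)) := by
  have hG := net_good hN π 1 (by omega : 0 < s)
  have hrot := isRot_netList hN π 1 fun _ => true
  have he : ∀ k, 1 ≤ k ∧ k ≤ 6 → NetEdge s N π.mate 1 (.wall (i + 1) k) := fun k hk =>
    ⟨by omega, by omega⟩
  have n1 := net_link_wall_one (hN := hN) (he 1 (by norm_num))
  have n2 := net_link_wall (hN := hN) (he 2 (by norm_num)) (by norm_num)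
  have n3 := net_link_wall (hN := hN) (he 3 (by norm_num)) (by norm_num)
  have n4 := net_link_wall (hN := hN) (he 4 (by norm_num)) (by norm_num)
  have n5 := net_link_wall (hN := hN) (he 5 (by norm_num)) (by norm_num)
  have n6 := net_link_wall_six (hN := hN) (he 6 (by norm_num))
  have s1 := net_surface_prev (hN := hN) (π := π) (t := 1) (k := 4 * i + 2) (by omega)
  have s2 := net_surface_prev (hN := hN) (π := π) (t := 1) (k := 4 * i + 3) (by omega)
  rw [prevRim_add_one s (4 * i + 1) (by omega)] at s1
  rw [prevRim_add_one s (4 * i + 2) (by omega)] at s2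
  have e1 : 4 * (i + 1) - 3 = 4 * i + 1 := by omega
  have e2 : 4 * (i + 1) - 1 = 4 * i + 3 := by omega
  rw [e1] at n1
  rw [e2] at n6
  exact isEven_trace hG hrot (u := .rim (4 * i + 1)) ⟨n1, n2, n3, n4, n5, n6, s2.symm, s1.symm, rfl⟩

theorem trace_houseWalk_wall {k : ℕ} (hk : 1 ≤ k ∧ k ≤ 6) :
    trace (houseWalk i) (.wall (i + 1) k) = 1 := by
  obtain rfl | rfl | rfl | rfl | rfl | rfl : k = 1 ∨ k = 2 ∨ k = 3 ∨ k = 4 ∨ k = 5 ∨ k = 6 := by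
    omega
  all_goals simp [houseWalk, trace]

/-- The claw lies entirely on one side of the bounding cycle, so its edges leave `v_2`, `v_4`, `v_6`
towards the same side. -/
theorem nx_house (hi : 1 ≤ i ∧ i ≤ N) :
    (σ.nx (.house i 2) (.wall i 1) = .wall i 2 ↔ σ.nx (.house i 4) (.wall i 3) = .wall i 4) ∧
      (σ.nx (.house i 6) (.wall i 5) = .wall i 6 ↔
        σ.nx (.house i 4) (.wall i 3) = .wall i 4) := by
  have hG := net_good hN π 1 (by omega : 0 < s)
  obtain ⟨i, rfl⟩ : ∃ j, i = j + 1 := ⟨i - 1, by omega⟩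
  obtain ⟨c, hc⟩ := exists_sideFun hG σ (isEven_houseWalk hN π hi.2)
  obtain ⟨μ, ω, -, -, a2, a4, a6⟩ := hc.house hi (fun k hk => trace_houseWalk_wall hk)
    fun k => by simp [houseWalk, trace]
  exact ⟨a2.trans a4.symm, a6.trans a4.symm⟩

/-- All spokes lie on the same side of the equator, so degree-three rim vertices have the same
direction as rim vertex 2, which serves as the reference for the orientation of the planet. -/
theorem nx_rim_free (hs : 0 < s) {k : ℕ} (hk : 1 ≤ k ∧ k ≤ 4 * s)
    (h : k % 4 = 0 ∨ k % 4 = 2 ∨ N < k / 4 + 1) :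
    σ.nx (.rim k) (.surface (prevRim s k)) = .surface k ↔
      σ.nx (.rim 2) (.surface 1) = .surface 2 := by
  have hG := net_good hN π 1 hs
  obtain ⟨c, hc⟩ := exists_sideFun hG σ (isEven_equator hN π 1)
  obtain ⟨κ, l, hkl⟩ := hc.equator_const hs
  have hk2 : 1 ≤ 2 ∧ 2 ≤ 4 * s := by omega
  have h1 := hc.three hG (incList_rim hN π 1 hk h) rfl rfl
  have h2 := hc.three hG (incList_rim hN π 1 hk2 (by norm_num)) rfl rfl
  rw [(hkl k hk).1, (hkl k hk).2.2] at h1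
  rw [(hkl 2 hk2).1, (hkl 2 hk2).2.2] at h2
  exact h1.2.trans h2.2.symm

/-- Spoke and wall are separated by the equator, which leaves one rotation for each orientation of
the planet. -/
theorem nx_rim_left (hi : i + 1 ≤ N) :
    (σ.nx (.rim 2) (.surface 1) = .surface 2 ∧
      σ.nx (.rim (4 * i + 1)) (.spoke (4 * i + 1)) = .surface (prevRim s (4 * i + 1)) ∧
      σ.nx (.rim (4 * i + 1)) (.surface (prevRim s (4 * i + 1))) = .wall (i + 1) 1 ∧
      σ.nx (.rim (4 * i + 1)) (.wall (i + 1) 1) = .surface (4 * i + 1) ∧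
      σ.nx (.rim (4 * i + 1)) (.surface (4 * i + 1)) = .spoke (4 * i + 1)) ∨
    (σ.nx (.rim 2) (.surface 1) ≠ .surface 2 ∧
      σ.nx (.rim (4 * i + 1)) (.surface (prevRim s (4 * i + 1))) = .spoke (4 * i + 1) ∧
      σ.nx (.rim (4 * i + 1)) (.wall (i + 1) 1) = .surface (prevRim s (4 * i + 1)) ∧
      σ.nx (.rim (4 * i + 1)) (.surface (4 * i + 1)) = .wall (i + 1) 1 ∧
      σ.nx (.rim (4 * i + 1)) (.spoke (4 * i + 1)) = .surface (4 * i + 1)) := by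
  have hs : 0 < s := by omega
  have hG := net_good hN π 1 hs
  obtain ⟨c, hc⟩ := exists_sideFun hG σ (isEven_equator hN π 1)
  obtain ⟨κ, l, hkl⟩ := hc.equator_const hs
  have hk2 : 1 ≤ 2 ∧ 2 ≤ 4 * s := by omega
  have hk : 1 ≤ 4 * i + 1 ∧ 4 * i + 1 ≤ 4 * s := by omega
  have h2 := hc.three hG (incList_rim hN π 1 hk2 (by norm_num)) rfl rfl
  rw [(hkl 2 hk2).1, (hkl 2 hk2).2.2] at h2
  have h8 : ∀ a : ZMod 2, a ≠ a + 1 := by decide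
  rcases nx_four_of_side hc hG (incList_rim_left hN π (t := 1) (by norm_num) hi) rfl rfl rfl rfl
    (hc.equator_house hi) with h | h
  · rw [(hkl _ hk).1, (hkl _ hk).2.2] at h
    exact Or.inl ⟨h2.2.2 h.1, h.2⟩
  · rw [(hkl _ hk).1, (hkl _ hk).2.2] at h
    refine Or.inr ⟨fun h' => ?_, h.2⟩
    have h3 := h2.2.1 h'
    rw [h.1] at h3
    exact h8 _ h3.symm

/-- The house does not meet the equator between its ends, so its last wall is on the same side as
its first. -/
theorem nx_rim_right (hi : i + 1 ≤ N) :
    (σ.nx (.rim 2) (.surface 1) = .surface 2 ∧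
      σ.nx (.rim (4 * i + 3)) (.spoke (4 * i + 3)) = .surface (4 * i + 2) ∧
      σ.nx (.rim (4 * i + 3)) (.surface (4 * i + 2)) = .wall (i + 1) 6 ∧
      σ.nx (.rim (4 * i + 3)) (.wall (i + 1) 6) = .surface (4 * i + 3) ∧
      σ.nx (.rim (4 * i + 3)) (.surface (4 * i + 3)) = .spoke (4 * i + 3)) ∨
    (σ.nx (.rim 2) (.surface 1) ≠ .surface 2 ∧
      σ.nx (.rim (4 * i + 3)) (.surface (4 * i + 2)) = .spoke (4 * i + 3) ∧
      σ.nx (.rim (4 * i + 3)) (.wall (i + 1) 6) = .surface (4 * i + 2) ∧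
      σ.nx (.rim (4 * i + 3)) (.surface (4 * i + 3)) = .wall (i + 1) 6 ∧
      σ.nx (.rim (4 * i + 3)) (.spoke (4 * i + 3)) = .surface (4 * i + 3)) := by
  have hs : 0 < s := by omega
  have hG := net_good hN π 1 hs
  obtain ⟨c, hc⟩ := exists_sideFun hG σ (isEven_equator hN π 1)
  obtain ⟨κ, l, hkl⟩ := hc.equator_const hs
  have hk2 : 1 ≤ 2 ∧ 2 ≤ 4 * s := by omega
  have hk : 1 ≤ 4 * i + 3 ∧ 4 * i + 3 ≤ 4 * s := by omega
  have hk1 : 1 ≤ 4 * i + 1 ∧ 4 * i + 1 ≤ 4 * s := by omega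
  have h2 := hc.three hG (incList_rim hN π 1 hk2 (by norm_num)) rfl rfl
  rw [(hkl 2 hk2).1, (hkl 2 hk2).2.2] at h2
  have h8 : ∀ a : ZMod 2, a ≠ a + 1 := by decide
  have h9 := hc.house_const (i := i + 1) ⟨by omega, hi⟩ (fun _ => rfl) fun _ => rfl
  have e1 : 4 * (i + 1) - 3 = 4 * i + 1 := by omega
  have e2 : 4 * (i + 1) - 1 = 4 * i + 3 := by omega
  have e3 := prevRim_add_one s (4 * i + 2) (by omega)
  have h10 := hkl _ hk
  rw [e3] at h10
  rw [e1, e2, hc.equator_house hi, (hkl _ hk1).1, ← h10.1] at h9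
  rcases nx_four_of_side hc hG (incList_rim_right hN π (t := 1) (by norm_num) hi) rfl rfl rfl rfl
    h9.symm with h | h
  · rw [h10.1, h10.2.2] at h
    exact Or.inl ⟨h2.2.2 h.1, h.2⟩
  · rw [h10.1, h10.2.2] at h
    refine Or.inr ⟨fun h' => ?_, h.2⟩
    have h3 := h2.2.1 h'
    rw [h.1] at h3
    exact h8 _ h3.symm

/-- A village has, up to reflection, no other embeddings than those which are obtained by moving
the inhabitants. -/
theorem village_rigid (hs : 0 < s)
    (h0 : ∀ e, (net hN π 1).Inc e .centre → σ.nx .centre e = τ.nx .centre e)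
    (h1 : σ.nx (.rim 2) (.surface 1) = τ.nx (.rim 2) (.surface 1))
    (h2 : ∀ i, 1 ≤ i ∧ i ≤ N → σ.nx (.house i 4) (.wall i 3) = τ.nx (.house i 4) (.wall i 3))
    {x : VillageVertex} {e : VillageEdge} (he : (net hN π 1).Inc e x) :
    σ.nx x e = τ.nx x e := by
  have hG := net_good hN π 1 hs
  have hD : σ.nx (.rim 2) (.surface 1) = .surface 2 ↔ τ.nx (.rim 2) (.surface 1) = .surface 2 := by
    rw [h1]
  have hx : IsVillageVertex s (Set.Icc 1 N) x := he.vertex_mem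
  cases x with
  | centre => exact h0 e he
  | rim k =>
    by_cases hk : k % 4 = 0 ∨ k % 4 = 2 ∨ N < k / 4 + 1
    · exact nx_eq_of_three hG (incList_rim hN π 1 hx hk)
        (((nx_rim_free hs hx hk).trans hD).trans (nx_rim_free hs hx hk).symm) he
    · obtain ⟨i, rfl | rfl⟩ : ∃ i, k = 4 * i + 1 ∨ k = 4 * i + 3 := ⟨k / 4, by omega⟩
      · have hi : i + 1 ≤ N := by omega
        have he' := ((incList_rim_left hN π (t := 1) (by norm_num) hi).2 e).2 he
        simp only [List.mem_cons, List.not_mem_nil, or_false] at he'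
        have hσ := nx_rim_left (σ := σ) hi
        have hτ := nx_rim_left (σ := τ) hi
        grind
      · have hi : i + 1 ≤ N := by omega
        have he' := ((incList_rim_right hN π (t := 1) (by norm_num) hi).2 e).2 he
        simp only [List.mem_cons, List.not_mem_nil, or_false] at he'
        have hσ := nx_rim_right (σ := σ) hi
        have hτ := nx_rim_right (σ := τ) hi
        grind
  | house i k =>
    have hi : 1 ≤ i ∧ i ≤ N := hx.1.1
    have hk : 2 ≤ k ∧ k ≤ 6 := hx.2
    have hγ : σ.nx (.house i 4) (.wall i 3) = .wall i 4 ↔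
      τ.nx (.house i 4) (.wall i 3) = .wall i 4 := by rw [h2 i hi]
    have hσ := nx_house (σ := σ) hi
    have hτ := nx_house (σ := τ) hi
    obtain rfl | rfl | rfl | rfl | rfl : k = 2 ∨ k = 3 ∨ k = 4 ∨ k = 5 ∨ k = 6 := by omega
    · exact nx_eq_of_three hG (incList_two hN π hi (Or.inl rfl))
        ((hσ.1.trans hγ).trans hτ.1.symm) he
    · exact nx_eq_of_two hG (incList_three hN π 1 hi) he
    · exact nx_eq_of_three hG (incList_four hN π 1 hi) hγ he
    · exact nx_eq_of_two hG (incList_five hN π 1 hi) he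
    · exact nx_eq_of_three hG (incList_six hN π hi (Or.inl rfl)).rotate_three
        ((hσ.2.trans hγ).trans hτ.2.symm) he
  | inhabitant i =>
    have hi : 1 ≤ i ∧ i ≤ N := hx.1
    exact nx_eq_of_three hG (incList_inhabitant hN π (t := 1) (by norm_num) hi)
      (by rw [nx_inhabitant hi, nx_inhabitant hi, h2 i hi]) he

end

/-! ### The truth value of a house -/

section

variable {α : Type*} {β : Type*} {G : Graph α β} {σ : PlanarEmbedding G} {C : Set β}

/-- Both moves in the definition of `SameSide` preserve a side function supported on `C`; this is
the invariant for refuting `SameSide`. The edges are existential, since the definition allows any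
face at each vertex. -/
theorem PlanarEmbedding.SameSide.side_eq {z : β → ZMod 2} {c : α → β → ZMod 2}
    (hc : SideFun σ z c) (hz : ∀ e ∉ C, z e = 0) {x y : α} (h : σ.SameSide C x y) :
    ∃ e f, G.Inc e x ∧ G.Inc f y ∧ c x e = c y f := by
  obtain ⟨d, d', rfl, rfl, h⟩ := h
  refine ⟨d.edge, d'.edge, d.inc, d'.inc, ?_⟩
  have h7 : ∀ a b : ZMod 2, a + b + b = a := by decide
  induction h with
  | rel a b h =>
    have h1 := hc.link a.isLink
    rcases h with rfl | ⟨ha, rfl⟩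
    · have h2 : facePerm σ.next a = σ.next a.rev := rfl
      rw [h2, ← σ.nx_dart, vertex_next σ.isCycleOn, hc.nx a.rev.inc]
      have h3 : a.rev.edge = a.edge := rfl
      rw [h3, h1, h7]
    · have h3 : a.rev.edge = a.edge := rfl
      rw [h3, h1, hz _ ha, add_zero]
  | refl => rfl
  | symm _ _ _ ih => exact ih.symm
  | trans _ _ _ _ _ ih1 ih2 => exact ih1.trans ih2

/-- The darts at `x` along `e` and at `y` along `f` are on the same side of the cycle `C`. -/
def SideConn (σ : PlanarEmbedding G) (C : Set β) (x : α) (e : β) (y : α) (f : β) : Prop :=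
  ∃ d d' : Dart G, d.vertex = x ∧ d.edge = e ∧ d'.vertex = y ∧ d'.edge = f ∧
    Relation.EqvGen (fun a b => b = facePerm σ.next a ∨ (a.edge ∉ C ∧ b = a.rev)) d d'

theorem SideConn.sameSide {x y : α} {e f : β} (h : SideConn σ C x e y f) : σ.SameSide C x y := by
  obtain ⟨d, d', h1, -, h2, -, h⟩ := h
  exact ⟨d, d', h1, h2, h⟩

theorem SideConn.trans {x y z : α} {e f g : β} (h : SideConn σ C x e y f)
    (h' : SideConn σ C y f z g) : SideConn σ C x e z g := by
  obtain ⟨d1, d2, h1, h2, h3, h4, h⟩ := h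
  obtain ⟨d3, d4, h5, h6, h7, h8, h'⟩ := h'
  obtain rfl : d2 = d3 := Dart.ext' (h3.trans h5.symm) (h4.trans h6.symm)
  exact ⟨d1, d4, h1, h2, h7, h8, h.trans _ _ _ h'⟩

theorem SideConn.link {x y : α} {e : β} (h : G.IsLink e x y) (he : e ∉ C) :
    SideConn σ C x e y e :=
  ⟨mkDart h.inc_left, (mkDart h.inc_left).rev, rfl, rfl,
    (Dart.isLink (mkDart h.inc_left)).right_unique h, rfl, .rel _ _ (Or.inr ⟨he, rfl⟩)⟩

theorem SideConn.pass {x y : α} {e f : β} (h : G.IsLink e x y) (hf : σ.nx x e = f) :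
    SideConn σ C y e x f := by
  refine ⟨(mkDart h.inc_left).rev, σ.next (mkDart h.inc_left),
    (Dart.isLink (mkDart h.inc_left)).right_unique h, rfl, vertex_next σ.isCycleOn _, ?_,
    .rel _ _ (Or.inl ?_)⟩
  · rw [← σ.nx_dart]
    exact hf
  · show _ = σ.next (mkDart h.inc_left).rev.rev
    rw [Dart.rev_rev]

theorem SideConn.turn {x : α} {e f : β} (h : G.Inc e x) (he : e ∉ C) (hf : σ.nx x e = f) :
    SideConn σ C x e x f := by
  obtain ⟨y, hy⟩ := h
  exact (SideConn.link hy he).trans (SideConn.pass hy hf)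

end

section

variable {s N : ℕ} {hN : N ≤ s} {π : Page N} {i : ℕ} {σ τ : PlanarEmbedding (net hN π 1)}

theorem trace_houseWalk_of_notMem {e : VillageEdge} (he : e ∉ boundingCycle (i + 1)) :
    trace (houseWalk i) e = 0 := by
  have e1 : 4 * (i + 1) - 3 = 4 * i + 1 := by omega
  have e2 : 4 * (i + 1) - 2 = 4 * i + 2 := by omega
  have h1 : ∀ k, 1 ≤ k ∧ k ≤ 6 → e ≠ .wall (i + 1) k := fun k hk h =>
    he (Or.inl ⟨k, hk, h⟩)
  have h2 : e ≠ .surface (4 * i + 1) := fun h => he (Or.inr (Or.inl (e1 ▸ h)))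
  have h3 : e ≠ .surface (4 * i + 2) := fun h => he (Or.inr (Or.inr (e2 ▸ h)))
  simp [houseWalk, trace, h1, h2, h3]

/-- The inhabitant is outside if and only if the rotations of its house and of the planet have
different directions. -/
theorem sameSide_iff (hi : i + 1 ≤ N) :
    σ.SameSide (boundingCycle (i + 1)) (.inhabitant (i + 1)) .centre ↔
      ¬ (σ.nx (.house (i + 1) 4) (.wall (i + 1) 3) = .wall (i + 1) 4 ↔
        σ.nx (.rim 2) (.surface 1) = .surface 2) := by
  have hs : 0 < s := by omega
  have hG := net_good hN π 1 hs
  have hi' : 1 ≤ i + 1 ∧ i + 1 ≤ N := by omega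
  have hb : 1 ≤ 4 * i + 1 ∧ 4 * i + 1 ≤ 4 * s := by omega
  have hb' : 1 ≤ 4 * i + 3 ∧ 4 * i + 3 ≤ 4 * s := by omega
  have he : ∀ k, 1 ≤ k ∧ k ≤ 6 → NetEdge s N π.mate 1 (.wall (i + 1) k) := fun k hk =>
    ⟨hi', by omega⟩
  have hcl : ∀ k, 1 ≤ k ∧ k ≤ 3 → NetEdge s N π.mate 1 (.claw (i + 1) k) := fun k hk =>
    ⟨hi', by omega⟩
  have n1 := net_link_wall_one (hN := hN) (he 1 (by norm_num))
  have n2 := net_link_wall (hN := hN) (he 2 (by norm_num)) (by norm_num)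
  have n3 := net_link_wall (hN := hN) (he 3 (by norm_num)) (by norm_num)
  have n4 := net_link_wall (hN := hN) (he 4 (by norm_num)) (by norm_num)
  have n5 := net_link_wall (hN := hN) (he 5 (by norm_num)) (by norm_num)
  have n6 := net_link_wall_six (hN := hN) (he 6 (by norm_num))
  have o2 := net_link_claw (hN := hN) (hcl 2 (by norm_num)) (by norm_num)
  have e1 : 4 * (i + 1) - 3 = 4 * i + 1 := by omega
  have e2 : 4 * (i + 1) - 1 = 4 * i + 3 := by omega
  have e3 : 4 * (i + 1) - 2 = 4 * i + 2 := by omega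
  rw [e1] at n1
  rw [e2] at n6
  have hl2 := incList_two hN π hi' (t := 1) (Or.inl rfl)
  have hl3 := incList_three hN π 1 hi'
  have hl4 := incList_four hN π 1 hi'
  have hl5 := incList_five hN π 1 hi'
  have hl6 := (incList_six hN π hi' (t := 1) (Or.inl rfl)).rotate_three
  have hcC : ∀ k, .claw (i + 1) k ∉ boundingCycle (i + 1) := fun k => by simp [boundingCycle]
  constructor
  -- The colouring for the bounding cycle gives the inhabitant and the centre equal colours. At the
  -- left end of the house, colours and known rotation then make the directions of house and planet
  -- opposite.
  · intro h h'
    obtain ⟨c, hc⟩ := exists_sideFun hG σ (isEven_houseWalk hN π hi)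
    obtain ⟨μ, ω, h2, hw, -, h4, -⟩ := hc.house hi' (fun k hk => trace_houseWalk_wall hk)
      fun k => by simp [houseWalk, trace]
    obtain ⟨e, f, hex, hfy, hef⟩ := h.side_eq hc fun e he => trace_houseWalk_of_notMem he
    have hex' := ((incList_inhabitant hN π (t := 1) (by norm_num) hi').2 e).2 hex
    have h5 : c (.inhabitant (i + 1)) e = ω := by
      simp only [List.mem_cons, List.not_mem_nil, or_false] at hex'
      rcases hex' with rfl | rfl | rfl
      exacts [hw 1 (by norm_num), hw 2 (by norm_num), hw 3 (by norm_num)]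
    have h6 : c .centre f = c .centre (.spoke (4 * i + 1)) := by
      refine hc.const hG (fun e he => ?_) (net_spoke hb).inc_left hfy
      cases e with
      | spoke k => simp [houseWalk, trace]
      | surface k =>
        have := (net_inc_iff.1 he).2
        simp [netEnds] at this
      | wall j k =>
        have := (net_inc_iff.1 he).2
        simp only [netEnds, houseVertex] at this
        split_ifs at this <;> simp at this
      | claw j k => simp [houseWalk, trace]
    have h7 := hc.link (net_spoke (hN := hN) (π := π) (t := 1) hb)
    have h8 := hc.link n1
    rw [h5, h6] at hef
    rw [trace_houseWalk_wall (by norm_num), h2] at h8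
    have z1 : trace (houseWalk i) (.spoke (4 * i + 1)) = 0 := by simp [houseWalk, trace]
    have z2 : trace (houseWalk i) (.surface (prevRim s (4 * i + 1))) = 0 := by
      have h9 : prevRim s (4 * i + 1) ≠ 4 * i + 1 ∧ prevRim s (4 * i + 1) ≠ 4 * i + 2 := by
        unfold prevRim
        split_ifs <;> omega
      simp [houseWalk, trace, h9]
    have z3 : trace (houseWalk i) (.wall (i + 1) 1) = 1 := trace_houseWalk_wall (by norm_num)
    rw [z1, add_zero, ← hef] at h7
    have hl := incList_rim_left hN π (t := 1) (by norm_num) hi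
    have y1 := hc.nx ((hl.2 (.surface (prevRim s (4 * i + 1)))).1 (by simp))
    have y2 := hc.nx ((hl.2 (.wall (i + 1) 1)).1 (by simp))
    have y3 := hc.nx ((hl.2 (.spoke (4 * i + 1))).1 (by simp))
    rw [z2] at y1
    rw [z3] at y2
    rw [z1] at y3
    have h9 : ∀ a b : ZMod 2, (a = b) ↔ ¬ (a = b + 1) := by decide
    have h10 : ∀ a : ZMod 2, a + 1 + 1 = a := by decide
    rw [h4] at h'
    rcases nx_rim_left (σ := σ) hi with h | h
    · have := h'.2 h.1
      grind
    · have := mt h'.1 h.1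
      grind
  -- An explicit passage from the inhabitant along the outer side of the house to the centre: over
  -- its left end if the rotation at `v_4` takes `wall 3` to `wall 4`, and over its right end
  -- otherwise.
  · intro h
    have start := (SideConn.link (σ := σ) o2 (hcC 2))
    have h23 := nx_two (σ := σ) hG (show IncList (net hN π 1) (.house (i + 1) 3)
      [.wall (i + 1) 3, .wall (i + 1) 2] from ⟨by simp, fun e => by rw [← hl3.2 e]; simp [or_comm]⟩)
    have h45 := nx_two (σ := σ) hG hl5
    have hh := nx_house (σ := σ) hi'
    have t2 := nx_three (σ := σ) hG hl2
    have t4 := nx_three (σ := σ) hG hl4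
    have t6 := nx_three (σ := σ) hG hl6
    by_cases hγ : σ.nx (.house (i + 1) 4) (.wall (i + 1) 3) = .wall (i + 1) 4
    · have hD : σ.nx (.rim 2) (.surface 1) ≠ .surface 2 := fun hD => h ⟨fun _ => hD, fun _ => hγ⟩
      have r := (nx_rim_left (σ := σ) hi).resolve_left fun h => hD h.1
      have q4 : σ.nx (.house (i + 1) 4) (.claw (i + 1) 2) = .wall (i + 1) 3 := by
        simp [hγ] at t4
        exact t4.2
      have q2 : σ.nx (.house (i + 1) 2) (.wall (i + 1) 2) = .claw (i + 1) 1 ∧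
          σ.nx (.house (i + 1) 2) (.claw (i + 1) 1) = .wall (i + 1) 1 := by
        simp [hh.1.2 hγ] at t2
        exact t2
      have hp : .surface (prevRim s (4 * i + 1)) ∉ boundingCycle (i + 1) := by
        have h9 : prevRim s (4 * i + 1) ≠ 4 * i + 1 ∧ prevRim s (4 * i + 1) ≠ 4 * i + 2 := by
          unfold prevRim
          split_ifs <;> omega
        simp [boundingCycle, e1, e3, h9]
      exact ((((((((start.trans (.turn ((hl4.2 _).1 (by simp)) (hcC 2) q4)).trans
        (.pass n3 h23)).trans (.pass n2 q2.1)).trans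
        (.turn ((hl2.2 _).1 (by simp)) (hcC 1) q2.2)).trans (.pass n1 r.2.2.1)).trans
        (.turn (net_surface_prev hb).inc_right hp r.2.1)).trans
        (.link (net_spoke hb).symm (by simp [boundingCycle])))).sameSide
    · have hD : σ.nx (.rim 2) (.surface 1) = .surface 2 := by
        by_contra hD
        exact h ⟨fun h => absurd h hγ, fun h => absurd h hD⟩
      have r := (nx_rim_right (σ := σ) hi).resolve_right fun h => h.1 hD
      have q4 : σ.nx (.house (i + 1) 4) (.claw (i + 1) 2) = .wall (i + 1) 4 := by
        simp [hγ] at t4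
        exact t4.2.1
      have q6 : σ.nx (.house (i + 1) 6) (.wall (i + 1) 5) = .claw (i + 1) 3 ∧
          σ.nx (.house (i + 1) 6) (.claw (i + 1) 3) = .wall (i + 1) 6 := by
        simp [mt hh.2.1 hγ] at t6
        exact ⟨t6.1, t6.2.1⟩
      have hp : .surface (4 * i + 3) ∉ boundingCycle (i + 1) := by
        simp [boundingCycle, e1, e3]
      exact ((((((((start.trans (.turn ((hl4.2 _).1 (by simp)) (hcC 2) q4)).trans
        (.pass n4.symm h45)).trans (.pass n5.symm q6.1)).trans
        (.turn ((hl6.2 _).1 (by simp)) (hcC 3) q6.2)).trans (.pass n6.symm r.2.2.2.1)).trans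
        (.turn (net_surface_inc hb') hp r.2.2.2.2)).trans
        (.link (net_spoke hb').symm (by simp [boundingCycle])))).sameSide

end

/-! ### Linked inhabitants are on the same side -/

section

variable {s N : ℕ} {hN : N ≤ s} {π : Page N} {i : ℕ} {σ : PlanarEmbedding (net hN π 4)}

/-- The edge between the inhabitants closes a cycle through the middle of the arch. The two feet of
the arch are connected through the planet off this cycle, so they lie on the same side of it. This
ties together the rotations at both vertices `v_4`. -/
theorem nx_linked (hi : 1 ≤ i ∧ i ≤ N) (h : i < π.mate i) :
    σ.nx (.house i 4) (.wall i 3) = .wall i 4 ↔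
      σ.nx (.house (π.mate i) 4) (.wall (π.mate i) 3) = .wall (π.mate i) 4 := by
  have hs : 0 < s := by omega
  have hG := net_good hN π 4 hs
  have hrot := isRot_netList hN π 4 fun _ => true
  have hinv := π.invol i
  have hi' : 1 ≤ π.mate i ∧ π.mate i ≤ N := π.mem hi
  have lm := incList_two_link hN π (t := 4) (by norm_num) hi h
  have lk6 := incList_six hN π (t := 4) hi' (Or.inr (by rwa [hinv]))
  have lk3 := incList_three hN π 4 hi'
  have lk4 := incList_four hN π 4 hi'
  have lk5 := incList_five hN π 4 hi'
  have li2 := incList_two hN π (t := 4) hi (Or.inr h)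
  have li3 := incList_three hN π 4 hi
  have li4 := incList_four hN π 4 hi
  have li5 := incList_five hN π 4 hi
  have li6 := incList_six_link hN π (t := 4) (by norm_num) hi h
  have ei : ∀ k, 2 ≤ k ∧ k ≤ 5 → NetEdge s N π.mate 4 (.wall i k) := fun k hk => ⟨hi, by omega⟩
  have ek : ∀ k, 2 ≤ k ∧ k ≤ 5 → NetEdge s N π.mate 4 (.wall (π.mate i) k) :=
    fun k hk => ⟨hi', by omega⟩
  have ei1 : NetEdge s N π.mate 4 (.wall i 1) := ⟨hi, by omega⟩
  have ek6 : NetEdge s N π.mate 4 (.wall (π.mate i) 6) := ⟨hi', by omega⟩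
  have ei7 : NetEdge s N π.mate 4 (.wall i 7) := ⟨hi, by omega⟩
  have ec : NetEdge s N π.mate 4 (.claw i 4) := ⟨hi, by omega⟩
  have ei2 : NetEdge s N π.mate 4 (.claw i 2) := ⟨hi, by omega⟩
  have ek2 : NetEdge s N π.mate 4 (.claw (π.mate i) 2) := ⟨hi', by omega⟩
  have b1 : 1 ≤ 4 * i - 3 ∧ 4 * i - 3 ≤ 4 * s := by omega
  have b2 : 1 ≤ 4 * π.mate i - 1 ∧ 4 * π.mate i - 1 ≤ 4 * s := by omega
  have d4 := net_link_wall (hN := hN) (ei 4 (by norm_num)) (by norm_num)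
  have d5 := net_link_wall (hN := hN) (ei 5 (by norm_num)) (by norm_num)
  have d7 := net_link_wall_seven (hN := hN) ei7
  have d2 := net_link_wall (hN := hN) (ek 2 (by norm_num)) (by norm_num)
  have d3 := net_link_wall (hN := hN) (ek 3 (by norm_num)) (by norm_num)
  have dk := net_link_claw (hN := hN) ek2 (by norm_num)
  have dc := net_link_claw_four (hN := hN) ec
  have di := net_link_claw (hN := hN) ei2 (by norm_num)
  have f1 := net_link_wall_one (hN := hN) ei1
  have f2 := net_link_wall (hN := hN) (ei 2 (by norm_num)) (by norm_num)
  have f3 := net_link_wall (hN := hN) (ei 3 (by norm_num)) (by norm_num)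
  have g6 := net_link_wall_six (hN := hN) ek6
  have g5 := net_link_wall (hN := hN) (ek 5 (by norm_num)) (by norm_num)
  have g4 := net_link_wall (hN := hN) (ek 4 (by norm_num)) (by norm_num)
  have s1 := net_spoke (hN := hN) (π := π) (t := 4) b1
  have s2 := net_spoke (hN := hN) (π := π) (t := 4) b2
  -- From `v_4` of the left house over the link to `v_4` of the right house, and back through the
  -- two inhabitants.
  have hev := isEven_trace hG hrot (u := .house i 4) (l := [(.wall i 4, .house i 5),
    (.wall i 5, .house i 6), (.wall i 7, .house (π.mate i) 2),
    (.wall (π.mate i) 2, .house (π.mate i) 3), (.wall (π.mate i) 3, .house (π.mate i) 4),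
    (.claw (π.mate i) 2, .inhabitant (π.mate i)), (.claw i 4, .inhabitant i),
    (.claw i 2, .house i 4)]) ⟨d4, d5, d7, d2, d3, dk.symm, dc.symm, di, rfl⟩
  obtain ⟨c, hc⟩ := exists_sideFun hG σ hev
  generalize π.mate i = k at *
  have hik : i ≠ k := h.ne
  have hki : k ≠ i := h.ne'
  have rimc : ∀ j, ∀ e, (net hN π 4).Inc e (.rim j) → trace [(VillageEdge.wall i 4,
      VillageVertex.house i 5), (.wall i 5, .house i 6), (.wall i 7, .house k 2),
      (.wall k 2, .house k 3), (.wall k 3, .house k 4), (.claw k 2, .inhabitant k),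
      (.claw i 4, .inhabitant i), (.claw i 2, .house i 4)] e = 0 := by
    intro j e he
    have he' := (net_inc_iff.1 he).2
    cases e with
    | spoke k => simp [trace]
    | surface k => simp [trace]
    | wall a b =>
      have hb : b = 1 ∨ b = 6 := by
        have he0 := (net_inc_iff.1 he).1.2
        simp only [netEnds, houseVertex] at he'
        split_ifs at he' <;> simp at he' <;> omega
      rcases hb with rfl | rfl <;> simp [trace]
    | claw a b =>
      simp only [netEnds] at he'
      split_ifs at he' <;> simp at he'
  have cenc : ∀ e, (net hN π 4).Inc e .centre → trace [(VillageEdge.wall i 4,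
      VillageVertex.house i 5), (.wall i 5, .house i 6), (.wall i 7, .house k 2),
      (.wall k 2, .house k 3), (.wall k 3, .house k 4), (.claw k 2, .inhabitant k),
      (.claw i 4, .inhabitant i), (.claw i 2, .house i 4)] e = 0 := by
    intro e he
    have he' := (net_inc_iff.1 he).2
    cases e with
    | spoke k => simp [trace]
    | surface k => simp [trace]
    | wall a b =>
      simp only [netEnds, houseVertex] at he'
      split_ifs at he' <;> simp at he'
    | claw a b =>
      simp only [netEnds] at he'
      split_ifs at he' <;> simp at he'
  have r1 := hc.const hG (rimc _) f1.inc_left s1.inc_right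
  have r2 := hc.const hG (rimc _) g6.inc_right s2.inc_right
  have r3 := hc.const hG cenc s1.inc_left s2.inc_left
  have t2 := hc.const_list hG li2 (by simp [trace, hik]) (.wall i 1) (by simp) (.wall i 2) (by simp)
  have t3 := hc.const_list hG li3 (by simp [trace, hik]) (.wall i 2) (by simp) (.wall i 3) (by simp)
  have t6 := hc.const_list hG lk6 (by simp [trace, hki]) (.wall k 6) (by simp) (.wall k 5) (by simp)
  have t5 := hc.const_list hG lk5 (by simp [trace, hki]) (.wall k 5) (by simp) (.wall k 4) (by simp)
  have u4 := hc.three hG li4.rotate_three.rotate_three (by simp [trace]) (by simp [trace, hik])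
  have v4 := hc.three hG lk4.rotate_three (by simp [trace, hki]) (by simp [trace, hki])
  have p5 := hc.pair_list hG li5 (p := .wall i 4) (q := .wall i 5) (by simp) (by simp) (by simp)
    (by simp [trace]) (by simp)
  have p6 := hc.pair_list hG li6 (p := .wall i 5) (q := .wall i 7) (by simp) (by simp) (by simp)
    (by simp [trace]) (by simp [trace])
  have p2 := hc.pair_list hG lm (p := .wall i 7) (q := .wall k 2) (by simp) (by simp) (by simp)
    (by simp [trace]) (by simp [trace, hki])
  have p3 := hc.pair_list hG lk3 (p := .wall k 2) (q := .wall k 3) (by simp) (by simp) (by simp)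
    (by simp [trace]) (by simp)
  have p4 := hc.pair_list hG lk4 (p := .wall k 3) (q := .claw k 2) (by simp) (by simp) (by simp)
    (by simp [trace]) (by simp [trace, hki])
  have l4 := hc.link d4
  have l5 := hc.link d5
  have l7 := hc.link d7
  have l2 := hc.link d2
  have l3 := hc.link d3
  have m1 := hc.link f1
  have m2 := hc.link f2
  have m3 := hc.link f3
  have m6 := hc.link g6
  have m5 := hc.link g5
  have m4 := hc.link g4
  have ms1 := hc.link s1
  have ms2 := hc.link s2
  clear rimc cenc hev
  simp [trace, hik, hki] at l4 l5 l7 l2 l3 m1 m2 m3 m6 m5 m4 ms1 ms2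
  have h10 : ∀ a : ZMod 2, a + 1 + 1 = a := by decide
  -- The connection off the cycle: down the left foot of the arch, through the centre of the planet
  -- and up the right foot.
  have key1 : c (.house i 4) (.wall i 3) = c (.house k 4) (.wall k 4) := by
    rw [m3, ← t3, m2, ← t2, m1, ← r1, ms1, ← r3, ← ms2, r2, m6, t6, m5, t5, m4]
  -- Following the cycle itself along one of its sides.
  have key2 : c (.house k 4) (.claw k 2) = c (.house i 4) (.wall i 4) := by
    simp only [p4, l3, p3, l2, p2, l7, p6, l5, p5, l4, h10]
  have x1 : σ.nx (.house i 4) (.wall i 3) = .wall i 4 ↔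
      σ.nx (.house i 4) (.wall i 4) = .claw i 2 := by
    have h1 := nx_three hG (σ := σ) li4
    have hd := li4.1
    simp at hd
    grind
  have x2 : σ.nx (.house k 4) (.wall k 3) = .wall k 4 ↔
      σ.nx (.house k 4) (.claw k 2) = .wall k 3 := by
    have h1 := nx_three hG (σ := σ) lk4
    have hd := lk4.1
    simp at hd
    grind
  rw [x1, x2, u4.2, v4.2, key1, key2]

end

/-! ### The sequence of nets -/

/-- The data of a net on a planet of equator `s`. -/
structure Stage (s : ℕ) where
  size : ℕ
  size_le : size ≤ s
  page : Page size
  level : ℕ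

/-- The net of a stage. -/
def Stage.graph {s : ℕ} (S : Stage s) : Graph VillageVertex VillageEdge :=
  net S.size_le S.page S.level

/-- Pairs of stages whose nets are subgraphs of each other. -/
inductive Stage.Sub {s : ℕ} : Stage s → Stage s → Prop
  | one {N N' : ℕ} (hN : N ≤ s) (hN' : N' ≤ s) (π : Page N) (π' : Page N') {t : ℕ} (h : N' ≤ N)
      (ht : t = 1 ∨ t = 2) : Stage.Sub ⟨N', hN', π', 1⟩ ⟨N, hN, π, t⟩
  | two {N : ℕ} (hN : N ≤ s) (π : Page N) : Stage.Sub ⟨N, hN, π, 3⟩ ⟨N, hN, π, 2⟩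
  | four {N : ℕ} (hN : N ≤ s) (π : Page N) : Stage.Sub ⟨N, hN, π, 3⟩ ⟨N, hN, π, 4⟩

section

variable {s N m : ℕ}

theorem Stage.Sub.le {S T : Stage s} (h : S.Sub T) : S.graph ≤ T.graph := by
  cases h with
  | one hN hN' π π' h ht => exact net_one_le hN hN' π π' h ht
  | two hN π => exact net_three_le_two
  | four hN π => exact net_three_le_four

/-- The embedding of a stage. -/
noncomputable def Stage.emb (S : Stage s) (hs : 0 < s) (ht : 1 ≤ S.level ∧ S.level ≤ 4)
    {g : ℕ → Bool} (hg : ∀ i, g (S.page.mate i) = g i) : PlanarEmbedding S.graph :=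
  netEmb S.size_le S.page hs ht hg

theorem Stage.Sub.induced {S T : Stage s} (h : S.Sub T) (hs : 0 < s)
    (hS : 1 ≤ S.level ∧ S.level ≤ 4) (hT : 1 ≤ T.level ∧ T.level ≤ 4) {g : ℕ → Bool}
    (hgS : ∀ i, g (S.page.mate i) = g i) (hgT : ∀ i, g (T.page.mate i) = g i) :
    InducedOn h.le (T.emb hs hT hgT) (S.emb hs hS hgS) := by
  cases h with
  | one hN hN' π π' h ht => exact netEmb_one_induced hs h ht hT hS hgT hgS
  | two hN π => exact netEmb_induced hs hT hS hgT net_three_le_two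
  | four hN π => exact netEmb_induced hs hT hS hgT net_three_le_four

/-- The stages of the sequence: the inhabitants of the houses that are paired by `A`, `B` or `C` are
linked one page after the other. -/
def stages (hm : m ≤ s) (hN : N ≤ s) (A B C : Page N) : ℕ → Stage s
  | 0 => ⟨m, hm, Page.id m, 1⟩
  | 1 => ⟨N, hN, A, 1⟩
  | 2 => ⟨N, hN, A, 2⟩
  | 3 => ⟨N, hN, A, 3⟩
  | 4 => ⟨N, hN, A, 4⟩
  | 5 => ⟨N, hN, A, 3⟩
  | 6 => ⟨N, hN, A, 2⟩
  -- The net of stage 1 is the same for all pages and is a subgraph of both neighbours, so the page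
  -- can be changed here.
  | 7 => ⟨N, hN, B, 1⟩
  | 8 => ⟨N, hN, B, 2⟩
  | 9 => ⟨N, hN, B, 3⟩
  | 10 => ⟨N, hN, B, 4⟩
  | 11 => ⟨N, hN, B, 3⟩
  | 12 => ⟨N, hN, B, 2⟩
  | 13 => ⟨N, hN, C, 1⟩
  | 14 => ⟨N, hN, C, 2⟩
  | 15 => ⟨N, hN, C, 3⟩
  | 16 => ⟨N, hN, C, 4⟩
  | 17 => ⟨N, hN, C, 3⟩
  | 18 => ⟨N, hN, C, 2⟩
  | 19 => ⟨N, hN, C, 1⟩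
  | _ => ⟨m, hm, Page.id m, 1⟩

variable (hm : m ≤ s) (hN : N ≤ s) (A B C : Page N)

theorem stages_sub (hmN : m ≤ N) {n : ℕ} (hn : n < 20) :
    (stages hm hN A B C n).Sub (stages hm hN A B C (n + 1)) ∨
      (stages hm hN A B C (n + 1)).Sub (stages hm hN A B C n) := by
  have two := fun π : Page N => Stage.Sub.two hN π
  have four := fun π : Page N => Stage.Sub.four hN π
  have one := fun π π' : Page N => Stage.Sub.one hN hN π π' (t := 2) le_rfl (Or.inr rfl)
  have zero := fun π : Page N => Stage.Sub.one hN hm π (Page.id m) (t := 1) hmN (Or.inl rfl)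
  interval_cases n <;> first
    | exact Or.inl (zero _)
    | exact Or.inr (zero _)
    | exact Or.inl (one _ _)
    | exact Or.inr (one _ _)
    | exact Or.inl (two _)
    | exact Or.inr (two _)
    | exact Or.inl (four _)
    | exact Or.inr (four _)

theorem stages_prop (p : Stage s → Prop) (h0 : p ⟨m, hm, Page.id m, 1⟩)
    (h : ∀ (π : Page N) t, π = A ∨ π = B ∨ π = C → 1 ≤ t ∧ t ≤ 4 → p ⟨N, hN, π, t⟩) (n : ℕ) :
    p (stages hm hN A B C n) := by
  unfold stages
  split <;> first | exact h0 | exact h _ _ (by simp) (by norm_num)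

theorem stages_size {n : ℕ} (h1 : 1 ≤ n) (h2 : n ≤ 19) : (stages hm hN A B C n).size = N := by
  interval_cases n <;> rfl

theorem stages_size_ge (hmN : m ≤ N) (n : ℕ) : m ≤ (stages hm hN A B C n).size :=
  stages_prop hm hN A B C (fun S => m ≤ S.size) le_rfl (fun _ _ _ _ => hmN) n

theorem stages_size_le (hmN : m ≤ N) (n : ℕ) : (stages hm hN A B C n).size ≤ N :=
  stages_prop hm hN A B C (fun S => S.size ≤ N) hmN (fun _ _ _ _ => le_rfl) n

theorem stages_level (n : ℕ) :
    1 ≤ (stages hm hN A B C n).level ∧ (stages hm hN A B C n).level ≤ 4 :=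
  stages_prop hm hN A B C (fun S => 1 ≤ S.level ∧ S.level ≤ 4) (by norm_num) (fun _ _ _ h => h) n

theorem stages_page {g : ℕ → Bool} (hA : ∀ i, g (A.mate i) = g i) (hB : ∀ i, g (B.mate i) = g i)
    (hC : ∀ i, g (C.mate i) = g i) (n : ℕ) (i : ℕ) :
    g ((stages hm hN A B C n).page.mate i) = g i :=
  stages_prop hm hN A B C (fun S => ∀ i, g (S.page.mate i) = g i) (fun _ => rfl)
    (fun π t h _ => by rcases h with rfl | rfl | rfl <;> assumption) n i

/-- The sequence of nets. -/
def netSequence (hmN : m ≤ N) :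
    HybridDeletionSequence VillageVertex VillageEdge where
  steps := 20
  graph i := (stages hm hN A B C i).graph
  strict := Set.univ
  finite_vertexSet i := (net_finite_vertexSet _ _ _).1
  finite_edgeSet i := (net_finite_edgeSet _ _ _).1
  simple i := net_simple _ _ _
  step i := by
    rcases stages_sub hm hN A B C hmN i.2 with h | h
    · exact Or.inl (isHybridSubgraph_of_le _ h.le)
    · exact Or.inr (isHybridSubgraph_of_le _ h.le)

variable (hmN : m ≤ N)

theorem netSequence_compatible (i : Fin 20) :
    ((netSequence hm hN A B C hmN).graph i.castSucc).Compatible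
      ((netSequence hm hN A B C hmN).graph i.succ) := by
  rcases stages_sub hm hN A B C hmN i.2 with h | h
  · exact h.le.compatible
  · exact h.le.compatible.symm

theorem netSequence_sparse (hs : 0 < s) (i : Fin 21) : Sparse ((netSequence hm hN A B C hmN).graph i) :=
  net_sparse (stages hm hN A B C i).size_le _ _ hs

variable {hm hN A B C hmN}

/-- The embedding of the graph `n` in a simultaneous embedding. -/
def embAt (Φ : SimultaneousEmbedding (netSequence hm hN A B C hmN)) (n : ℕ) (hn : n < 21) :
    PlanarEmbedding (stages hm hN A B C n).graph := Φ.emb ⟨n, hn⟩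

theorem nx_eq_of_inc (hs : 0 < s) (Φ : SimultaneousEmbedding (netSequence hm hN A B C hmN))
    {x : VillageVertex} {p : VillageEdge → Prop} {a b : ℕ} (hab : a ≤ b) (hb : b < 21)
    (h : ∀ n, a ≤ n → n ≤ b → ∀ e, (stages hm hN A B C n).graph.Inc e x ↔ p e) {e : VillageEdge}
    (he : p e) : (embAt Φ b hb).nx x e = (embAt Φ a (hab.trans_lt hb)).nx x e := by
  induction b, hab using Nat.le_induction with
  | base => rfl
  | succ b hab ih =>
    rw [← ih (by omega) fun n h1 h2 => h n h1 (by omega)]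
    have hb' : b < 20 := by omega
    exact (Φ.nx_eq rfl (netSequence_sparse hm hN A B C hmN hs)
      (netSequence_compatible hm hN A B C hmN) ⟨b, hb'⟩
      (fun e => (h b hab (by omega) e).trans (h (b + 1) (by omega) le_rfl e).symm)
      ((h b hab (by omega) e).2 he)).symm

/-- The vertex `v_4` keeps its three edges at every stage in which its house is present. The first
`m` houses are always present, the others in graphs 1 to 19. -/
theorem nx_four_eq (hs : 0 < s) (Φ : SimultaneousEmbedding (netSequence hm hN A B C hmN)) {i : ℕ}
    (hi : 1 ≤ i ∧ i ≤ N) {a b : ℕ} (hab : a ≤ b) (hb : b < 21)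
    (h : i ≤ m ∨ 1 ≤ a ∧ b ≤ 19) :
    (embAt Φ b hb).nx (.house i 4) (.wall i 3) =
      (embAt Φ a (hab.trans_lt hb)).nx (.house i 4) (.wall i 3) := by
  refine nx_eq_of_inc hs Φ hab hb (p := fun e => e ∈ [VillageEdge.wall i 3, .wall i 4, .claw i 2])
    (fun n h1 h2 e => ((incList_four (stages hm hN A B C n).size_le _ _ ⟨hi.1, ?_⟩).2 e).symm)
    (by simp)
  rcases h with h | h
  · exact h.trans (stages_size_ge hm hN A B C hmN n)
  · rw [stages_size hm hN A B C (by omega) (by omega)]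
    exact hi.2

theorem centre_inc {π : Page N} {t : ℕ} (e : VillageEdge) :
    (net hN π t).Inc e .centre ↔ ∃ k, (1 ≤ k ∧ k ≤ 4 * s) ∧ e = .spoke k := by
  constructor
  · intro h
    obtain ⟨h1, h2⟩ := net_inc_iff.1 h
    cases e with
    | spoke k => exact ⟨k, h1, rfl⟩
    | surface k => simp [netEnds] at h2
    | wall i k =>
      simp only [netEnds, houseVertex] at h2
      split_ifs at h2 <;> simp at h2
    | claw i k =>
      simp only [netEnds] at h2
      split_ifs at h2 <;> simp at h2
  · rintro ⟨k, hk, rfl⟩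
    exact (net_spoke hk).inc_left

theorem emb_eq_of_nx {α : Type*} {β : Type*} {G : Graph α β} {σ τ : PlanarEmbedding G}
    (h : ∀ x e, G.Inc e x → σ.nx x e = τ.nx x e) : σ = τ := by
  have h3 : σ.next = τ.next := Equiv.ext fun d => Dart.ext'
    ((vertex_next σ.isCycleOn d).trans (vertex_next τ.isCycleOn d).symm) (by
      rw [← σ.nx_dart, ← τ.nx_dart, h _ _ d.inc])
  cases σ
  cases τ
  cases h3
  rfl

/-- The vertices whose rotations determine a village, namely the centre, rim vertex 2 and all `v_4`,
keep their edges throughout. -/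
theorem embAt_last_eq (hs : 0 < s) (Φ : SimultaneousEmbedding (netSequence hm hN A B C hmN)) :
    (embAt Φ 20 (by norm_num) : PlanarEmbedding (net hm (Page.id m) 1)) =
      embAt Φ 0 (by norm_num) := by
  refine emb_eq_of_nx fun x e he => ?_
  refine village_rigid hs (fun e he => ?_) ?_ (fun i hi => ?_) he
  · exact nx_eq_of_inc hs Φ (a := 0) (b := 20) (by norm_num) (by norm_num)
      (fun n _ _ e => centre_inc (hN := (stages hm hN A B C n).size_le) e) ((centre_inc e).1 he)
  · exact nx_eq_of_inc hs Φ (a := 0) (b := 20) (by norm_num) (by norm_num)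
      (p := fun e => e ∈ [VillageEdge.surface (prevRim s 2), .surface 2, .spoke 2])
      (fun n _ _ e => ((incList_rim (stages hm hN A B C n).size_le _ _ ⟨by norm_num, by omega⟩
        (by norm_num)).2 e).symm) (by simp [prevRim])
  · exact nx_four_eq hs Φ ⟨hi.1, hi.2.trans hmN⟩ (by norm_num) (by norm_num) (Or.inl hi.2)

end

/-! ### The housing sequence -/

theorem IncList.degree_eq {α : Type*} {β : Type*} {G : Graph α β} {x : α} {l : List β}
    (h : IncList G x l) : degree G x = l.length := by
  classical
  have h1 : G.incidenceSet x = (l.toFinset : Set β) := by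
    ext e
    exact ((List.mem_toFinset).trans (h.2 e)).symm
  rw [degree, h1, Set.ncard_coe_finset, List.toFinset_card_of_nodup h.1]

/-- Equality as an isomorphism. -/
def GraphIso.ofEq {α : Type*} {β : Type*} {G H : Graph α β} (h : G = H) : GraphIso G H where
  onV := id
  onE := id
  bijV := h ▸ Set.bijOn_id _
  bijE := h ▸ Set.bijOn_id _
  map_isLink _ _ _ h' := h ▸ h'

theorem GraphIso.ofEq_carries {α : Type*} {β : Type*} {G H : Graph α β} (h : G = H)
    (σ : PlanarEmbedding H) : ∃ τ : PlanarEmbedding G, (GraphIso.ofEq h).Carries τ σ := by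
  subst h
  exact ⟨σ, fun _ => rfl⟩

section

variable {s N m : ℕ}

theorem degree_centre (hN : N ≤ s) (π : Page N) (t : ℕ) :
    degree (net hN π t) .centre = 4 * s := by
  have h1 : IncList (net hN π t) .centre ((List.range (4 * s)).map fun k => .spoke (k + 1)) := by
    refine ⟨netRot_nodup (π := π) (fun _ => true) (x := .centre) trivial, fun e => ?_⟩
    rw [centre_inc, List.mem_map]
    constructor
    · rintro ⟨k, hk, rfl⟩
      rw [List.mem_range] at hk
      exact ⟨k + 1, by omega, rfl⟩
    · rintro ⟨k, hk, rfl⟩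
      exact ⟨k - 1, List.mem_range.2 (by omega), congrArg _ (by omega)⟩
  rw [h1.degree_eq]
  simp

/-- The centre has degree `4 * s`, every other vertex at most 4. For `s = 1` a house end on the rim
could also have degree 4, whence the condition that there are no houses then. -/
theorem degree_lt_centre (hN : N ≤ s) (π : Page N) (t : ℕ) (hs : 0 < s) (h1 : s = 1 → N = 0)
    {x : VillageVertex} (hx : x ∈ (net hN π t).vertexSet) (hne : x ≠ .centre) :
    degree (net hN π t) x < degree (net hN π t) .centre := by
  rw [degree_centre]
  rcases Nat.lt_or_ge 1 s with h | h
  · rw [(isRot_netList hN π t (fun _ => true) x hx).degree_eq]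
    have h2 : (netRot s π.mate (fun _ => true) x).length ≤ 4 := by
      cases x with
      | centre => exact absurd rfl hne
      | _ =>
        simp only [netRot]
        (try split_ifs) <;> simp
    have h3 : (netList s N π.mate t (fun _ => true) x).length ≤ _ := List.length_filter_le _ _
    omega
  · have hN0 := h1 (by omega)
    cases x with
    | centre => exact absurd rfl hne
    | rim k =>
      rw [(incList_rim hN π t hx (Or.inr (Or.inr (by omega)))).degree_eq]
      simp only [List.length_cons, List.length_nil]
      omega
    | house i k =>
      have : 1 ≤ i ∧ i ≤ N := hx.1.1
      omega
    | inhabitant i =>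
      have : 1 ≤ i ∧ i ≤ N := hx.1
      omega

theorem planet_mem_net (hN : N ≤ s) (π : Page N) (t : ℕ) {x : VillageVertex}
    (hx : x ∈ (planet s).vertexSet) : x ∈ (net hN π t).vertexSet := by
  cases x with
  | centre => trivial
  | rim k => exact hx
  | house i k => exact absurd hx.1.1 (Set.notMem_empty _)
  | inhabitant i => exact absurd hx.1 (Set.notMem_empty _)

theorem planet_isLink_net (hN : N ≤ s) (π : Page N) (t : ℕ) {e : VillageEdge}
    {x y : VillageVertex} (h : (planet s).IsLink e x y) : (net hN π t).IsLink e x y := by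
  obtain ⟨h1, h2⟩ := h
  cases e with
  | spoke k => exact ⟨h1, h2⟩
  | surface k => exact ⟨h1, h2⟩
  | wall i k => exact absurd h1.1.1 (Set.notMem_empty _)
  | claw i k => exact absurd h1.1.1 (Set.notMem_empty _)

/-- The housing sequence for three pages. -/
def netHousing (hm : m ≤ s) (hN : N ≤ s) (A B C : Page N) (hmN : m ≤ N) (hs : 0 < s)
    (h1 : s = 1 → N = 0) : HousingSequence VillageVertex VillageEdge (Set.Icc 1 m) s where
  toHybridDeletionSequence := netSequence hm hN A B C hmN
  index_subset := Set.Icc_subset_Icc_right hm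
  twoConnected i := net_twoConnected (stages hm hN A B C i).size_le _ _ hs
  first := GraphIso.ofEq (net_one hm (Page.id m)).symm
  last := GraphIso.ofEq (net_one hm (Page.id m)).symm
  last_onV _ _ := rfl
  last_onE _ _ := rfl
  planet_mem i _ hx := planet_mem_net (stages hm hN A B C i).size_le _ _ hx
  planet_isLink i _ _ _ h := planet_isLink_net (stages hm hN A B C i).size_le _ _ h
  degree_lt i _ hx hne := degree_lt_centre (stages hm hN A B C i).size_le _ _ hs
    (fun h => Nat.le_zero.1 (h1 h ▸ stages_size_le hm hN A B C hmN i)) hx hne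
  same_embedding Φ := by
    obtain ⟨τ, hτ⟩ := GraphIso.ofEq_carries (net_one hm (Page.id m)).symm (embAt Φ 0 (by norm_num))
    refine ⟨τ, hτ, ?_⟩
    have h := embAt_last_eq hs Φ
    have hτ' : (GraphIso.ofEq (net_one hm (Page.id m)).symm).Carries τ
        (embAt Φ 20 (by norm_num) : PlanarEmbedding (net hm (Page.id m) 1)) := h ▸ hτ
    exact hτ'

variable {hm : m ≤ s} {hN : N ≤ s} {A B C : Page N} {hmN : m ≤ N} {hs : 0 < s}
  {h1 : s = 1 → N = 0}

theorem truthValue_eq_true {α : Type*} {β : Type*} {I : Set ℕ} {G : Graph α β}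
    (θ : GraphIso (village s I) G) (σ : PlanarEmbedding G) (i : ℕ) : truthValue θ σ i = true ↔
      ¬ σ.SameSide (θ.onE '' boundingCycle i) (θ.onV (.inhabitant i)) (θ.onV .centre) := by
  simp [truthValue]

theorem allocation_eq (Φ : SimultaneousEmbedding (netSequence hm hN A B C hmN))
    (i : Set.Icc 1 m) :
    (netHousing hm hN A B C hmN hs h1).allocation Φ i = true ↔
      ((embAt Φ 0 (by norm_num)).nx (.house i 4) (.wall i 3) = .wall i 4 ↔
        (embAt Φ 0 (by norm_num)).nx (.rim 2) (.surface 1) = .surface 2) := by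
  obtain ⟨i, hi⟩ := i
  obtain ⟨i, rfl⟩ : ∃ j, i = j + 1 := ⟨i - 1, by have := hi.1; omega⟩
  have h2 := sameSide_iff (hN := hm) (π := Page.id m) (σ := embAt Φ 0 (by norm_num)) hi.2
  have h3 : (netHousing hm hN A B C hmN hs h1).allocation Φ ⟨i + 1, hi⟩ = true ↔
      ¬ (embAt Φ 0 (by norm_num) : PlanarEmbedding (net hm (Page.id m) 1)).SameSide
        (id '' boundingCycle (i + 1)) (.inhabitant (i + 1)) .centre :=
    truthValue_eq_true (GraphIso.ofEq (net_one hm (Page.id m)).symm) (embAt Φ 0 (by norm_num)) _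
  rw [Set.image_id] at h3
  exact h3.trans ((not_congr h2).trans not_not)

/-- The common values are read off the second graph, which contains all `N` houses; the fourth
stages of the three pages, graphs 4, 10 and 16, provide the equalities. -/
theorem allocation_eq_of_page (Φ : SimultaneousEmbedding (netSequence hm hN A B C hmN))
    (hs : 0 < s) : ∃ g : ℕ → Bool, (∀ i, g (A.mate i) = g i) ∧ (∀ i, g (B.mate i) = g i) ∧
      (∀ i, g (C.mate i) = g i) ∧ ∀ i, 1 ≤ i ∧ i ≤ m → (g i = true ↔
        (embAt Φ 0 (by norm_num)).nx (.house i 4) (.wall i 3) = .wall i 4) := by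
  classical
  let γ : ℕ → Prop := fun i => (embAt Φ 1 (by norm_num)).nx (.house i 4) (.wall i 3) = .wall i 4
  have key : ∀ (π : Page N), (∀ i, 1 ≤ i ∧ i ≤ N → i < π.mate i → (γ i ↔ γ (π.mate i))) →
      ∀ i, decide (γ (π.mate i) ∨ ¬ (1 ≤ π.mate i ∧ π.mate i ≤ N)) =
        decide (γ i ∨ ¬ (1 ≤ i ∧ i ≤ N)) := by
    intro π hπ i
    by_cases hi : 1 ≤ i ∧ i ≤ N
    · have hi' : 1 ≤ π.mate i ∧ π.mate i ≤ N := π.mem hi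
      have h2 : γ i ↔ γ (π.mate i) := by
        rcases Nat.lt_trichotomy i (π.mate i) with h | h | h
        · exact hπ i hi h
        · rw [← h]
        · have h3 := hπ (π.mate i) hi' (by rwa [π.invol])
          rw [π.invol] at h3
          exact h3.symm
      simp [hi, hi', h2]
    · rw [π.fixed i hi]
  have link : ∀ n (hn : n < 21), 1 ≤ n → n ≤ 19 → ∀ i, 1 ≤ i ∧ i ≤ N →
      (γ i ↔ (embAt Φ n hn).nx (.house i 4) (.wall i 3) = .wall i 4) := fun n hn h2 h3 i hi => by
    rw [nx_four_eq hs Φ hi h2 hn (Or.inr ⟨le_rfl, h3⟩)]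
  -- Indices without a house get the value true; pages fix them.
  refine ⟨fun i => decide (γ i ∨ ¬ (1 ≤ i ∧ i ≤ N)), key A fun i hi h => ?_,
    key B fun i hi h => ?_, key C fun i hi h => ?_, fun i hi => ?_⟩
  · rw [link 4 (by norm_num) (by norm_num) (by norm_num) i hi,
      link 4 (by norm_num) (by norm_num) (by norm_num) _ (A.mem hi)]
    exact nx_linked hi h
  · rw [link 10 (by norm_num) (by norm_num) (by norm_num) i hi,
      link 10 (by norm_num) (by norm_num) (by norm_num) _ (B.mem hi)]
    exact nx_linked hi h
  · rw [link 16 (by norm_num) (by norm_num) (by norm_num) i hi,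
      link 16 (by norm_num) (by norm_num) (by norm_num) _ (C.mem hi)]
    exact nx_linked hi h
  · have hi' : 1 ≤ i ∧ i ≤ N := ⟨hi.1, hi.2.trans hmN⟩
    have h2 := nx_four_eq hs Φ hi' (a := 0) (b := 1) (by norm_num) (by norm_num) (Or.inl hi.2)
    simp only [hi', and_self, not_true_eq_false, or_false, decide_eq_true_eq, γ]
    rw [h2]

theorem netEmb_four (hN : N ≤ s) (π : Page N) (hs : 0 < s) {t : ℕ} (ht : 1 ≤ t ∧ t ≤ 4)
    {g : ℕ → Bool} (hg : ∀ i, g (π.mate i) = g i) {i : ℕ} (hi : 1 ≤ i ∧ i ≤ N) :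
    (netEmb hN π hs ht hg).nx (.house i 4) (.wall i 3) = .wall i 4 ↔ g i = true := by
  classical
  rw [netEmb_nx hs ht hg (((incList_four hN π t hi).2 _).1 (by simp))]
  cases hgi : g i
  · have h : netList s N π.mate t g (.house i 4) = [.wall i 3, .claw i 2, .wall i 4] := by
      simp [netList, netRot, NetEdge, hi, hgi]
    rw [h, List.formPerm_apply_head _ _ _ (by simp)]
    simp
  · have h : netList s N π.mate t g (.house i 4) = [.wall i 3, .wall i 4, .claw i 2] := by
      simp [netList, netRot, NetEdge, hi, hgi]
    rw [h, List.formPerm_apply_head _ _ _ (by simp)]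
    simp

theorem netEmb_rim_two (hN : N ≤ s) (π : Page N) (hs : 0 < s) {t : ℕ} (ht : 1 ≤ t ∧ t ≤ 4)
    {g : ℕ → Bool} (hg : ∀ i, g (π.mate i) = g i) :
    (netEmb hN π hs ht hg).nx (.rim 2) (.surface 1) = .surface 2 := by
  classical
  have h := net_surface_prev (hN := hN) (π := π) (t := t) (k := 2) (by omega)
  rw [prevRim_add_one s 1 (by norm_num)] at h
  rw [netEmb_nx hs ht hg h.inc_right]
  have n2 : 2 ≤ 4 * s := by omega
  have n1 : 1 ≤ 4 * s := by omega
  have h2 : netList s N π.mate t g (.rim 2) = [.surface 1, .surface 2, .spoke 2] := by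
    simp [netList, netRot, NetEdge, n1, n2]
  rw [h2, List.formPerm_apply_head _ _ _ (by simp)]

/-- Every assignment that is constant on the pairs of all pages is realized. -/
theorem exists_allocation (hs : 0 < s) {g : ℕ → Bool} (hA : ∀ i, g (A.mate i) = g i)
    (hB : ∀ i, g (B.mate i) = g i) (hC : ∀ i, g (C.mate i) = g i) :
    ∃ Φ : SimultaneousEmbedding (netSequence hm hN A B C hmN),
      ∀ i : Set.Icc 1 m, (netHousing hm hN A B C hmN hs h1).allocation Φ i = g i := by
  have hl := stages_level hm hN A B C
  have hp := stages_page hm hN A B C hA hB hC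
  -- The same `g` is used at every stage; at each step the rotation lists of the larger net restrict
  -- to those of the smaller.
  let Φ : SimultaneousEmbedding (netSequence hm hN A B C hmN) :=
    SimultaneousEmbedding.ofInduced rfl (netSequence_sparse hm hN A B C hmN hs)
      (netSequence_compatible hm hN A B C hmN)
      (fun i => (stages hm hN A B C i).emb hs (hl i) (hp i)) fun i => by
        rcases stages_sub hm hN A B C hmN i.2 with h | h
        · exact Or.inl ⟨h.le, h.induced hs (hl _) (hl _) (hp _) (hp _)⟩
        · exact Or.inr ⟨h.le, h.induced hs (hl _) (hl _) (hp _) (hp _)⟩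
  refine ⟨Φ, fun i => ?_⟩
  rw [Bool.eq_iff_iff]
  refine (allocation_eq Φ i).trans ?_
  have h2 := netEmb_four hm (Page.id m) hs (t := 1) (by norm_num) (g := g) (fun _ => rfl) i.2
  have h3 := netEmb_rim_two hm (Page.id m) hs (t := 1) (by norm_num) (g := g) (fun _ => rfl)
  exact ⟨fun h => h2.1 (h.2 h3), fun h => ⟨fun _ => h3, fun _ => h2.2 h⟩⟩

end

/-! ### The pages that implement equalities -/

/-- A page given by an involution of `{0, …, N - 1}`. -/
def Page.ofFun {N : ℕ} (f : ℕ → ℕ) (hlt : ∀ q < N, f q < N) (hinv : ∀ q < N, f (f q) = q)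
    (hnc : ∀ p q, q < N → p < q → q < f p → f q < f p) : Page N where
  mate i := if 1 ≤ i ∧ i ≤ N then f (i - 1) + 1 else i
  invol i := by
    by_cases h : 1 ≤ i ∧ i ≤ N
    · have h1 := hlt (i - 1) (by omega)
      have h2 := hinv (i - 1) (by omega)
      rw [if_pos h, if_pos ⟨by omega, by omega⟩, Nat.add_sub_cancel, h2]
      omega
    · rw [if_neg h, if_neg h]
  fixed i h := if_neg h
  nonCrossing i j h h' := by
    by_cases hi : 1 ≤ i ∧ i ≤ N
    · rw [if_pos hi] at h' ⊢
      have h1 := hlt (i - 1) (by omega)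
      have h2 := hnc (i - 1) (j - 1) (by omega) (by omega) (by omega)
      rw [if_pos ⟨by omega, by omega⟩]
      omega
    · rw [if_neg hi] at h'
      omega

theorem Page.ofFun_inv {N : ℕ} {f : ℕ → ℕ} {hlt : ∀ q < N, f q < N} {hinv : ∀ q < N, f (f q) = q}
    {hnc : ∀ p q, q < N → p < q → q < f p → f q < f p} {g : ℕ → Bool} :
    (∀ i, g ((Page.ofFun f hlt hinv hnc).mate i) = g i) ↔ ∀ q < N, g (f q + 1) = g (q + 1) := by
  constructor
  · intro h q hq
    have h1 := h (q + 1)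
    simp only [Page.ofFun] at h1
    rwa [if_pos ⟨by omega, by omega⟩, Nat.add_sub_cancel] at h1
  · intro h i
    simp only [Page.ofFun]
    split_ifs with hi
    · have h1 := h (i - 1) (by omega)
      rwa [Nat.sub_add_cancel hi.1] at h1
    · rfl

/-- The column of a site, when consecutive blocks of `m` sites are traversed in opposite
directions. -/
def column (m q : ℕ) : ℕ := if q / m % 2 = 0 then q % m else m - 1 - q % m

/-- The site in block `b` and column `a`. -/
def site (m b a : ℕ) : ℕ := m * b + if b % 2 = 0 then a else m - 1 - a

section

variable {m : ℕ}

theorem site_div {b a : ℕ} (ha : a < m) : site m b a / m = b := by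
  rw [site, Nat.mul_add_div (by omega), Nat.div_eq_of_lt (by split_ifs <;> omega), add_zero]

theorem site_mod {b a : ℕ} (ha : a < m) :
    site m b a % m = if b % 2 = 0 then a else m - 1 - a := by
  rw [site, Nat.mul_add_mod, Nat.mod_eq_of_lt (by split_ifs <;> omega)]

theorem column_site {b a : ℕ} (ha : a < m) : column m (site m b a) = a := by
  rw [column, site_div ha, site_mod ha]
  split_ifs <;> omega

theorem column_lt (hm : 0 < m) (q : ℕ) : column m q < m := by
  have := Nat.mod_lt q hm
  unfold column
  split_ifs <;> omega

theorem site_column (hm : 0 < m) (q : ℕ) : site m (q / m) (column m q) = q := by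
  have h1 := Nat.mod_lt q hm
  have h2 := Nat.div_add_mod q m
  unfold site column
  split_ifs <;> omega

theorem site_lt {b a M : ℕ} (hb : b < M) (ha : a < m) : site m b a < m * M := by
  rw [mul_comm]
  exact (Nat.div_lt_iff_lt_mul (by omega)).1 (by rwa [site_div ha])

/-- Houses of the same column in consecutive blocks are mirror images with a common centre, so the
pairs between two blocks are nested. -/
theorem site_add_site {b a : ℕ} (ha : a < m) :
    site m b a + site m (b + 1) a + 1 = 2 * (m * b) + 2 * m := by
  have h : m * (b + 1) = m * b + m := by ring
  unfold site
  rw [h]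
  split_ifs <;> omega

/-- The block that is paired with block `b` of `M` blocks, when blocks of parity `p` are paired with
their successors. -/
def pairBlock (M p b : ℕ) : ℕ :=
  if b % 2 = p then if b + 1 < M then b + 1 else b else if 0 < b then b - 1 else b

theorem pairBlock_lt {M p b : ℕ} (hb : b < M) : pairBlock M p b < M := by
  unfold pairBlock
  split_ifs <;> omega

theorem pairBlock_pairBlock {M p b : ℕ} (hp : p < 2) (hb : b < M) :
    pairBlock M p (pairBlock M p b) = b := by
  unfold pairBlock
  split_ifs <;> omega

/-- The page on `M` blocks of `m` sites which pairs blocks by `pairBlock M p`. -/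
def blockPage (hm : 0 < m) (M p : ℕ) (hp : p < 2) : Page (m * M) :=
  Page.ofFun (fun q => site m (pairBlock M p (q / m)) (column m q))
    (fun q hq => site_lt (pairBlock_lt ((Nat.div_lt_iff_lt_mul hm).2 (by rwa [mul_comm])))
      (column_lt hm q))
    (fun q hq => by
      rw [site_div (column_lt hm q), column_site (column_lt hm q), pairBlock_pairBlock hp
        ((Nat.div_lt_iff_lt_mul hm).2 (by rwa [mul_comm])), site_column hm])
    (fun x y hy hxy hlt => by
      have ex := site_column hm x
      have ey := site_column hm y
      have cx := column_lt hm x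
      have cy := column_lt hm y
      have hM : y / m < M := (Nat.div_lt_iff_lt_mul hm).2 (by rwa [mul_comm])
      have h1 : x / m ≤ y / m := Nat.div_le_div_right hxy.le
      have h2 := Nat.div_le_div_right (c := m) hlt.le
      rw [site_div cx] at h2
      generalize x / m = b at *
      generalize y / m = d at *
      generalize column m x = u at *
      generalize column m y = v at *
      -- A partner beyond `y > x` can only lie in the following block.
      have h3 : pairBlock M p b = b + 1 := by
        by_contra hne
        have h4 : pairBlock M p b = b := by
          unfold pairBlock at h2 hne ⊢
          split_ifs at h2 hne ⊢ <;> omega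
        rw [h4] at hlt
        omega
      have h4 : b % 2 = p ∧ b + 1 < M := by
        unfold pairBlock at h3
        split_ifs at h3 <;> omega
      rw [h3] at hlt h2 ⊢
      -- Both pairs have the same sum, so `x < y` reverses to the partners.
      have e1 := site_add_site (b := b) cx
      have e2 := site_add_site (b := b) cy
      obtain rfl | rfl : d = b ∨ d = b + 1 := by omega
      · rw [h3]
        omega
      · have h5 : pairBlock M p (b + 1) = b := by
          unfold pairBlock
          split_ifs <;> omega
        rw [h5]
        omega)

theorem blockPage_inv (hm : 0 < m) {M p : ℕ} (hp : p < 2) {g : ℕ → Bool} :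
    (∀ i, g ((blockPage hm M p hp).mate i) = g i) ↔ ∀ b < M, ∀ a < m,
      g (site m (pairBlock M p b) a + 1) = g (site m b a + 1) := by
  rw [blockPage, Page.ofFun_inv]
  constructor
  · intro h b hb a ha
    have h1 := h _ (site_lt hb ha)
    rwa [site_div ha, column_site ha] at h1
  · intro h q hq
    have h1 := h (q / m) ((Nat.div_lt_iff_lt_mul hm).2 (by rwa [mul_comm])) _ (column_lt hm q)
    rwa [site_column hm] at h1

open Classical in
/-- The column to which column `a` is moved in block `b` by the exchanges `Q`. -/
noncomputable def swapColumn (m : ℕ) (Q : ℕ → ℕ → Prop) (b a : ℕ) : ℕ :=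
  if Q (b / m) (b % m) then Equiv.swap (b / m) (b % m) a else a

theorem swapColumn_swapColumn (Q : ℕ → ℕ → Prop) (b a : ℕ) :
    swapColumn m Q b (swapColumn m Q b a) = a := by
  unfold swapColumn
  split_ifs <;> simp

theorem swapColumn_lt (Q : ℕ → ℕ → Prop) {b a : ℕ} (hb : b < m * m) (ha : a < m) :
    swapColumn m Q b a < m := by
  have h1 : b / m < m := (Nat.div_lt_iff_lt_mul (by omega)).2 hb
  have h2 := Nat.mod_lt b (show 0 < m by omega)
  unfold swapColumn
  split_ifs
  · rw [Equiv.swap_apply_def]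
    split_ifs <;> omega
  · exact ha

/-- Each block contains at most one exchanged pair, so no second pair can cross it. -/
theorem swapColumn_eq_or (Q : ℕ → ℕ → Prop) (b u v : ℕ) (huv : v ≠ u)
    (hu : swapColumn m Q b u ≠ u) (h : v ≠ swapColumn m Q b u) : swapColumn m Q b v = v := by
  unfold swapColumn at hu h ⊢
  split_ifs at hu h ⊢
  · rw [Equiv.swap_apply_def] at hu h ⊢
    split_ifs at hu h ⊢ <;> grind
  · rfl

/-- The page on `m * m` blocks of `m` sites which exchanges, in block `m * a + a'`, the columns `a`
and `a'` if `Q a a'`. -/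
noncomputable def swapPage (hm : 0 < m) (Q : ℕ → ℕ → Prop) : Page (m * (m * m)) :=
  Page.ofFun (fun q => site m (q / m) (swapColumn m Q (q / m) (column m q)))
    (fun q hq => by
      have hM : q / m < m * m := (Nat.div_lt_iff_lt_mul hm).2 (by rwa [mul_comm])
      exact site_lt hM (swapColumn_lt Q hM (column_lt hm q)))
    (fun q hq => by
      have hM : q / m < m * m := (Nat.div_lt_iff_lt_mul hm).2 (by rwa [mul_comm])
      have h1 := swapColumn_lt Q hM (column_lt hm q)
      rw [site_div h1, column_site h1, swapColumn_swapColumn, site_column hm])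
    (fun x y hy hxy hlt => by
      have ex := site_column hm x
      have ey := site_column hm y
      have hM : y / m < m * m := (Nat.div_lt_iff_lt_mul hm).2 (by rwa [mul_comm])
      have h1 : x / m ≤ y / m := Nat.div_le_div_right hxy.le
      have h3 := swapColumn_lt Q (h1.trans_lt hM) (column_lt hm x)
      have h2 := Nat.div_le_div_right (c := m) hlt.le
      rw [site_div h3] at h2
      -- Exchanges stay within a block, so anything below the link is in the same block.
      have h4 : y / m = x / m := le_antisymm h2 h1
      rw [h4] at ey ⊢
      rw [swapColumn_eq_or Q (x / m) (column m x) (column m y), ey]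
      · exact hlt
      · intro h
        rw [h] at ey
        omega
      · intro h
        rw [h] at hlt
        omega
      · intro h
        rw [← h] at hlt
        omega)

theorem swapPage_inv (hm : 0 < m) {Q : ℕ → ℕ → Prop} {g : ℕ → Bool} :
    (∀ i, g ((swapPage hm Q).mate i) = g i) ↔ ∀ b < m * m, ∀ a < m,
      g (site m b (swapColumn m Q b a) + 1) = g (site m b a + 1) := by
  rw [swapPage, Page.ofFun_inv]
  constructor
  · intro h b hb a ha
    have h1 := h _ (site_lt hb ha)
    rwa [site_div ha, column_site ha] at h1
  · intro h q hq
    have h1 := h (q / m) ((Nat.div_lt_iff_lt_mul hm).2 (by rwa [mul_comm])) _ (column_lt hm q)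
    rwa [site_column hm] at h1

end

/-- Three pages implement any set of equalities. -/
theorem exists_pages {m N : ℕ} (hN : N = m * (m * m)) (P : Set (Sym2 (Set.Icc 1 m : Set ℕ))) :
    ∃ A B C : Page N,
      (∀ g : ℕ → Bool, (∀ i, g (A.mate i) = g i) → (∀ i, g (B.mate i) = g i) →
        (∀ i, g (C.mate i) = g i) → (fun i : Set.Icc 1 m => g i) ∈ EQ P) ∧
      ∀ f ∈ EQ P, ∃ g : ℕ → Bool, (∀ i, g (A.mate i) = g i) ∧ (∀ i, g (B.mate i) = g i) ∧
        (∀ i, g (C.mate i) = g i) ∧ ∀ i : Set.Icc 1 m, g i = f i := by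
  subst hN
  rcases Nat.eq_zero_or_pos m with rfl | hm
  · refine ⟨Page.id _, Page.id _, Page.id _, fun g _ _ _ i => ?_, fun f _ => ⟨fun _ => true,
      fun _ => rfl, fun _ => rfl, fun _ => rfl, fun i => ?_⟩⟩ <;>
    · have := i.2.1
      have := i.2.2
      omega
  -- Columns are counted from 0 and houses from 1.
  let Q : ℕ → ℕ → Prop := fun a a' => ∃ (h : a + 1 ∈ Set.Icc 1 m) (h' : a' + 1 ∈ Set.Icc 1 m),
    s(⟨a + 1, h⟩, ⟨a' + 1, h'⟩) ∈ P
  refine ⟨blockPage hm (m * m) 0 (by norm_num), blockPage hm (m * m) 1 (by norm_num),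
    swapPage hm Q, fun g hA hB hC => ?_, fun f hf => ?_⟩
  · rw [blockPage_inv] at hA hB
    rw [swapPage_inv] at hC
    -- Even blocks are joined to their successors by the first page and odd ones by the second, so
    -- every block repeats block 0, which is the original village.
    have h1 : ∀ b < m * m, ∀ a < m, g (site m b a + 1) = g (a + 1) := by
      intro b
      induction b with
      | zero => intro _ a _; simp [site]
      | succ b ih =>
        intro hb a ha
        rw [← ih (by omega) a ha]
        rcases Nat.mod_two_eq_zero_or_one b with h | h
        · have := hA b (by omega) a ha
          rwa [pairBlock, if_pos h, if_pos hb] at this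
        · have := hB b (by omega) a ha
          rwa [pairBlock, if_pos h, if_pos hb] at this
    rintro ⟨i, hi⟩ ⟨j, hj⟩ hij
    have hi1 := hi.1
    have hi2 := hi.2
    have hj1 := hj.1
    have hj2 := hj.2
    obtain ⟨i, rfl⟩ : ∃ k, i = k + 1 := ⟨i - 1, by omega⟩
    obtain ⟨j, rfl⟩ : ∃ k, j = k + 1 := ⟨j - 1, by omega⟩
    have e1 : (m * i + j) / m = i := by
      rw [Nat.mul_add_div hm, Nat.div_eq_of_lt (by omega), add_zero]
    have e2 : (m * i + j) % m = j := by
      rw [Nat.mul_add_mod, Nat.mod_eq_of_lt (by omega)]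
    have hb : m * i + j < m * m := (Nat.div_lt_iff_lt_mul hm).1 (by omega)
    have h2 := hC _ hb i (by omega)
    have hQ : Q i j := ⟨hi, hj, hij⟩
    rw [swapColumn, e1, e2, if_pos hQ, Equiv.swap_apply_left, h1 _ hb _ (by omega),
      h1 _ hb _ (by omega)] at h2
    exact h2.symm
  · have hc := column_lt hm
    -- Extended by true beyond the columns; the assignment depends only on the column, which the
    -- first two pages preserve.
    let F : ℕ → Bool := fun a => if h : a + 1 ∈ Set.Icc 1 m then f ⟨a + 1, h⟩ else true
    have hF : ∀ b < m * m, ∀ a < m, F (swapColumn m Q b a) = F a := by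
      intro b hb a ha
      unfold swapColumn
      split_ifs with h
      · obtain ⟨h1, h2, h3⟩ := h
        have h4 : F (b / m) = F (b % m) := by
          simp only [F, dif_pos h1, dif_pos h2]
          exact hf _ _ h3
        rw [Equiv.swap_apply_def]
        split_ifs with h5 h6
        · rw [h5, h4]
        · rw [h6, h4]
        · rfl
      · rfl
    refine ⟨fun i => F (column m (i - 1)), ?_, ?_, ?_, ?_⟩
    · refine (blockPage_inv (g := fun i => F (column m (i - 1))) hm _).2 fun b hb a ha => ?_
      simp only [Nat.add_sub_cancel, column_site ha]
    · refine (blockPage_inv (g := fun i => F (column m (i - 1))) hm _).2 fun b hb a ha => ?_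
      simp only [Nat.add_sub_cancel, column_site ha]
    · refine (swapPage_inv (g := fun i => F (column m (i - 1))) hm).2 fun b hb a ha => ?_
      simp only [Nat.add_sub_cancel, column_site ha, column_site (swapColumn_lt Q hb ha)]
      exact hF b hb a ha
    · rintro ⟨i, hi⟩
      have hi1 := hi.1
      have hi2 := hi.2
      have h1 : column m (i - 1) = i - 1 := by
        rw [column, Nat.div_eq_of_lt (by omega), if_pos rfl, Nat.mod_eq_of_lt (by omega)]
      have h2 : i - 1 + 1 = i := by omega
      simp only [h1, F, h2, dif_pos hi]

/-- The total size is linear in `s`; the factor `s ^ (1 / 3)` is only used to absorb the constant.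
-/
theorem mul_le_rpow_four_thirds {c s : ℝ} (hc : 0 ≤ c) (hs : 0 < s) (h : c ^ 3 ≤ s) :
    c * s ≤ s ^ ((4 : ℝ) / 3) := by
  have h1 : s ^ ((4 : ℝ) / 3) = s ^ ((1 : ℝ) / 3) * s := by
    rw [← Real.rpow_add_one hs.ne']
    norm_num
  have h2 : (c ^ 3) ^ ((1 : ℝ) / 3) = c := by
    rw [← Real.rpow_natCast, ← Real.rpow_mul hc]
    norm_num
  rw [h1]
  refine mul_le_mul_of_nonneg_right ?_ hs.le
  calc c = (c ^ 3) ^ ((1 : ℝ) / 3) := h2.symm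
    _ ≤ s ^ ((1 : ℝ) / 3) := Real.rpow_le_rpow (by positivity) h (by norm_num)

theorem netSequence_size_le {s N m : ℕ} (hm : m ≤ s) (hN : N ≤ s) (A B C : Page N) (hmN : m ≤ N) :
    (netSequence hm hN A B C hmN).size ≤ 21 * (12 * s + 1 + 17 * N) := by
  have h : ∀ i ∈ (Finset.univ : Finset (Fin 21)),
      ((stages hm hN A B C i).graph.vertexSet.ncard +
        (stages hm hN A B C i).graph.edgeSet.ncard) ≤ 12 * s + 1 + 17 * N := by
    intro i _
    have h1 := (net_finite_vertexSet (stages hm hN A B C i).size_le (stages hm hN A B C i).page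
      (stages hm hN A B C i).level).2
    have h2 := (net_finite_edgeSet (stages hm hN A B C i).size_le (stages hm hN A B C i).page
      (stages hm hN A B C i).level).2
    have h3 := stages_size_le hm hN A B C hmN i
    unfold Stage.graph
    omega
  have h4 := Finset.sum_le_card_nsmul _ _ _ h
  rw [Finset.card_univ, Fintype.card_fin, smul_eq_mul] at h4
  exact h4

theorem size_bound {m s : ℕ} (hs : m ^ 3 ≤ s) (hms : m < s) :
    ((21 * (12 * s + 1 + 17 * m ^ 3) : ℕ) : ℝ) ≤ 400 * (s : ℝ) ^ ((4 : ℝ) / 3) := by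
  have hs0 : (0 : ℝ) < s := by exact_mod_cast (by omega : 0 < s)
  have key : ∀ c : ℝ, 0 ≤ c → c ^ 3 ≤ s →
      ((21 * (12 * s + 1 + 17 * m ^ 3) : ℕ) : ℝ) ≤ 400 * (c * s) →
      ((21 * (12 * s + 1 + 17 * m ^ 3) : ℕ) : ℝ) ≤ 400 * (s : ℝ) ^ ((4 : ℝ) / 3) :=
    fun c hc h h' => h'.trans (mul_le_mul_of_nonneg_left (mul_le_rpow_four_thirds hc hs0 h)
      (by norm_num))
  have hs' : ((m : ℝ)) ^ 3 ≤ s := by exact_mod_cast hs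
  push_cast at key ⊢
  obtain rfl | rfl | hm : m = 0 ∨ m = 1 ∨ 2 ≤ m := by omega
  · have h1 : (1 : ℝ) ≤ s := by exact_mod_cast hms
    refine key 1 (by norm_num) (by linarith) ?_
    norm_num
    linarith
  · have h1 : (2 : ℝ) ≤ s := by exact_mod_cast hms
    -- `(5 / 4) ^ 3 = 125 / 64` is still at most `2 ≤ s`, while factor 1 would be too small here
    -- when `s = 2`.
    refine key (5 / 4) (by norm_num) (by linarith) ?_
    norm_num
    linarith
  · have h1 : 8 ≤ s := le_trans (by simpa using Nat.pow_le_pow_left hm 3) hs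
    have h2 : (8 : ℝ) ≤ s := by exact_mod_cast h1
    refine key 2 (by norm_num) (by linarith) ?_
    linarith

end HousingSeq

theorem mainTheorem8 (m s : ℕ) (hs : m ^ 3 ≤ s) (hms : m < s)
    (P : Set (Sym2 (Set.Icc 1 m : Set ℕ))) (hP : P ⊆ {e | ¬ e.IsDiag}) :
    ∃ (α β : Type) (S : HousingSeq.HousingSequence α β (Set.Icc 1 m) s),
      S.length ≤ 27 ∧ (S.size : ℝ) ≤ 400 * (s : ℝ) ^ ((4 : ℝ) / 3) ∧
        S.allocationSet = HousingSeq.EQ P := by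
  obtain ⟨A, B, C, h1, h2⟩ := HousingSeq.exists_pages (N := m ^ 3) (by ring) P
  have hmN : m ≤ m ^ 3 := Nat.le_self_pow (by norm_num) m
  have hs0 : 0 < s := by omega
  have hs1 : s = 1 → m ^ 3 = 0 := by
    intro h
    obtain rfl : m = 0 := by omega
    norm_num
  refine ⟨_, _, HousingSeq.netHousing hms.le hs A B C hmN hs0 hs1, by
    show 20 + 1 ≤ 27
    norm_num, ?_, ?_⟩
  · refine le_trans (Nat.cast_le.2 ?_) (HousingSeq.size_bound hs hms)
    exact HousingSeq.netSequence_size_le hms.le hs A B C hmN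
  · ext f
    constructor
    -- Truth values compare houses with the same planet, so equal directions at `v_4` mean equal
    -- truth values.
    · rintro ⟨Φ, rfl⟩ i j hij
      obtain ⟨g, hA, hB, hC, hg⟩ := HousingSeq.allocation_eq_of_page Φ hs0
      have h3 : g i = g j := h1 g hA hB hC i j hij
      have hi := (hg i i.2).symm
      rw [h3, hg j j.2] at hi
      have h4 := HousingSeq.allocation_eq (hm := hms.le) (hN := hs) (hs := hs0) (h1 := hs1)
        (hmN := hmN) (A := A) (B := B) (C := C) Φ
      exact Bool.eq_iff_iff.2 ((h4 i).trans ((iff_congr hi Iff.rfl).trans (h4 j).symm))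
    · intro hf
      obtain ⟨g, hA, hB, hC, hg⟩ := h2 f hf
      obtain ⟨Φ, hΦ⟩ := HousingSeq.exists_allocation hs0 hA hB hC
      exact ⟨Φ, funext fun i => (hΦ i).trans (hg i)⟩
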